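/- Let $n>1$ and let $(M^{2n+1},\alpha)$ be a closed contact manifold, oriented by $\alpha\wedge(d\alpha)^n>0$. Let $\mathcal O$ be an open-book decomposition of $M$ with binding a closed manifold $N^{2n-1}$: the page coordinate $e^{i\theta}\colon M\setminus N\to S^1$ is a smooth submersion, and it is the polar angle in some tubular neighbourhood of $N$. Suppose that $\mathcal O$ supports $(M,\alpha)$ by means of a smooth function $\rho>0$, i.e. $\alpha|_N$ is a contact form and $d\theta\wedge(d(\rho\alpha))^n>0$ on $M\setminus N$. Suppose moreover that $\rho\alpha$ is axisymmetric near the binding: in some tubular neighbourhood $N\times D^2$ of $N$ ($D^2$ the closed unit disk with polar coordinates $(r,\theta)$, where $\theta$ is the page coordinate), $\rho\alpha=f(r)\,\mu+g(r)\,d\theta$, where $\mu$ is the pull-back of $\rho\alpha|_N$ under the projection $N\times D^2\to N$, $f>0$, $f'<0$ on $(0,1]$, and $g$ is weakly increasing with $g(r)=r^2$ near $r=0$ and $g(r)=1$ near $r=1$. Finally suppose that $N$ carries a nowhere vanishing closed $1$-form $\nu$ with $\nu\wedge(d(\rho\alpha|_N))^{n-1}\equiv0$. Then there is a family of $1$-forms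 $\alpha_t$, $0\le t\le1$, on $M$, smooth in $(t,p)\in[0,1]\times M$ (so $\alpha_t\to\alpha_1$ in $C^\infty$ as $t\to1$), such that $\alpha_0=\rho\alpha$, $\alpha_t\wedge(d\alpha_t)^n>0$ for $0\le t<1$, $\alpha_1$ vanishes nowhere, $\alpha_1\wedge d\alpha_1\equiv0$, and $\ker\alpha_1$ is a spinnable foliation associated with $\mathcal O$. Thus the contact structure $\ker\alpha$ deforms through contact structures to a spinnable foliation. Here the foliation $\ker\omega$ of a nowhere vanishing $1$-form $\omega$ with $\omega\wedge d\omega\equiv0$ is called a spinnable foliation associated with $\mathcal O$ if $N$ is fibred over $S^1$ and, for some tubular neighbourhood $N\times D^2$ of $N$ whose polar angle is the page coordinate, $\omega$ is a positive multiple of $d\theta$ outside $N\times D^2$, while on $N\times D^2$ one has $\omega=a(r)\,\nu'+b(r)\,d\theta+c(r)\,dr$ with $\nu'$ the pull-back of a nowhere vanishing closed $1$-form on $N$ and $a,b,c$ smooth, $a>0$ on $[0,\frac12)$, $a=0$ on $[\frac12,1]$, $b=0$ on $[0,\frac12]$, $b>0$ on $(\frac12,1]$, $c(\frac12)\ne0$,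 and $c=0$ near $r=0$ and near $r=1$. -/

import Mathlib

open scoped Manifold ContDiff

noncomputable section

namespace ContactFoliation

/-- The Euclidean model space of dimension `d`. -/
abbrev Model (d : ℕ) : Type := EuclideanSpace ℝ (Fin d)

section Forms

variable {d : ℕ} {M : Type*} [TopologicalSpace M] [ChartedSpace (Model d) M]

variable (d M) in
/-- A (not necessarily smooth) differential `1`-form on the `d`-dimensional manifold `M`:
a covector on each tangent space. -/
abbrev OneForm : Type _ := ∀ p : M, TangentSpace (𝓡 d) p →L[ℝ] Bundle.Trivial M ℝ p

/-- A family `A t` of `1`-forms is smooth for `t ∈ s` when `(t, p) ↦ (A t) p`, as a map into the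
cotangent bundle, is jointly smooth on `s × M`. For `s = [0,1]` and `M` compact this says in
particular that `A t` converges to `A 1` in the `C^∞` topology as `t → 1`. -/
def IsSmoothFamilyOn [IsManifold (𝓡 d) ∞ M] (A : ℝ → OneForm d M) (s : Set ℝ) : Prop :=
  ContMDiffOn (𝓘(ℝ, ℝ).prod (𝓡 d)) ((𝓡 d).prod 𝓘(ℝ, Model d →L[ℝ] ℝ)) ∞
    (fun q : ℝ × M ↦ Bundle.TotalSpace.mk' (Model d →L[ℝ] ℝ)
      (E := fun p : M ↦ TangentSpace (𝓡 d) p →L[ℝ] Bundle.Trivial M ℝ p) q.2 (A q.1 q.2))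
    (s ×ˢ Set.univ)

/-- Smoothness of a `1`-form, as a section of the cotangent bundle. -/
def IsSmooth [IsManifold (𝓡 d) ∞ M] (α : OneForm d M) : Prop :=
  ContMDiff (𝓡 d) ((𝓡 d).prod 𝓘(ℝ, Model d →L[ℝ] ℝ)) ∞
    (fun p : M ↦ Bundle.TotalSpace.mk' (Model d →L[ℝ] ℝ)
      (E := fun p : M ↦ TangentSpace (𝓡 d) p →L[ℝ] Bundle.Trivial M ℝ p) p (α p))

/-- The expression of the `1`-form `α` in the preferred chart at `p`: its pull-back under the
inverse of that chart. -/
def localRep (α : OneForm d M) (p : M) (y : Model d) : Model d →L[ℝ] ℝ :=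
  (α ((extChartAt (𝓡 d) p).symm y)).comp
    (mfderiv 𝓘(ℝ, Model d) (𝓡 d) (extChartAt (𝓡 d) p).symm y)

/-- The exterior derivative `dα` at `p`, computed in the preferred chart at `p`; that chart is
also the one through which `TangentSpace (𝓡 d) p` is identified with the model space. -/
def dForm (α : OneForm d M) (p : M) : TangentSpace (𝓡 d) p [⋀^Fin 2]→L[ℝ] ℝ :=
  extDeriv (fun y ↦ ContinuousAlternatingMap.ofSubsingleton ℝ (Model d) ℝ (0 : Fin 1)
    (localRep α p y)) (extChartAt (𝓡 d) p p)

/-- The `(2k+1)`-form `β ∧ η ∧ ⋯ ∧ η` (with `k` factors `η`) on a vector space, for a `1`-form `β`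
and a `2`-form `η`:
`(β ∧ η^k)(v₀,…,v₂ₖ) = 2⁻ᵏ ∑_σ sign(σ) β(v_σ(0)) η(v_σ(1),v_σ(2)) ⋯ η(v_σ(2k-1),v_σ(2k))`. -/
def wedgePow {V : Type*} (β : V → ℝ) (η : (Fin 2 → V) → ℝ) (k : ℕ) (v : Fin (2 * k + 1) → V) : ℝ :=
  (2 ^ k : ℝ)⁻¹ * ∑ σ : Equiv.Perm (Fin (2 * k + 1)),
    ((Equiv.Perm.sign σ : ℤ) : ℝ) * β (v (σ 0)) *
      ∏ i : Fin k, η ![v (σ ⟨2 * i + 1, by omega⟩), v (σ ⟨2 * i + 2, by omega⟩)]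

/-- The value of the `(2k+1)`-form `β ∧ (dα)^k` at the point `p`. -/
def wedgeD (β α : OneForm d M) (k : ℕ) (p : M)
    (v : Fin (2 * k + 1) → TangentSpace (𝓡 d) p) : ℝ :=
  wedgePow (fun u ↦ β p u) (fun u ↦ dForm α p u) k v

/-- `α` is a contact form on a manifold of dimension `2 * k + 1`: it is smooth and
`α ∧ (dα)^k` vanishes at no point. -/
def IsContactForm [IsManifold (𝓡 d) ∞ M] (k : ℕ) (α : OneForm d M) : Prop :=
  IsSmooth α ∧ ∀ p : M, ∃ v, wedgeD α α k p v ≠ 0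

/-- The pull-back of a `1`-form under a map. -/
def pullback {d' : ℕ} {N : Type*} [TopologicalSpace N] [ChartedSpace (Model d') N]
    (F : N → M) (α : OneForm d M) : OneForm d' N :=
  fun x ↦ (α (F x)).comp (mfderiv (𝓡 d') (𝓡 d) F x)

/-- The product of a function and a `1`-form. -/
def fmul (ρ : M → ℝ) (α : OneForm d M) : OneForm d M := fun p ↦ ρ p • α p

/-- The `1`-form `dθ` of a circle-valued map `exp(iθ)`, that is, the imaginary part of
`exp(-iθ) d(exp(iθ))`. -/
def angleForm (ϑ : M → Circle) : OneForm d M := fun p ↦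
  Complex.imCLM.comp
    (((starRingEnd ℂ (ϑ p)) • ContinuousLinearMap.id ℝ ℂ : ℂ →L[ℝ] ℂ).comp
      (mfderiv (𝓡 d) 𝓘(ℝ, ℂ) (fun q ↦ (ϑ q : ℂ)) p))

end Forms

/-- The form `dθ` of polar coordinates `z = r exp(iθ)` on the plane, at the point `z`, applied to
the vector `w` (it is only relevant for `z ≠ 0`). -/
def polarTheta (z w : ℂ) : ℝ := (starRingEnd ℂ z * w).im / ‖z‖ ^ 2

/-- The form `dr` of polar coordinates on the plane, at the point `z`, applied to `w`
(it is only relevant for `z ≠ 0`). -/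
def polarR (z w : ℂ) : ℝ := (starRingEnd ℂ z * w).re / ‖z‖

section OpenBooks

variable {n : ℕ}
  {M : Type*} [TopologicalSpace M] [ChartedSpace (Model (2 * n + 1)) M]
  {N : Type*} [TopologicalSpace N] [ChartedSpace (Model (2 * n - 1)) N]

/-- `Φ : N × ℝ² → M` is a tubular neighbourhood (a diffeomorphism onto an open subset) of the
submanifold `incl : N → M` in which the map `angle` is the polar angle of the plane.
The compact tubular neighbourhood `N × D²` is the part over the closed unit disk. -/
structure IsTube (incl : N → M) (angle : M → Circle) (Φ : N × ℂ → M) : Prop where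
  injective : Function.Injective Φ
  isLocalDiffeomorph :
    IsLocalDiffeomorph ((𝓡 (2 * n - 1)).prod 𝓘(ℝ, ℂ)) (𝓡 (2 * n + 1)) ∞ Φ
  zero_section : ∀ x, Φ (x, 0) = incl x
  angle_eq : ∀ x (z : ℂ), z ≠ 0 → (angle (Φ (x, z)) : ℂ) = z / (‖z‖ : ℂ)

variable (n M N) in
/-- An open-book decomposition of the closed `(2n+1)`-manifold `M` with binding the closed
`(2n-1)`-manifold `N`: an embedding `incl` of the binding, and a smooth submersion
`angle = exp(iθ)` from the complement of the binding to the circle which is the polar angle in some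
tubular neighbourhood of the binding. The pages are the closures of the fibres of `angle`; as `M`
is compact, `angle` is a locally trivial fibration off the binding. (The values of `angle` on the
binding are irrelevant.) -/
structure OpenBook where
  incl : N → M
  angle : M → Circle
  smooth_angle : ContMDiffOn (𝓡 (2 * n + 1)) 𝓘(ℝ, ℂ) ∞ (fun p ↦ (angle p : ℂ)) (Set.range incl)ᶜ
  submersion : ∀ p ∉ Set.range incl, (angleForm angle : OneForm (2 * n + 1) M) p ≠ 0
  exists_tube : ∃ Φ : N × ℂ → M, IsTube (n := n) incl angle Φ

namespace OpenBook

/-- The open book supports the contact manifold `(M, α)` by means of the positive function `ρ`: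
the binding is a contact submanifold, and `dθ ∧ (d(ρα))^n > 0` off the binding with respect to the
orientation of `M` given by `α ∧ (dα)^n`. -/
structure Supports [IsManifold (𝓡 (2 * n + 1)) ∞ M] [IsManifold (𝓡 (2 * n - 1)) ∞ N]
    (O : OpenBook n M N) (α : OneForm (2 * n + 1) M) (ρ : M → ℝ) : Prop where
  contact_binding : IsContactForm (n - 1) (pullback O.incl α : OneForm (2 * n - 1) N)
  smooth : ContMDiff (𝓡 (2 * n + 1)) 𝓘(ℝ, ℝ) ∞ ρ
  pos : ∀ p, 0 < ρ p
  pages : ∀ p ∉ Set.range O.incl, ∀ v, 0 < wedgeD α α n p v →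
    0 < wedgeD (angleForm O.angle) (fmul ρ α) n p v

/-- The `1`-form `β` is axisymmetric near the binding: in some tubular neighbourhood `N × D²` of the
binding, in which the polar angle is the page coordinate `θ`, it has the form
`f(r) μ + g(r) dθ`, where `μ` is the pull-back of `β|N` under the projection to `N`,
`f > 0`, `f' < 0` on `(0,1]`, and `g` is weakly increasing with `g(r) = r²` near `r = 0` and
`g(r) = 1` near `r = 1`. -/
def IsAxisymmetric (O : OpenBook n M N) (β : OneForm (2 * n + 1) M) : Prop :=
  ∃ (Φ : N × ℂ → M) (f g : ℝ → ℝ), IsTube (n := n) O.incl O.angle Φ ∧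
    ContDiffOn ℝ ∞ f (Set.Icc 0 1) ∧ ContDiffOn ℝ ∞ g (Set.Icc 0 1) ∧
    (∀ r ∈ Set.Icc (0 : ℝ) 1, 0 < f r) ∧
    (∀ r ∈ Set.Ioc (0 : ℝ) 1, derivWithin f (Set.Icc 0 1) r < 0) ∧
    MonotoneOn g (Set.Icc 0 1) ∧
    (∃ ε ∈ Set.Ioo (0 : ℝ) 1, (∀ r ∈ Set.Icc 0 ε, g r = r ^ 2) ∧
      ∀ r ∈ Set.Icc (1 - ε) 1, g r = 1) ∧
    ∀ (x : N) (z : ℂ), ‖z‖ ≤ 1 → ∀ (v : TangentSpace (𝓡 (2 * n - 1)) x) (w : ℂ),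
      β (Φ (x, z)) (mfderiv ((𝓡 (2 * n - 1)).prod 𝓘(ℝ, ℂ)) (𝓡 (2 * n + 1)) Φ (x, z) (v, w)) =
        f ‖z‖ * (pullback O.incl β : OneForm (2 * n - 1) N) x v + g ‖z‖ * polarTheta z w

/-- The foliation defined by a nowhere vanishing integrable `1`-form `η` is a spinnable foliation
associated to the open book: the binding is fibred over the circle (it has a submersion to the
circle), and, for some tubular neighbourhood `N × D²` of the binding in which the polar angle is
the page coordinate,
* outside `N × D²` the leaves are the pages, co-oriented by `dθ`;
* on `N × D²` one has `η = a(r) ν + b(r) dθ + c(r) dr`, with `ν` a nowhere vanishing closed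
  `1`-form on `N`, where `a > 0` for `r < 1/2` and `a = 0` for `r ≥ 1/2`, `b = 0` for `r ≤ 1/2` and
  `b > 0` for `r > 1/2`, and `c` is nonzero at `r = 1/2` and zero near `r = 0` and `r = 1`.
Thus `r = 1/2` is a union of compact leaves; outside it the pages spiral towards it, and inside it
the products of the leaves of `ν` with the disk do so. -/
structure IsSpinnable [IsManifold (𝓡 (2 * n - 1)) ∞ N]
    (O : OpenBook n M N) (η : OneForm (2 * n + 1) M) : Prop where
  fibred : ∃ q : N → Circle,
    ContMDiff (𝓡 (2 * n - 1)) 𝓘(ℝ, ℂ) ∞ (fun x ↦ (q x : ℂ)) ∧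
    ∀ x, (angleForm q : OneForm (2 * n - 1) N) x ≠ 0
  leaves : ∃ (Φ : N × ℂ → M) (ν : OneForm (2 * n - 1) N) (a b c : ℝ → ℝ),
    IsTube (n := n) O.incl O.angle Φ ∧
    IsSmooth ν ∧ (∀ x, ν x ≠ 0) ∧ (∀ x, dForm ν x = 0) ∧
    ContDiff ℝ ∞ a ∧ ContDiff ℝ ∞ b ∧ ContDiff ℝ ∞ c ∧
    (∀ r ∈ Set.Ico (0 : ℝ) (1 / 2), 0 < a r) ∧ (∀ r ∈ Set.Icc (1 / 2 : ℝ) 1, a r = 0) ∧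
    (∀ r ∈ Set.Icc (0 : ℝ) (1 / 2), b r = 0) ∧ (∀ r ∈ Set.Ioc (1 / 2 : ℝ) 1, 0 < b r) ∧
    c (1 / 2) ≠ 0 ∧
    (∃ ε ∈ Set.Ioo (0 : ℝ) 1, ∀ r, r ∈ Set.Icc 0 ε ∨ r ∈ Set.Icc (1 - ε) 1 → c r = 0) ∧
    (∀ (x : N) (z : ℂ), ‖z‖ ≤ 1 → ∀ (v : TangentSpace (𝓡 (2 * n - 1)) x) (w : ℂ),
      η (Φ (x, z)) (mfderiv ((𝓡 (2 * n - 1)).prod 𝓘(ℝ, ℂ)) (𝓡 (2 * n + 1)) Φ (x, z) (v, w)) =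
        a ‖z‖ * ν x v + b ‖z‖ * polarTheta z w + c ‖z‖ * polarR z w) ∧
    ∀ p, (∀ (x : N) (z : ℂ), ‖z‖ ≤ 1 → Φ (x, z) ≠ p) →
      ∃ l : ℝ, 0 < l ∧ η p = l • (angleForm O.angle : OneForm (2 * n + 1) M) p

end OpenBook

end OpenBooks

end ContactFoliation

end

/-! The family is the straight segment `(1 - t) β + t η` from `β = ρα` to an explicit form `η`
(`spinForm`), equal to `a(r) ν + b(r) dθ + d(C(r))` in the axisymmetric tube and to `dθ` elsewhere.
Since `a` lives on `r < 1/2` and `b` on `r > 1/2`, `a b' = b a' = 0`, which gives `η ∧ dη = 0`; at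
`r = 1/2`, where both vanish, `C' = 1` keeps `η` nonzero.

Contactness is a computation in the tube off the core. For a form `B μ + H ν + G dθ + c dr` against
a 2-form `F dμ + dr ∧ (F' μ + H' ν + G' dθ)`, the top power is `n F^(n-1) (B G' - G F') (dμ)^(n-1) ∧
μ ∧ dr ∧ dθ`: `(dμ)^n` vanishes because `dim N = 2n - 1`, `ν ∧ (dμ)^(n-1) = 0` kills every `ν` term,
and `c` drops out (`exists_wedgePow_product`). The form `η` thus affects only the `dθ` coefficient,
and along the segment `B G' - G F'` becomes `(1 - t) ((1 - t) (f g' - g f') + t (f b' - b f'))`.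
Here `f g' - g f' > 0` because `β` is contact, and `f b' - b f' ≥ 0` because `f > 0`, `f' < 0`, `b ≥
0`, `b' ≥ 0`. The common volume element is positive because `dθ ∧ (dβ)^n > 0` and `-f' > 0`
(`wedgeD_segment_pos_of_ne`).

At the binding and outside `r ≤ 3/4` the form `η` is closed, so the top form is `(1 - t)^n ((1 - t)
β ∧ (dβ)^n + t η ∧ (dβ)^n)` (`wedgeD_segment_of_closed`). The last term is positive outside by the
supporting condition, and zero at the binding (`wedgeD_spinForm_binding`).

The fibration of `N` over the circle is Tischler's theorem for `ν` (`exists_submersion_circle`).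
Wedge powers, defined as signed sums over permutations, are computed in the exterior algebra of the
dual space (`Represents.wedgePow_eq`). -/

noncomputable section

namespace ContactFoliation

/-! ### Wedge powers as products in the exterior algebra of covectors. -/

section Algebra

open ExteriorAlgebra

/-- A product over `Fin (2 * k + 1)`, grouped as a first factor followed by pairs. -/
lemma prod_ofFn_pairs {G : Type*} [Monoid G] (k : ℕ) (f : Fin (2 * k + 1) → G) :
    (List.ofFn f).prod = f 0 * (List.ofFn fun i : Fin k ↦
      f ⟨2 * i + 1, by omega⟩ * f ⟨2 * i + 2, by omega⟩).prod := by
  rw [List.ofFn_succ, List.prod_cons, List.ofFn_mul']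
  congr 1
  rw [List.prod_flatten, List.map_ofFn]
  congr 2
  funext i
  simp only [Function.comp, List.ofFn_succ, List.ofFn_zero, List.prod_cons, List.prod_nil, mul_one]
  rfl

lemma prod_univ_pairs {G : Type*} [CommMonoid G] (k : ℕ) (f : Fin (2 * k + 1) → G) :
    ∏ j, f j = f 0 * ∏ i : Fin k, (f ⟨2 * i + 1, by omega⟩ * f ⟨2 * i + 2, by omega⟩) := by
  rw [← List.prod_ofFn, prod_ofFn_pairs, List.prod_ofFn]

/-- The sequence `β, a₀, b₀, a₁, b₁, …`. -/
def interleave {L : Type*} {k : ℕ} (β : L) (a b : Fin k → L) (j : Fin (2 * k + 1)) : L :=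
  if h0 : (j : ℕ) = 0 then β
  else if (j : ℕ) % 2 = 1 then a ⟨(j - 1) / 2, by omega⟩ else b ⟨(j - 1) / 2, by omega⟩

section interleave

variable {L : Type*} {k : ℕ} (β : L) (a b : Fin k → L)

lemma interleave_zero : interleave β a b 0 = β := by simp [interleave]

lemma interleave_odd (i : Fin k) : interleave β a b ⟨2 * i + 1, by omega⟩ = a i := by
  have h : (2 * (i : ℕ) + 1) % 2 = 1 := by omega
  simp [interleave, h]

lemma interleave_even (i : Fin k) : interleave β a b ⟨2 * i + 2, by omega⟩ = b i := by
  have h : ¬ (2 * (i : ℕ) + 2) % 2 = 1 := by omega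
  have h' : (2 * (i : ℕ) + 1) / 2 = i := by omega
  simp [interleave, h']

end interleave

variable {V : Type*} [AddCommGroup V] [Module ℝ V] [TopologicalSpace V]

/-- The determinant of the values of `m` covectors on `m` given vectors. -/
def evalDet {m : ℕ} (v : Fin m → V) : (V →L[ℝ] ℝ) [⋀^Fin m]→ₗ[ℝ] ℝ :=
  (Matrix.detRowAlternating (n := Fin m) (R := ℝ)).compLinearMap
    (LinearMap.pi fun b ↦
      { toFun := fun l : V →L[ℝ] ℝ ↦ l (v b), map_add' := fun _ _ ↦ rfl, map_smul' := fun _ _ ↦ rfl })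

/-- Evaluation of elements of the exterior algebra of the dual space at a family of vectors. -/
def pairing {m : ℕ} (v : Fin m → V) : ExteriorAlgebra ℝ (V →L[ℝ] ℝ) →ₗ[ℝ] ℝ :=
  liftAlternating (Pi.single m (evalDet v))

/-- Leibniz expansion of the determinant, transposed so that the permutation acts on the vectors, as
it does in `wedgePow`. -/
lemma pairing_ιMulti {m : ℕ} (v : Fin m → V) (l : Fin m → V →L[ℝ] ℝ) :
    pairing v (ιMulti ℝ m l) = ∑ σ : Equiv.Perm (Fin m),
      ((Equiv.Perm.sign σ : ℤ) : ℝ) * ∏ j, l j (v (σ j)) := by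
  rw [pairing, liftAlternating_apply_ιMulti, Pi.single_eq_same]
  change Matrix.det (Matrix.of fun a b ↦ l a (v b)) = _
  rw [← Matrix.det_transpose, Matrix.det_apply']
  rfl

/-- A `2`-form is represented by the element `X` of the exterior algebra of the dual. -/
def Represents (η : (Fin 2 → V) → ℝ) (X : ExteriorAlgebra ℝ (V →L[ℝ] ℝ)) : Prop :=
  ∃ (m : ℕ) (a b : Fin m → V →L[ℝ] ℝ),
    (∀ u, η u = ∑ s, (a s (u 0) * b s (u 1) - a s (u 1) * b s (u 0))) ∧
    X = ∑ s, ι ℝ (a s) * ι ℝ (b s)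

lemma Represents.wedge (a b : V →L[ℝ] ℝ) :
    Represents (fun u ↦ a (u 0) * b (u 1) - a (u 1) * b (u 0)) (ι ℝ a * ι ℝ b) :=
  ⟨1, fun _ ↦ a, fun _ ↦ b, by simp, by simp⟩

lemma Represents.add {η η' : (Fin 2 → V) → ℝ} {X X'} (h : Represents η X) (h' : Represents η' X') :
    Represents (fun u ↦ η u + η' u) (X + X') := by
  obtain ⟨m, a, b, h1, rfl⟩ := h
  obtain ⟨m', a', b', h1', rfl⟩ := h'
  refine ⟨m + m', Fin.append a a', Fin.append b b', fun u ↦ ?_, ?_⟩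
  · simp only [Fin.sum_univ_add, h1, h1', Fin.append_left, Fin.append_right]
  · simp [Fin.sum_univ_add]

lemma Represents.smul {η : (Fin 2 → V) → ℝ} {X} (h : Represents η X) (r : ℝ) :
    Represents (fun u ↦ r * η u) (r • X) := by
  obtain ⟨m, a, b, h1, rfl⟩ := h
  refine ⟨m, r • a, b, fun u ↦ ?_, ?_⟩
  · simp only [h1, Finset.mul_sum, Pi.smul_apply, FunLike.coe_smul, smul_eq_mul]
    exact Finset.sum_congr rfl fun _ _ ↦ by ring
  · simp [Finset.smul_sum]

lemma ι_mul_ι_comm (a b : V →L[ℝ] ℝ) : ι ℝ a * ι ℝ b = -(ι ℝ b * ι ℝ a) :=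
  eq_neg_of_add_eq_zero_left (ι_add_mul_swap a b)

lemma commute_wedge_ι (a b c : V →L[ℝ] ℝ) : Commute (ι ℝ a * ι ℝ b) (ι ℝ c) := by
  rw [Commute, SemiconjBy, mul_assoc, ι_mul_ι_comm b c, mul_neg, ← mul_assoc, ι_mul_ι_comm a c,
    neg_mul, neg_neg, mul_assoc]

/-- Elements of even degree are central; this is all that later manipulations need to know about
`X`. -/
lemma Represents.commute {η : (Fin 2 → V) → ℝ} {X} (h : Represents η X) (c : V →L[ℝ] ℝ) :
    Commute X (ι ℝ c) := by
  obtain ⟨m, a, b, -, rfl⟩ := h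
  exact Commute.sum_left _ _ _ fun s _ ↦ commute_wedge_ι _ _ _

lemma sum_pow_eq_sum_ofFn {A : Type*} [Semiring A] {m : ℕ} (x : Fin m → A) (k : ℕ) :
    (∑ s, x s) ^ k = ∑ f : Fin k → Fin m, (List.ofFn fun i ↦ x (f i)).prod := by
  induction k with
  | zero => simp
  | succ k ih =>
    rw [pow_succ', ih, Finset.sum_mul_sum, ← Finset.sum_product', Finset.univ_product_univ]
    exact Fintype.sum_equiv (Fin.consEquiv fun _ ↦ Fin m) _ _ fun p ↦ by simp [Fin.consEquiv]

lemma ι_mul_sum_pow {m : ℕ} (β : V →L[ℝ] ℝ) (a b : Fin m → V →L[ℝ] ℝ) (k : ℕ) :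
    ι ℝ β * (∑ s, ι ℝ (a s) * ι ℝ (b s)) ^ k =
      ∑ f : Fin k → Fin m, ιMulti ℝ (2 * k + 1) (interleave β (a ∘ f) (b ∘ f)) := by
  rw [sum_pow_eq_sum_ofFn, Finset.mul_sum]
  refine Finset.sum_congr rfl fun f _ ↦ ?_
  rw [ιMulti_apply, prod_ofFn_pairs]
  simp only [interleave_zero, interleave_odd, interleave_even, Function.comp]

-- `S` is the set of pairs already antisymmetrised. The alternating sum antisymmetrises each pair
-- anyway, so doing it by hand only doubles the sum, once per pair; at `S = univ` the factor cancels
-- the `2⁻ᵏ` of `wedgePow`.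
omit [AddCommGroup V] [Module ℝ V] [TopologicalSpace V] in
lemma sum_sign_mul_prod_antisymm {k : ℕ} (β : V → ℝ) (a b : Fin k → V → ℝ)
    (v : Fin (2 * k + 1) → V) (S : Finset (Fin k)) :
    ∑ σ : Equiv.Perm (Fin (2 * k + 1)), ((Equiv.Perm.sign σ : ℤ) : ℝ) * β (v (σ 0)) *
      ∏ i : Fin k, (a i (v (σ ⟨2 * i + 1, by omega⟩)) * b i (v (σ ⟨2 * i + 2, by omega⟩)) -
        if i ∈ S then a i (v (σ ⟨2 * i + 2, by omega⟩)) * b i (v (σ ⟨2 * i + 1, by omega⟩)) else 0) =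
    2 ^ S.card * ∑ σ : Equiv.Perm (Fin (2 * k + 1)), ((Equiv.Perm.sign σ : ℤ) : ℝ) * β (v (σ 0)) *
      ∏ i : Fin k, (a i (v (σ ⟨2 * i + 1, by omega⟩)) * b i (v (σ ⟨2 * i + 2, by omega⟩))) := by
  induction S using Finset.induction_on with
  | empty => simp
  | insert j S hj ih =>
    rw [Finset.card_insert_of_notMem hj, pow_succ, mul_comm (2 ^ _), mul_assoc, ← ih]
    set Q : Equiv.Perm (Fin (2 * k + 1)) → ℝ := fun σ ↦
      ((Equiv.Perm.sign σ : ℤ) : ℝ) * β (v (σ 0)) *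
      ∏ i : Fin k, (a i (v (σ ⟨2 * i + 1, by omega⟩)) * b i (v (σ ⟨2 * i + 2, by omega⟩)) -
        if i ∈ S then a i (v (σ ⟨2 * i + 2, by omega⟩)) * b i (v (σ ⟨2 * i + 1, by omega⟩)) else 0)
      with hQ
    change _ = 2 * ∑ σ, Q σ
    -- Reindexing by `σ ↦ σ * τ` exchanges the two slots of the pair `j`, fixes all other slots and
    -- flips the sign.
    let τ : Equiv.Perm (Fin (2 * k + 1)) :=
      Equiv.swap ⟨2 * j + 1, by omega⟩ ⟨2 * j + 2, by omega⟩
    have hτ : Equiv.Perm.sign τ = -1 := Equiv.Perm.sign_swap (by simp)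
    have hs : 2 * ∑ σ, Q σ = ∑ σ, (Q σ + Q (σ * τ)) := by
      rw [Finset.sum_add_distrib, two_mul, ← Equiv.sum_comp (Equiv.mulRight τ) Q]
      rfl
    rw [hs]
    refine Finset.sum_congr rfl fun σ _ ↦ ?_
    have h0 : τ 0 = 0 := Equiv.swap_apply_of_ne_of_ne (by simp [Fin.ext_iff]) (by simp [Fin.ext_iff])
    have h1 : τ ⟨2 * j + 1, by omega⟩ = ⟨2 * j + 2, by omega⟩ := Equiv.swap_apply_left _ _
    have h2 : τ ⟨2 * j + 2, by omega⟩ = ⟨2 * j + 1, by omega⟩ := Equiv.swap_apply_right _ _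
    have h3 : ∀ i, i ≠ j → τ ⟨2 * i + 1, by omega⟩ = ⟨2 * i + 1, by omega⟩ := fun i hi ↦
      Equiv.swap_apply_of_ne_of_ne (by simp [Fin.ext_iff]; omega) (by simp [Fin.ext_iff]; omega)
    have h4 : ∀ i, i ≠ j → τ ⟨2 * i + 2, by omega⟩ = ⟨2 * i + 2, by omega⟩ := fun i hi ↦
      Equiv.swap_apply_of_ne_of_ne (by simp [Fin.ext_iff]; omega) (by simp [Fin.ext_iff]; omega)
    simp only [hQ, Equiv.Perm.sign_mul, hτ, Equiv.Perm.mul_apply, h0]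
    set R : Fin k → ℝ := fun i ↦
      (a i (v (σ ⟨2 * i + 1, by omega⟩)) * b i (v (σ ⟨2 * i + 2, by omega⟩)) -
        if i ∈ S then a i (v (σ ⟨2 * i + 2, by omega⟩)) * b i (v (σ ⟨2 * i + 1, by omega⟩)) else 0)
      with hR
    rw [← Finset.mul_prod_erase _ _ (Finset.mem_univ j), ← Finset.mul_prod_erase _ R (Finset.mem_univ j),
      ← Finset.mul_prod_erase _ _ (Finset.mem_univ j)]
    rw [Finset.prod_congr rfl (s₁ := Finset.univ.erase j) (g := R) (fun i hi ↦ by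
        simp [hR, Finset.mem_insert, Finset.ne_of_mem_erase hi]),
      Finset.prod_congr rfl (s₁ := Finset.univ.erase j) (f := fun i : Fin k ↦
        (a i (v (σ (τ ⟨2 * i + 1, by omega⟩))) * b i (v (σ (τ ⟨2 * i + 2, by omega⟩))) -
        if i ∈ S then a i (v (σ (τ ⟨2 * i + 2, by omega⟩))) * b i (v (σ (τ ⟨2 * i + 1, by omega⟩)))
          else 0)) (g := R) (fun i hi ↦ by
        rw [h3 i (Finset.ne_of_mem_erase hi), h4 i (Finset.ne_of_mem_erase hi)])]
    simp only [hR, h1, h2, Finset.mem_insert_self, if_true, if_neg hj]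
    push_cast
    ring

/-- `wedgePow β η k` is the evaluation of `β * X ^ k` in the exterior algebra. -/
lemma Represents.wedgePow_eq {η : (Fin 2 → V) → ℝ} {X} (h : Represents η X) (β : V →L[ℝ] ℝ) (k : ℕ)
    (v : Fin (2 * k + 1) → V) : wedgePow β η k v = pairing v (ι ℝ β * X ^ k) := by
  obtain ⟨m, a, b, h1, rfl⟩ := h
  rw [ι_mul_sum_pow, map_sum]
  simp only [pairing_ιMulti, prod_univ_pairs, interleave_zero, interleave_odd, interleave_even,
    Function.comp, wedgePow, h1, Matrix.cons_val_zero, Matrix.cons_val_one]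
  simp only [Finset.prod_univ_sum, Finset.mul_sum, Fintype.piFinset_univ]
  rw [Finset.sum_comm]
  refine Finset.sum_congr rfl fun f _ ↦ ?_
  have key := sum_sign_mul_prod_antisymm (fun x ↦ β x) (fun i x ↦ a (f i) x) (fun i x ↦ b (f i) x) v
    Finset.univ
  simp only [Finset.mem_univ, if_true, Finset.card_univ, Fintype.card_fin] at key
  rw [← Finset.mul_sum, key, ← mul_assoc, inv_mul_cancel₀ (by positivity), one_mul]
  exact Finset.sum_congr rfl fun _ _ ↦ by ring

end Algebra

/-! ### Multilinear identities and top-degree vanishing. -/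

section Algebra

open ExteriorAlgebra

lemma wedgePow_linear {V : Type*} (β θ : V → ℝ) (η : (Fin 2 → V) → ℝ) (k : ℕ) (s t : ℝ)
    (v : Fin (2 * k + 1) → V) :
    wedgePow (fun u ↦ s * β u + t * θ u) (fun u ↦ s * η u) k v =
      s ^ k * (s * wedgePow β η k v + t * wedgePow θ η k v) := by
  simp only [wedgePow, Finset.prod_mul_distrib, Finset.prod_const, Finset.card_univ,
    Fintype.card_fin, Finset.mul_sum, ← Finset.sum_add_distrib]
  exact Finset.sum_congr rfl fun _ _ ↦ by ring

lemma wedgePow_comp_perm {V : Type*} (β : V → ℝ) (η : (Fin 2 → V) → ℝ) (k : ℕ)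
    (v : Fin (2 * k + 1) → V) (τ : Equiv.Perm (Fin (2 * k + 1))) :
    wedgePow β η k (v ∘ τ) = (Equiv.Perm.sign τ : ℤ) * wedgePow β η k v := by
  simp only [wedgePow]
  conv_rhs => rw [← Equiv.sum_comp (Equiv.mulLeft τ)]
  simp only [Finset.mul_sum]
  refine Finset.sum_congr rfl fun σ _ ↦ ?_
  have h : ((Equiv.Perm.sign τ : ℤ) : ℝ) * ((Equiv.Perm.sign τ : ℤ) : ℝ) = 1 := by
    rcases Int.units_eq_one_or (Equiv.Perm.sign τ) with h | h <;> simp [h]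
  simp only [Function.comp, Equiv.coe_mulLeft, Equiv.Perm.sign_mul, Equiv.Perm.mul_apply]
  push_cast
  linear_combination (- (2 ^ k : ℝ)⁻¹ * ((Equiv.Perm.sign σ : ℤ) : ℝ) * β (v (τ (σ 0))) *
      ∏ i : Fin k, η ![v (τ (σ ⟨2 * i + 1, by omega⟩)), v (τ (σ ⟨2 * i + 2, by omega⟩))]) * h

/-- Exchanging the first two vectors reverses the sign; `0 < k` guarantees that there are two. It
supplies the positively oriented frames at which positivity becomes nonvanishing. -/
lemma exists_wedgePow_pos {V : Type*} {β : V → ℝ} {η : (Fin 2 → V) → ℝ} {k : ℕ} (hk : 0 < k)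
    {v : Fin (2 * k + 1) → V} (h : wedgePow β η k v ≠ 0) : ∃ w, 0 < wedgePow β η k w := by
  rcases h.lt_or_gt with h | h
  · refine ⟨v ∘ Equiv.swap ⟨0, by omega⟩ ⟨1, by omega⟩, ?_⟩
    rw [wedgePow_comp_perm, Equiv.Perm.sign_swap (by simp)]
    simpa using h
  · exact ⟨v, h⟩

section Commutation

variable {V : Type*} [AddCommGroup V] [Module ℝ V] [TopologicalSpace V]
  {X : ExteriorAlgebra ℝ (V →L[ℝ] ℝ)}

/-- The extra term of `d(ρα) = ρ dα + dρ ∧ α` contains `α`, so it dies against the leading factor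
`α`. -/
lemma ι_mul_pow_conformal (hX : ∀ c, Commute X (ι ℝ c)) (β γ : V →L[ℝ] ℝ) (r : ℝ) (k : ℕ) :
    ι ℝ β * (ι ℝ γ * ι ℝ β + r • X) ^ k = r ^ k • (ι ℝ β * X ^ k) := by
  have h1 : ι ℝ β * (ι ℝ γ * ι ℝ β + r • X) = r • (X * ι ℝ β) := by
    rw [mul_add, ι_mul_ι_comm γ β, mul_neg, ← mul_assoc, ι_sq_zero, zero_mul, neg_zero, zero_add,
      mul_smul_comm, (hX β).eq]
  induction k with
  | zero => simp
  | succ k ih =>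
    rw [pow_succ', ← mul_assoc, h1, smul_mul_assoc, mul_assoc, ih, mul_smul_comm, smul_smul,
      ← mul_assoc, (hX β).eq, mul_assoc, ← pow_succ', ← pow_succ']

/-- The binomial theorem, of which only the terms of degree at most one in `D` survive. In the
application `D` is a multiple of `dr`. -/
lemma add_pow_of_sq_zero {A : Type*} [Ring A] [Algebra ℝ A] {X D : A} (h : Commute X D)
    (hD : D * D = 0) (F : ℝ) (k : ℕ) :
    (F • X + D) ^ (k + 1) = F ^ (k + 1) • X ^ (k + 1) + ((k + 1) * F ^ k) • (X ^ k * D) := by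
  induction k with
  | zero => simp
  | succ k ih =>
    rw [pow_succ, ih, add_mul, mul_add, mul_add]
    simp only [smul_mul_assoc, mul_smul_comm, mul_assoc, hD, mul_zero, smul_zero, add_zero,
      ← h.eq]
    simp only [← mul_assoc, ← pow_succ, smul_smul]
    push_cast
    module

/-- The top power of a form `B μ + H ν + G Θ + c R` against `F X + R ∧ (F' μ + H' ν + G' Θ)`, where
`X`, `μ`, `ν` come from the first factor of a product with a plane: only the coefficients of
`μ` and `Θ` matter. -/
lemma ι_mul_pow_product (hX : ∀ c, Commute X (ι ℝ c)) {k : ℕ} (hX0 : X ^ (k + 1) = 0)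
    (μ ν R Θ : V →L[ℝ] ℝ) (hν : ι ℝ ν * X ^ k = 0) (F B H G c F' H' G' : ℝ) :
    ι ℝ (B • μ + H • ν + G • Θ + c • R) *
        (F • X + ι ℝ R * ι ℝ (F' • μ + H' • ν + G' • Θ)) ^ (k + 1) =
      ((k + 1) * F ^ k * (B * G' - G * F')) • (X ^ k * (ι ℝ μ * (ι ℝ R * ι ℝ Θ))) := by
  have hk : ∀ c, Commute (X ^ k) (ι ℝ c) := fun c ↦ (hX c).pow_left k
  have hν' : X ^ k * ι ℝ ν = 0 := by rw [(hk ν).eq, hν]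
  have hD : Commute X (ι ℝ R * ι ℝ (F' • μ + H' • ν + G' • Θ)) := (hX _).mul_right (hX _)
  have hDD : ι ℝ R * ι ℝ (F' • μ + H' • ν + G' • Θ) * (ι ℝ R * ι ℝ (F' • μ + H' • ν + G' • Θ)) = 0 := by
    rw [mul_assoc, ← mul_assoc (ι ℝ (F' • μ + H' • ν + G' • Θ)), ι_mul_ι_comm _ R, neg_mul,
      mul_assoc, ι_sq_zero, mul_zero, neg_zero, mul_zero]
  rw [add_pow_of_sq_zero hD hDD, hX0, smul_zero, zero_add, mul_smul_comm, ← mul_assoc,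
    ← (hk _).eq, mul_assoc]
  have hνl : ∀ Z, X ^ k * (ι ℝ ν * Z) = 0 := fun Z ↦ by rw [← mul_assoc, hν', zero_mul]
  have hνr : ∀ a b, X ^ k * (ι ℝ a * (ι ℝ b * ι ℝ ν)) = 0 := fun a b ↦ by
    rw [← mul_assoc (ι ℝ a), (commute_wedge_ι a b ν).eq, hνl]
  have hμμ : ι ℝ μ * (ι ℝ R * ι ℝ μ) = 0 := by
    rw [ι_mul_ι_comm R, mul_neg, ← mul_assoc, ι_sq_zero, zero_mul, neg_zero]
  have hΘΘ : ι ℝ Θ * (ι ℝ R * ι ℝ Θ) = 0 := by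
    rw [ι_mul_ι_comm R, mul_neg, ← mul_assoc, ι_sq_zero, zero_mul, neg_zero]
  have hRR : ∀ a, ι ℝ R * (ι ℝ R * ι ℝ a) = 0 := fun a ↦ by
    rw [← mul_assoc, ι_sq_zero, zero_mul]
  have hΘμ : ι ℝ Θ * (ι ℝ R * ι ℝ μ) = -(ι ℝ μ * (ι ℝ R * ι ℝ Θ)) := by
    rw [← mul_assoc, (commute_wedge_ι Θ R μ).eq, ι_mul_ι_comm Θ R, mul_neg]
  simp only [map_add, map_smul, add_mul, mul_add, smul_mul_assoc, mul_smul_comm, hνl, hνr, hμμ,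
    hΘΘ, hRR, hΘμ, smul_zero, zero_add, add_zero, smul_neg, mul_neg]
  module

end Commutation

section Pullback

variable {V W : Type*} [AddCommGroup V] [Module ℝ V] [TopologicalSpace V]
  [AddCommGroup W] [Module ℝ W] [TopologicalSpace W]

/-- Precomposition with a continuous linear map, on covectors. -/
def covectorPullback (π : V →L[ℝ] W) : (W →L[ℝ] ℝ) →ₗ[ℝ] (V →L[ℝ] ℝ) where
  toFun l := l.comp π
  map_add' _ _ := rfl
  map_smul' _ _ := rfl

lemma Represents.comp {η : (Fin 2 → W) → ℝ} {Y} (h : Represents η Y) (π : V →L[ℝ] W) :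
    Represents (fun u ↦ η (fun i ↦ π (u i))) (ExteriorAlgebra.map (covectorPullback π) Y) := by
  obtain ⟨m, a, b, h1, rfl⟩ := h
  exact ⟨m, fun s ↦ (a s).comp π, fun s ↦ (b s).comp π, fun u ↦ h1 _, by
    simp only [map_sum, map_mul, ExteriorAlgebra.map_apply_ι]; rfl⟩

end Pullback

lemma finrank_covector (m : ℕ) : Module.finrank ℝ (Model m →L[ℝ] ℝ) = m := by
  rw [← (LinearMap.toContinuousLinearMap (𝕜 := ℝ) (E := Model m) (F' := ℝ)).finrank_eq]
  simp [Subspace.dual_finrank_eq]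

/-- The degree `2k + 2` exceeds the dimension, so every monomial is a wedge of linearly dependent
covectors. -/
lemma Represents.pow_succ_eq_zero {k : ℕ} {η : (Fin 2 → Model (2 * k + 1)) → ℝ} {Y}
    (h : Represents η Y) : Y ^ (k + 1) = 0 := by
  obtain ⟨m, a, b, -, rfl⟩ := h
  rw [pow_succ', Finset.sum_mul]
  refine Finset.sum_eq_zero fun s _ ↦ ?_
  rw [mul_assoc, ι_mul_sum_pow, Finset.mul_sum]
  refine Finset.sum_eq_zero fun f _ ↦ ?_
  have := ιMulti_succ_apply (R := ℝ)
    (Fin.cons (a s) (interleave (b s) (a ∘ f) (b ∘ f)) : Fin (2 * k + 1).succ → _)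
  simp only [Fin.cons_zero, Matrix.vecTail, Function.comp_def, Fin.cons_succ] at this
  rw [show ι ℝ (a s) * ιMulti ℝ (2 * k + 1) (interleave (b s) (a ∘ f) (b ∘ f)) = _ from this.symm]
  refine AlternatingMap.map_linearDependent _ _ fun hli ↦ ?_
  have := hli.fintype_card_le_finrank
  rw [finrank_covector] at this
  simp at this

/-- In top degree the exterior power is a line, detected by evaluation on one basis. Hence the
pointwise hypothesis on `ν ∧ (dμ)^k` becomes an identity in the algebra, which can be pulled back to
a larger space. -/
lemma Represents.ι_mul_pow_eq_zero {k : ℕ} {η : (Fin 2 → Model (2 * k + 1)) → ℝ} {Y}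
    (h : Represents η Y) (ν : Model (2 * k + 1) →L[ℝ] ℝ) (h0 : ∀ v, wedgePow ν η k v = 0) :
    ι ℝ ν * Y ^ k = 0 := by
  have hιMulti (e : Module.Basis (Fin (2 * k + 1)) ℝ (Model (2 * k + 1) →L[ℝ] ℝ)) :
      ιMulti ℝ (2 * k + 1) =
        (LinearMap.toSpanSingleton ℝ _ (ιMulti ℝ (2 * k + 1) e)).compAlternatingMap e.det := by
    refine e.ext_alternating fun v hv ↦ ?_
    have h1 := (ιMulti ℝ (2 * k + 1)).map_perm e (Equiv.ofBijective v hv.bijective_of_finite)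
    have h2 := e.det.map_perm e (Equiv.ofBijective v hv.bijective_of_finite)
    rw [e.det_self] at h2
    change ιMulti ℝ (2 * k + 1) (e ∘ v) = e.det (e ∘ v) • ιMulti ℝ (2 * k + 1) e
    rw [show e ∘ v = e ∘ (Equiv.ofBijective v hv.bijective_of_finite) from rfl, h1, h2]
    rcases Int.units_eq_one_or (Equiv.Perm.sign (Equiv.ofBijective v hv.bijective_of_finite)) with
      h | h <;> simp [h]
  let b := (EuclideanSpace.basisFun (Fin (2 * k + 1)) ℝ).toBasis
  let bd := b.dualBasis.map (LinearMap.toContinuousLinearMap (𝕜 := ℝ) (F' := ℝ))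
  have hpair : pairing b (ιMulti ℝ (2 * k + 1) bd) = 1 := by
    rw [pairing, liftAlternating_apply_ιMulti, Pi.single_eq_same]
    change Matrix.det (Matrix.of fun i j ↦ bd i (b j)) = 1
    rw [show (Matrix.of fun i j ↦ bd i (b j)) = 1 from ?_, Matrix.det_one]
    ext i j
    simp [bd, Matrix.one_apply, Finsupp.single_apply, eq_comm]
  have hex : ∃ c : ℝ, ι ℝ ν * Y ^ k = c • ιMulti ℝ (2 * k + 1) bd := by
    obtain ⟨m, a, b', -, rfl⟩ := h
    refine ⟨∑ f : Fin k → Fin m, bd.det (interleave ν (a ∘ f) (b' ∘ f)), ?_⟩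
    rw [ι_mul_sum_pow, Finset.sum_smul]
    refine Finset.sum_congr rfl fun f _ ↦ ?_
    exact congrArg (fun g ↦ g (interleave ν (a ∘ f) (b' ∘ f))) (hιMulti bd)
  obtain ⟨c, hc⟩ := hex
  have := h.wedgePow_eq ν k b
  rw [h0, hc, map_smul, hpair, smul_eq_mul, mul_one] at this
  rw [hc, ← this, zero_smul]

/-- Every alternating `2`-form on the model space is represented in the exterior algebra. -/
lemma exists_represents {d : ℕ} (w : Model d [⋀^Fin 2]→L[ℝ] ℝ) :
    ∃ X, Represents (fun u ↦ w u) X := by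
  have hu : ∀ x y : Model d, ![x, y] = Function.update ![x, 0] 1 y := fun x y ↦ by
    ext i; fin_cases i <;> simp
  have hu' : ∀ x y : Model d, ![x, y] = Function.update ![0, y] 0 x := fun x y ↦ by
    ext i; fin_cases i <;> simp
  -- `w = ∑ eⁱ ∧ (½ w(eᵢ, ·))`: the factor one half compensates for the two terms of each wedge,
  -- which contribute equally.
  let b : Fin d → Model d →L[ℝ] ℝ := fun i ↦ LinearMap.toContinuousLinearMap
    { toFun := fun y ↦ 2⁻¹ * w ![EuclideanSpace.single i 1, y]
      map_add' := fun x y ↦ by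
        rw [hu, w.map_update_add, ← hu, ← hu, mul_add]
      map_smul' := fun c x ↦ by
        rw [hu, w.map_update_smul, ← hu]; simp; ring }
  let l : Model d → Model d →ₗ[ℝ] ℝ := fun y ↦
    { toFun := fun x ↦ w ![x, y]
      map_add' := fun x x' ↦ by rw [hu', w.map_update_add, ← hu', ← hu']
      map_smul' := fun c x ↦ by rw [hu', w.map_update_smul, ← hu']; simp }
  have hl : ∀ x y : Model d, w ![x, y] = ∑ i, x i * w ![EuclideanSpace.single i 1, y] := by
    intro x y
    have hx : x = ∑ i, x i • (EuclideanSpace.single i (1 : ℝ)) := by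
      ext j
      simp [Finset.sum_apply, Pi.single_apply]
    change l y x = _
    conv_lhs => rw [hx]
    simp only [map_sum, map_smul, smul_eq_mul]
    rfl
  refine ⟨_, d, fun i ↦ EuclideanSpace.proj i, b, fun u ↦ ?_, rfl⟩
  have hsw : w ![u 1, u 0] = - w ![u 0, u 1] := by
    have := w.map_swap ![u 0, u 1] (i := 0) (j := 1) (by decide)
    refine Eq.trans (congrArg w ?_) this
    ext i; fin_cases i <;> simp
  have hu2 : u = ![u 0, u 1] := by ext i; fin_cases i <;> simp
  have e : ∀ x y : Model d, ∑ i, x i * (2⁻¹ * w ![EuclideanSpace.single i 1, y]) =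
      2⁻¹ * w ![x, y] := fun x y ↦ by
    rw [hl, Finset.mul_sum]; exact Finset.sum_congr rfl fun _ _ ↦ by ring
  change w u = ∑ i, (u 0 i * (2⁻¹ * w ![EuclideanSpace.single i 1, u 1]) -
    u 1 i * (2⁻¹ * w ![EuclideanSpace.single i 1, u 0]))
  rw [Finset.sum_sub_distrib, e, e, hsw, ← hu2]
  ring

end Algebra

/-! ### Calculus of 1-forms in a preferred chart. -/

section LocalCalculus

open Filter Topology

variable {d : ℕ} {M : Type*} [TopologicalSpace M] [ChartedSpace (Model d) M]

/-- The value of a `1`-form at a point, as a covector on the model space. -/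
def cov (α : OneForm d M) (p : M) : Model d →L[ℝ] ℝ := α p

/-- The differential of a function, as a `1`-form. -/
def diff (f : M → ℝ) : OneForm d M := fun p ↦ mfderiv (𝓡 d) 𝓘(ℝ, ℝ) f p

/-- Smoothness of a `1`-form at a point, in the preferred chart. -/
def SmoothFormAt (α : OneForm d M) (p : M) : Prop :=
  ContDiffAt ℝ ∞ (localRep α p) (extChartAt (𝓡 d) p p)

lemma tendsto_extChartAt_symm (p : M) :
    Tendsto (extChartAt (𝓡 d) p).symm (𝓝 (extChartAt (𝓡 d) p p)) (𝓝 p) := by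
  have := continuousAt_extChartAt_symm (I := 𝓡 d) p
  rwa [ContinuousAt, extChartAt_to_inv] at this

lemma localRep_congr {α β : OneForm d M} {p : M} (h : ∀ᶠ q in 𝓝 p, α q = β q) :
    localRep α p =ᶠ[𝓝 (extChartAt (𝓡 d) p p)] localRep β p := by
  filter_upwards [(tendsto_extChartAt_symm p).eventually h] with y hy
  simp only [localRep, hy]

lemma SmoothFormAt.congr {α β : OneForm d M} {p : M} (hα : SmoothFormAt α p)
    (h : ∀ᶠ q in 𝓝 p, β q = α q) : SmoothFormAt β p :=
  ContDiffAt.congr_of_eventuallyEq hα (localRep_congr h)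

lemma dForm_congr {α β : OneForm d M} {p : M} (h : ∀ᶠ q in 𝓝 p, α q = β q) :
    dForm α p = dForm β p := by
  refine Filter.EventuallyEq.extDeriv_eq ?_
  filter_upwards [localRep_congr h] with y hy
  rw [hy]

lemma localRep_self [IsManifold (𝓡 d) ∞ M] (α : OneForm d M) (p : M) (w : Model d) :
    localRep α p (extChartAt (𝓡 d) p p) w = cov α p w := by
  have h1 : mfderiv 𝓘(ℝ, Model d) (𝓡 d) (extChartAt (𝓡 d) p).symm (extChartAt (𝓡 d) p p) w = w := by
    have := mfderivWithin_range_extChartAt_symm (I := 𝓡 d) (x := p)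
    rw [modelWithCornersSelf_coe, Set.range_id, mfderivWithin_univ] at this
    rw [this]; rfl
  change α _ (mfderiv 𝓘(ℝ, Model d) (𝓡 d) (extChartAt (𝓡 d) p).symm (extChartAt (𝓡 d) p p) w) = _
  rw [h1]
  have h2 : ∀ q, q = p → (α q : Model d →L[ℝ] ℝ) w = (α p : Model d →L[ℝ] ℝ) w := by
    rintro q rfl; rfl
  exact h2 _ (extChartAt_to_inv p)

/-- All later rules for `dα` are read off from this antisymmetrised derivative in the chart at `p`.
-/
lemma dForm_apply {α : OneForm d M} {p : M} (h : SmoothFormAt α p) (u : Fin 2 → Model d) :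
    dForm α p u = fderiv ℝ (localRep α p) (extChartAt (𝓡 d) p p) (u 0) (u 1) -
      fderiv ℝ (localRep α p) (extChartAt (𝓡 d) p p) (u 1) (u 0) := by
  have hd : DifferentiableAt ℝ (localRep α p) (extChartAt (𝓡 d) p p) := h.differentiableAt (by simp)
  have hd' : DifferentiableAt ℝ (fun y ↦ ContinuousAlternatingMap.ofSubsingleton ℝ (Model d) ℝ
      (0 : Fin 1) (localRep α p y)) (extChartAt (𝓡 d) p p) :=
    (ContinuousAlternatingMap.ofSubsingletonLIE (𝕜 := ℝ) (E := Model d) (F := ℝ)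
      (0 : Fin 1)).differentiableAt.comp _ hd
  change extDeriv _ _ u = _
  rw [extDeriv_apply hd', Fin.sum_univ_two]
  have e : ∀ w w' : Model d, fderiv ℝ (fun y ↦ localRep α p y w) (extChartAt (𝓡 d) p p) w' =
      fderiv ℝ (localRep α p) (extChartAt (𝓡 d) p p) w' w := fun w w' ↦ by
    rw [fderiv_clm_apply hd (differentiableAt_const _)]
    simp
  simp only [ContinuousAlternatingMap.ofSubsingleton_apply_apply, e]
  simp [Fin.removeNth, Fin.succAbove]
  ring

lemma SmoothFormAt.add {α β : OneForm d M} {p : M} (hα : SmoothFormAt α p) (hβ : SmoothFormAt β p) :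
    SmoothFormAt (fun q ↦ α q + β q) p :=
  ContDiffAt.add hα hβ

lemma dForm_add {α β : OneForm d M} {p : M} (hα : SmoothFormAt α p) (hβ : SmoothFormAt β p)
    (u : Fin 2 → Model d) : dForm (fun q ↦ α q + β q) p u = dForm α p u + dForm β p u := by
  rw [dForm_apply hα, dForm_apply hβ, dForm_apply (hα.add hβ)]
  have : fderiv ℝ (localRep (fun q ↦ α q + β q) p) (extChartAt (𝓡 d) p p) =
      fderiv ℝ (localRep α p) (extChartAt (𝓡 d) p p) +
        fderiv ℝ (localRep β p) (extChartAt (𝓡 d) p p) :=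
    fderiv_add (hα.differentiableAt (by simp)) (hβ.differentiableAt (by simp))
  rw [this]
  simp only [add_apply]
  ring

section Functions

variable {F : Type*} [NormedAddCommGroup F] [NormedSpace ℝ F]

/-- A smooth function in the preferred chart. -/
lemma contDiffAt_chart {f : M → F} {p : M} (hf : ContMDiffAt (𝓡 d) 𝓘(ℝ, F) ∞ f p) :
    ContDiffAt ℝ ∞ (f ∘ (extChartAt (𝓡 d) p).symm) (extChartAt (𝓡 d) p p) := by
  have := (contMDiffAt_iff.1 hf).2
  simpa only [extChartAt_model_space_eq_id, PartialEquiv.refl_coe, Function.id_comp,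
    modelWithCornersSelf_coe, Set.range_id, contDiffWithinAt_univ] using this

lemma mfderiv_eq_fderiv_chart {f : M → F} {p : M} (hf : ContMDiffAt (𝓡 d) 𝓘(ℝ, F) ∞ f p)
    (w : Model d) : mfderiv (𝓡 d) 𝓘(ℝ, F) f p w =
      fderiv ℝ (f ∘ (extChartAt (𝓡 d) p).symm) (extChartAt (𝓡 d) p p) w := by
  rw [(hf.mdifferentiableAt (by simp)).mfderiv]
  simp only [writtenInExtChartAt, extChartAt_model_space_eq_id, PartialEquiv.refl_coe,
    Function.id_comp, modelWithCornersSelf_coe, Set.range_id, fderivWithin_univ]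
  rfl

end Functions

lemma diff_apply {f : M → ℝ} {p : M} (hf : ContMDiffAt (𝓡 d) 𝓘(ℝ, ℝ) ∞ f p) (w : Model d) :
    cov (diff f) p w =
      fderiv ℝ (f ∘ (extChartAt (𝓡 d) p).symm) (extChartAt (𝓡 d) p p) w :=
  mfderiv_eq_fderiv_chart hf w

lemma SmoothFormAt.fmul {α : OneForm d M} {p : M} {f : M → ℝ} (hα : SmoothFormAt α p)
    (hf : ContMDiffAt (𝓡 d) 𝓘(ℝ, ℝ) ∞ f p) : SmoothFormAt (fmul f α) p :=
  (contDiffAt_chart hf).smul hα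

lemma dForm_fmul [IsManifold (𝓡 d) ∞ M] {α : OneForm d M} {p : M} {f : M → ℝ} (hα : SmoothFormAt α p)
    (hf : ContMDiffAt (𝓡 d) 𝓘(ℝ, ℝ) ∞ f p) (u : Fin 2 → Model d) :
    dForm (fmul f α) p u = f p * dForm α p u +
      (cov (diff f) p (u 0) * cov α p (u 1) - cov (diff f) p (u 1) * cov α p (u 0)) := by
  rw [dForm_apply hα, dForm_apply (hα.fmul hf)]
  have : fderiv ℝ (localRep (ContactFoliation.fmul f α) p) (extChartAt (𝓡 d) p p) = _ :=
    fderiv_fun_smul ((contDiffAt_chart hf).differentiableAt (by simp)) (hα.differentiableAt (by simp))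
  rw [this, diff_apply hf, diff_apply hf, ← localRep_self α p,
    ← localRep_self α p]
  simp only [add_apply, Function.comp, extChartAt_to_inv,
    ContinuousLinearMap.smulRight_apply, FunLike.coe_smul, Pi.smul_apply, smul_eq_mul]
  ring

end LocalCalculus

/-! ### Smooth sections of the cotangent bundle versus smooth chart expressions. -/

section Bundle

open Filter Topology

variable {d : ℕ} {M : Type*} [TopologicalSpace M] [ChartedSpace (Model d) M]
  [IsManifold (𝓡 d) ∞ M]

/-- The inverse tangent trivialisation over a chart is the derivative of the inverse chart, so
bundle coordinates of a 1-form coincide with its pull-back under that inverse. This reduces bundle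
smoothness to smoothness of `localRep`. -/
lemma inCoordinates_eq_localRep (α : OneForm d M) {p q : M} (hq : q ∈ (chartAt (Model d) p).source) :
    ContinuousLinearMap.inCoordinates (Model d) (TangentSpace (𝓡 d)) ℝ (Bundle.Trivial M ℝ)
      p q p q (α q) = localRep α p (extChartAt (𝓡 d) p q) := by
  have : IsManifold (𝓡 d) 1 M := IsManifold.of_le (n := ∞) (by simp)
  have h1 : (trivializationAt (Model d) (TangentSpace (𝓡 d)) p).symmL ℝ q =
      mfderiv 𝓘(ℝ, Model d) (𝓡 d) (extChartAt (𝓡 d) p).symm (extChartAt (𝓡 d) p q) := by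
    have := TangentBundle.symmL_trivializationAt (I := 𝓡 d) hq
    rwa [modelWithCornersSelf_coe, Set.range_id, mfderivWithin_univ] at this
  have h2 : (extChartAt (𝓡 d) p).symm (extChartAt (𝓡 d) p q) = q :=
    (extChartAt (𝓡 d) p).left_inv (by simpa using hq)
  have h3 : ∀ q', q' = q → ∀ w : Model d, (α q' : Model d →L[ℝ] ℝ) w = (α q : Model d →L[ℝ] ℝ) w := by
    rintro q rfl w; rfl
  ext w
  rw [ContinuousLinearMap.inCoordinates, h1]
  have h4 := h3 _ h2
    ((mfderiv 𝓘(ℝ, Model d) (𝓡 d) (extChartAt (𝓡 d) p).symm (extChartAt (𝓡 d) p q) :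
      Model d →L[ℝ] Model d) w)
  refine Eq.trans ?_ h4.symm
  simp
  rfl

lemma contMDiffAt_section_iff (α : OneForm d M) (p : M) :
    ContMDiffAt (𝓡 d) ((𝓡 d).prod 𝓘(ℝ, Model d →L[ℝ] ℝ)) ∞
      (fun p : M ↦ Bundle.TotalSpace.mk' (Model d →L[ℝ] ℝ)
        (E := fun p : M ↦ TangentSpace (𝓡 d) p →L[ℝ] Bundle.Trivial M ℝ p) p (α p)) p ↔
      SmoothFormAt α p := by
  rw [contMDiffAt_hom_bundle]
  have hs : ∀ᶠ q in 𝓝 p, q ∈ (chartAt (Model d) p).source :=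
    (chartAt (Model d) p).open_source.mem_nhds (mem_chart_source _ p)
  have e : (fun x ↦ ContinuousLinearMap.inCoordinates (Model d) (TangentSpace (𝓡 d)) ℝ
      (Bundle.Trivial M ℝ) p x p x (α x)) =ᶠ[𝓝 p] localRep α p ∘ extChartAt (𝓡 d) p := by
    filter_upwards [hs] with q hq
    exact inCoordinates_eq_localRep α hq
  constructor
  · rintro ⟨-, h⟩
    have h' := contDiffAt_chart (h.congr_of_eventuallyEq e.symm)
    refine ContDiffAt.congr_of_eventuallyEq h' ?_
    filter_upwards [extChartAt_target_mem_nhds (I := 𝓡 d) p] with y hy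
    simp only [Function.comp]
    rw [(extChartAt (𝓡 d) p).right_inv hy]
  · intro h
    refine ⟨contMDiffAt_id, ?_⟩
    refine ContMDiffAt.congr_of_eventuallyEq ?_ e
    exact (ContDiffAt.contMDiffAt h).comp p (contMDiffAt_extChartAt)

lemma isSmooth_iff (α : OneForm d M) : IsSmooth α ↔ ∀ p, SmoothFormAt α p :=
  forall_congr' fun p ↦ contMDiffAt_section_iff α p

/-- The affine segment between two smooth forms is a smooth family. -/
lemma isSmoothFamilyOn_segment {β η : OneForm d M} (hβ : IsSmooth β) (hη : IsSmooth η) (s : Set ℝ) :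
    IsSmoothFamilyOn (fun t p ↦ (1 - t) • β p + t • η p) s := by
  refine ContMDiff.contMDiffOn fun ⟨t, p⟩ ↦ ?_
  rw [contMDiffAt_hom_bundle]
  refine ⟨contMDiffAt_snd, ?_⟩
  have hs : ∀ᶠ q in 𝓝 (t, p), q.2 ∈ (chartAt (Model d) p).source :=
    continuousAt_snd.eventually
      ((chartAt (Model d) p).open_source.mem_nhds (mem_chart_source _ p))
  have key : ∀ γ : OneForm d M, IsSmooth γ → ContMDiffAt (𝓘(ℝ, ℝ).prod (𝓡 d))
      𝓘(ℝ, Model d →L[ℝ] ℝ) ∞ (fun q : ℝ × M ↦ localRep γ p (extChartAt (𝓡 d) p q.2)) (t, p) := by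
    intro γ hγ
    refine ContMDiffAt.comp (t, p) (g := localRep γ p ∘ extChartAt (𝓡 d) p) (f := Prod.snd)
      (I' := 𝓡 d) ?_ contMDiffAt_snd
    exact (ContDiffAt.contMDiffAt ((isSmooth_iff γ).1 hγ p)).comp p contMDiffAt_extChartAt
  have ht : ContMDiffAt (𝓘(ℝ, ℝ).prod (𝓡 d)) 𝓘(ℝ, ℝ) ∞ (fun q : ℝ × M ↦ q.1) (t, p) :=
    contMDiffAt_fst
  have h1 : ContMDiffAt (𝓘(ℝ, ℝ).prod (𝓡 d)) 𝓘(ℝ, ℝ) ∞ (fun q : ℝ × M ↦ 1 - q.1) (t, p) :=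
    contMDiffAt_const.sub ht
  refine ((h1.smul (key β hβ)).add (ht.smul (key η hη))).congr_of_eventuallyEq ?_
  filter_upwards [hs] with q hq
  exact inCoordinates_eq_localRep (fun p ↦ (1 - q.1) • β p + q.1 • η p) hq

end Bundle

/-! ### Naturality of the exterior derivative under pull-back. -/

section Pullback

open Filter Topology

variable {d d' : ℕ} {M : Type*} [TopologicalSpace M] [ChartedSpace (Model d) M]
  [IsManifold (𝓡 d) ∞ M]
  {N : Type*} [TopologicalSpace N] [ChartedSpace (Model d') N] [IsManifold (𝓡 d') ∞ N]

/-- The chain rule applied to `F` read through both charts. It holds only near `p`, where `F` stays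
in the chart around `F p`; a germ is enough for differentiation. -/
lemma localRep_pullback (γ : OneForm d' N) {F : M → N} {p : M}
    (hF : ContMDiffAt (𝓡 d) (𝓡 d') ∞ F p) :
    localRep (pullback F γ) p =ᶠ[𝓝 (extChartAt (𝓡 d) p p)]
      fun y ↦ (localRep γ (F p) (writtenInExtChartAt (𝓡 d) (𝓡 d') p F y)).comp
        (fderiv ℝ (writtenInExtChartAt (𝓡 d) (𝓡 d') p F) y) := by
  have : IsManifold (𝓡 d) 1 M := IsManifold.of_le (n := ∞) (by simp)
  have : IsManifold (𝓡 d') 1 N := IsManifold.of_le (n := ∞) (by simp)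
  have hev : ∀ᶠ q in 𝓝 p, ContMDiffAt (𝓡 d) (𝓡 d') 1 F q :=
    (contMDiffAt_iff_contMDiffAt_nhds (by simp)).1 (hF.of_le (m := 1) (by simp))
  have hsrc : ∀ᶠ q in 𝓝 p, F q ∈ (extChartAt (𝓡 d') (F p)).source :=
    hF.continuousAt.eventually (extChartAt_source_mem_nhds (I := 𝓡 d') (F p))
  have ht := tendsto_extChartAt_symm (d := d) p
  filter_upwards [ht.eventually hev, (ht.eventually hsrc).eventually_nhds,
    extChartAt_target_mem_nhds (I := 𝓡 d) p] with y hFy hsy hy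
  have hsy0 := hsy.self_of_nhds
  have hφ : MDifferentiableAt 𝓘(ℝ, Model d) (𝓡 d) (extChartAt (𝓡 d) p).symm y := by
    have := mdifferentiableWithinAt_extChartAt_symm (I := 𝓡 d) hy
    rwa [modelWithCornersSelf_coe, Set.range_id, mdifferentiableWithinAt_univ] at this
  have hFd := hFy.mdifferentiableAt (by simp)
  have hψ : MDifferentiableAt (𝓡 d') 𝓘(ℝ, Model d') (extChartAt (𝓡 d') (F p))
      (F ((extChartAt (𝓡 d) p).symm y)) := mdifferentiableAt_extChartAt (by simpa using hsy0)
  have hFφ : MDifferentiableAt 𝓘(ℝ, Model d) (𝓡 d') (F ∘ (extChartAt (𝓡 d) p).symm) y :=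
    hFd.comp y hφ
  have hw : MDifferentiableAt 𝓘(ℝ, Model d) 𝓘(ℝ, Model d')
      (writtenInExtChartAt (𝓡 d) (𝓡 d') p F) y := MDifferentiableAt.comp y hψ hFφ
  have hψ' : MDifferentiableAt 𝓘(ℝ, Model d') (𝓡 d') (extChartAt (𝓡 d') (F p)).symm
      (writtenInExtChartAt (𝓡 d) (𝓡 d') p F y) := by
    have := mdifferentiableWithinAt_extChartAt_symm (I := 𝓡 d')
      ((extChartAt (𝓡 d') (F p)).map_source hsy0)
    rwa [modelWithCornersSelf_coe, Set.range_id, mdifferentiableWithinAt_univ] at this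
  have e : (extChartAt (𝓡 d') (F p)).symm ∘ (writtenInExtChartAt (𝓡 d) (𝓡 d') p F) =ᶠ[𝓝 y]
      F ∘ (extChartAt (𝓡 d) p).symm := by
    filter_upwards [hsy] with y' hy'
    exact (extChartAt (𝓡 d') (F p)).left_inv hy'
  have e1 := e.mfderiv_eq (I := 𝓘(ℝ, Model d)) (I' := 𝓡 d')
  have e2 := mfderiv_comp y hψ' hw
  have e3 := mfderiv_comp y hFd hφ
  have h3 : ∀ q q', q' = q → ∀ w w' : Model d', w = w' →
      (γ q' : Model d' →L[ℝ] ℝ) w = (γ q : Model d' →L[ℝ] ℝ) w' := by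
    rintro q _ rfl w _ rfl; rfl
  ext w
  refine h3 _ _ e.self_of_nhds.symm _ _ ?_
  have e4 : ∀ w : Model d, (mfderiv 𝓘(ℝ, Model d) (𝓡 d') (F ∘ (extChartAt (𝓡 d) p).symm) y :
      Model d →L[ℝ] Model d') w = (mfderiv 𝓘(ℝ, Model d') (𝓡 d') (extChartAt (𝓡 d') (F p)).symm
      (writtenInExtChartAt (𝓡 d) (𝓡 d') p F y) : Model d' →L[ℝ] Model d')
      (fderiv ℝ (writtenInExtChartAt (𝓡 d) (𝓡 d') p F) y w) := by
    intro w
    rw [← mfderiv_eq_fderiv]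
    exact (congrArg (fun T : Model d →L[ℝ] Model d' ↦ T w) e1).symm.trans
      (congrArg (fun T : Model d →L[ℝ] Model d' ↦ T w) e2)
  exact (congrArg (fun T : Model d →L[ℝ] Model d' ↦ T w) e3).symm.trans (e4 w)

omit [IsManifold (𝓡 d) ∞ M] [IsManifold (𝓡 d') ∞ N] in
lemma contDiffAt_writtenInExtChartAt {F : M → N} {p : M}
    (hF : ContMDiffAt (𝓡 d) (𝓡 d') ∞ F p) :
    ContDiffAt ℝ ∞ (writtenInExtChartAt (𝓡 d) (𝓡 d') p F) (extChartAt (𝓡 d) p p) := by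
  have := (contMDiffAt_iff.1 hF).2
  rwa [modelWithCornersSelf_coe, Set.range_id, contDiffWithinAt_univ] at this

omit [IsManifold (𝓡 d) ∞ M] [IsManifold (𝓡 d') ∞ N] in
lemma writtenInExtChartAt_self (F : M → N) (p : M) :
    writtenInExtChartAt (𝓡 d) (𝓡 d') p F (extChartAt (𝓡 d) p p) = extChartAt (𝓡 d') (F p) (F p) := by
  simp only [writtenInExtChartAt, Function.comp, extChartAt_to_inv]

lemma SmoothFormAt.pullback {γ : OneForm d' N} {F : M → N} {p : M} (hγ : SmoothFormAt γ (F p))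
    (hF : ContMDiffAt (𝓡 d) (𝓡 d') ∞ F p) : SmoothFormAt (pullback F γ : OneForm d M) p := by
  refine ContDiffAt.congr_of_eventuallyEq ?_ (localRep_pullback γ hF)
  have h := contDiffAt_writtenInExtChartAt hF
  have hγ' : ContDiffAt ℝ ∞ (localRep γ (F p))
    (writtenInExtChartAt (𝓡 d) (𝓡 d') p F (extChartAt (𝓡 d) p p)) := by
    rw [writtenInExtChartAt_self]; exact hγ
  exact (hγ'.comp _ h).clm_comp (h.fderiv_right (m := ∞) (by simp))

lemma dForm_pullback {γ : OneForm d' N} {F : M → N} {p : M} (hγ : SmoothFormAt γ (F p))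
    (hF : ContMDiffAt (𝓡 d) (𝓡 d') ∞ F p) (u : Fin 2 → Model d) :
    dForm (pullback F γ : OneForm d M) p u =
      dForm γ (F p) (fun i ↦ (mfderiv (𝓡 d) (𝓡 d') F p : Model d →L[ℝ] Model d') (u i)) := by
  have h := contDiffAt_writtenInExtChartAt hF
  have hγ' : ContDiffAt ℝ ∞ (localRep γ (F p))
    (writtenInExtChartAt (𝓡 d) (𝓡 d') p F (extChartAt (𝓡 d) p p)) := by
    rw [writtenInExtChartAt_self]; exact hγ
  have hd : DifferentiableAt ℝ (fun y ↦ ContinuousAlternatingMap.ofSubsingleton ℝ (Model d') ℝ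
      (0 : Fin 1) (localRep γ (F p) y))
      (writtenInExtChartAt (𝓡 d) (𝓡 d') p F (extChartAt (𝓡 d) p p)) :=
    (ContinuousAlternatingMap.ofSubsingletonLIE (𝕜 := ℝ) (E := Model d') (F := ℝ)
      (0 : Fin 1)).differentiableAt.comp _ (hγ'.differentiableAt (by simp))
  have key := extDeriv_pullback hd h (by rw [minSmoothness_of_isRCLikeNormedField]; exact ENat.LEInfty.out)
  have e : dForm (ContactFoliation.pullback F γ) p = extDeriv (fun y ↦
      (ContinuousAlternatingMap.ofSubsingleton ℝ (Model d') ℝ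
      (0 : Fin 1) (localRep γ (F p) (writtenInExtChartAt (𝓡 d) (𝓡 d') p F y))).compContinuousLinearMap
      (fderiv ℝ (writtenInExtChartAt (𝓡 d) (𝓡 d') p F) y)) (extChartAt (𝓡 d) p p) := by
    refine Filter.EventuallyEq.extDeriv_eq ?_
    filter_upwards [localRep_pullback γ hF] with y hy
    rw [hy]
    rfl
  rw [e, key, writtenInExtChartAt_self]
  have hm : (mfderiv (𝓡 d) (𝓡 d') F p : Model d →L[ℝ] Model d') =
      fderiv ℝ (writtenInExtChartAt (𝓡 d) (𝓡 d') p F) (extChartAt (𝓡 d) p p) := by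
    rw [(hF.mdifferentiableAt (by simp)).mfderiv, modelWithCornersSelf_coe, Set.range_id,
      fderivWithin_univ]
  rw [hm]
  rfl

end Pullback

/-! ### Differentials of functions are closed. -/

section Exact

open Filter Topology

variable {d : ℕ} {M : Type*} [TopologicalSpace M] [ChartedSpace (Model d) M]
  [IsManifold (𝓡 d) ∞ M]

lemma localRep_diff {f : M → ℝ} {p : M} (hf : ContMDiffAt (𝓡 d) 𝓘(ℝ, ℝ) ∞ f p) :
    localRep (diff f) p =ᶠ[𝓝 (extChartAt (𝓡 d) p p)]
      fderiv ℝ (f ∘ (extChartAt (𝓡 d) p).symm) := by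
  have : IsManifold (𝓡 d) 1 M := IsManifold.of_le (n := ∞) (by simp)
  have hev : ∀ᶠ q in 𝓝 p, ContMDiffAt (𝓡 d) 𝓘(ℝ, ℝ) 1 f q :=
    (contMDiffAt_iff_contMDiffAt_nhds (by simp)).1 (hf.of_le (m := 1) (by simp))
  filter_upwards [(tendsto_extChartAt_symm (d := d) p).eventually hev,
    extChartAt_target_mem_nhds (I := 𝓡 d) p] with y hFy hy
  have hφ : MDifferentiableAt 𝓘(ℝ, Model d) (𝓡 d) (extChartAt (𝓡 d) p).symm y := by
    have := mdifferentiableWithinAt_extChartAt_symm (I := 𝓡 d) hy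
    rwa [modelWithCornersSelf_coe, Set.range_id, mdifferentiableWithinAt_univ] at this
  rw [← mfderiv_eq_fderiv]
  exact (mfderiv_comp y (hFy.mdifferentiableAt (by simp)) hφ).symm

lemma smoothFormAt_diff {f : M → ℝ} {p : M} (hf : ContMDiffAt (𝓡 d) 𝓘(ℝ, ℝ) ∞ f p) :
    SmoothFormAt (diff f : OneForm d M) p :=
  ContDiffAt.congr_of_eventuallyEq ((contDiffAt_chart hf).fderiv_right (m := ∞) (by simp))
    (localRep_diff hf)

lemma dForm_diff {f : M → ℝ} {p : M} (hf : ContMDiffAt (𝓡 d) 𝓘(ℝ, ℝ) ∞ f p) (u : Fin 2 → Model d) :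
    dForm (diff f : OneForm d M) p u = 0 := by
  rw [dForm_apply (smoothFormAt_diff hf), (localRep_diff hf).fderiv_eq, sub_eq_zero]
  exact (contDiffAt_chart hf).isSymmSndFDerivAt
    (by rw [minSmoothness_of_isRCLikeNormedField]; exact ENat.LEInfty.out) _ _

end Exact

/-! ### Differentials of vector-valued functions and angular forms. -/

section Differentials

open Filter Topology

variable {d : ℕ} {M : Type*} [TopologicalSpace M] [ChartedSpace (Model d) M]
  {F G : Type*} [NormedAddCommGroup F] [NormedSpace ℝ F] [NormedAddCommGroup G] [NormedSpace ℝ G]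

/-- The differential at `p` of a function with values in a normed space, as a linear map on the
model space. -/
def dfun (f : M → F) (p : M) : Model d →L[ℝ] F := mfderiv (𝓡 d) 𝓘(ℝ, F) f p

lemma dfun_eq_fderiv {f : M → F} {p : M} (hf : ContMDiffAt (𝓡 d) 𝓘(ℝ, F) ∞ f p) :
    dfun f p = fderiv ℝ (f ∘ (extChartAt (𝓡 d) p).symm) (extChartAt (𝓡 d) p p) :=
  ContinuousLinearMap.ext fun w ↦ mfderiv_eq_fderiv_chart hf w

lemma differentiableAt_chart {f : M → F} {p : M} (hf : ContMDiffAt (𝓡 d) 𝓘(ℝ, F) ∞ f p) :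
    DifferentiableAt ℝ (f ∘ (extChartAt (𝓡 d) p).symm) (extChartAt (𝓡 d) p p) :=
  (contDiffAt_chart hf).differentiableAt (by simp)

lemma cov_diff (f : M → ℝ) (p : M) : cov (diff f) p = dfun (d := d) f p := rfl

lemma dfun_congr {f g : M → F} {p : M} (h : f =ᶠ[𝓝 p] g) : dfun (d := d) f p = dfun g p :=
  ContinuousLinearMap.ext fun w ↦ congrArg (fun T : Model d →L[ℝ] F ↦ T w)
    (h.mfderiv_eq (I := 𝓡 d) (I' := 𝓘(ℝ, F)))

lemma dfun_const (c : F) (p : M) : dfun (d := d) (fun _ : M ↦ c) p = 0 :=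
  mfderiv_const

lemma dfun_comp {f : M → F} {p : M} {g : F → G} (hf : ContMDiffAt (𝓡 d) 𝓘(ℝ, F) ∞ f p)
    (hg : ContDiffAt ℝ ∞ g (f p)) :
    dfun (fun q ↦ g (f q)) p = (fderiv ℝ g (f p)).comp (dfun (d := d) f p) := by
  have h : ContMDiffAt (𝓡 d) 𝓘(ℝ, G) ∞ (fun q ↦ g (f q)) p := hg.contMDiffAt.comp p hf
  rw [dfun_eq_fderiv hf, dfun_eq_fderiv h]
  have e : f p = (f ∘ (extChartAt (𝓡 d) p).symm) (extChartAt (𝓡 d) p p) := by simp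
  rw [e] at hg ⊢
  exact fderiv_comp _ (hg.differentiableAt (by simp)) (differentiableAt_chart hf)

lemma dfun_clm_comp {f : M → F} {p : M} (T : F →L[ℝ] G) (hf : ContMDiffAt (𝓡 d) 𝓘(ℝ, F) ∞ f p) :
    dfun (fun q ↦ T (f q)) p = T.comp (dfun (d := d) f p) := by
  rw [dfun_comp hf T.contDiff.contDiffAt, T.fderiv]

lemma dfun_add {f g : M → F} {p : M} (hf : ContMDiffAt (𝓡 d) 𝓘(ℝ, F) ∞ f p)
    (hg : ContMDiffAt (𝓡 d) 𝓘(ℝ, F) ∞ g p) :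
    dfun (fun q ↦ f q + g q) p = dfun (d := d) f p + dfun g p := by
  have h : ContMDiffAt (𝓡 d) 𝓘(ℝ, F) ∞ (fun q ↦ f q + g q) p := hf.add hg
  rw [dfun_eq_fderiv hf, dfun_eq_fderiv hg, dfun_eq_fderiv h]
  exact fderiv_add (differentiableAt_chart hf) (differentiableAt_chart hg)

lemma dfun_sub {f g : M → F} {p : M} (hf : ContMDiffAt (𝓡 d) 𝓘(ℝ, F) ∞ f p)
    (hg : ContMDiffAt (𝓡 d) 𝓘(ℝ, F) ∞ g p) :
    dfun (fun q ↦ f q - g q) p = dfun (d := d) f p - dfun g p := by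
  rw [dfun_eq_fderiv hf, dfun_eq_fderiv hg, dfun_eq_fderiv (hf.sub hg)]
  exact fderiv_sub (differentiableAt_chart hf) (differentiableAt_chart hg)

lemma dfun_smul {r : M → ℝ} {f : M → F} {p : M} (hr : ContMDiffAt (𝓡 d) 𝓘(ℝ, ℝ) ∞ r p)
    (hf : ContMDiffAt (𝓡 d) 𝓘(ℝ, F) ∞ f p) :
    dfun (fun q ↦ r q • f q) p = r p • dfun (d := d) f p + (dfun r p).smulRight (f p) := by
  have h : ContMDiffAt (𝓡 d) 𝓘(ℝ, F) ∞ (fun q ↦ r q • f q) p := hr.smul hf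
  rw [dfun_eq_fderiv hf, dfun_eq_fderiv hr, dfun_eq_fderiv h]
  have := fderiv_fun_smul (differentiableAt_chart hr) (differentiableAt_chart hf)
  simp only [Function.comp_apply, extChartAt_to_inv] at this
  exact this

lemma dfun_sum {ι : Type*} (s : Finset ι) {f : ι → M → F} {p : M}
    (hf : ∀ i ∈ s, ContMDiffAt (𝓡 d) 𝓘(ℝ, F) ∞ (f i) p) :
    dfun (fun q ↦ ∑ i ∈ s, f i q) p = ∑ i ∈ s, dfun (d := d) (f i) p := by
  classical
  induction s using Finset.induction_on with
  | empty => simpa using dfun_const (d := d) (0 : F) p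
  | insert i s hi ih =>
    simp only [Finset.sum_insert hi]
    have hs : ContMDiffAt (𝓡 d) 𝓘(ℝ, F) ∞ (fun q ↦ ∑ i ∈ s, f i q) p :=
      contMDiffAt_finsetSum fun j hj ↦ hf j (Finset.mem_insert_of_mem hj)
    rw [dfun_add (hf i (Finset.mem_insert_self i s)) hs,
      ih fun j hj ↦ hf j (Finset.mem_insert_of_mem hj)]

/-- The form `Im (conj ζ dζ)` of a complex-valued function; where `ζ = r exp(iθ)`, this is
`r² dθ`. -/
def angular (ζ : M → ℂ) : OneForm d M := fun p ↦
  Complex.imCLM.comp (((starRingEnd ℂ (ζ p)) • ContinuousLinearMap.id ℝ ℂ : ℂ →L[ℝ] ℂ).comp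
    (mfderiv (𝓡 d) 𝓘(ℝ, ℂ) ζ p))

lemma cov_angular (ζ : M → ℂ) (p : M) (w : Model d) :
    cov (angular ζ) p w = (starRingEnd ℂ (ζ p) * dfun (d := d) ζ p w).im := rfl

lemma angleForm_eq_angular (ϑ : M → Circle) :
    (angleForm ϑ : OneForm d M) = angular fun p ↦ (ϑ p : ℂ) := rfl

/-- The term with `dr` is `r |ζ|² dr`, which is real, so it has no imaginary part. With `r = 1/|ζ|`
this relates `Im (conj ζ dζ)` to `dθ`. -/
lemma cov_angular_smul {r : M → ℝ} {ζ : M → ℂ} {p : M} (hr : ContMDiffAt (𝓡 d) 𝓘(ℝ, ℝ) ∞ r p)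
    (hζ : ContMDiffAt (𝓡 d) 𝓘(ℝ, ℂ) ∞ ζ p) :
    cov (angular fun q ↦ r q • ζ q) p = r p ^ 2 • cov (d := d) (angular ζ) p := by
  ext w
  rw [cov_angular, dfun_smul hr hζ]
  simp only [FunLike.coe_smul, Pi.smul_apply, cov_angular, add_apply,
    ContinuousLinearMap.smulRight_apply, smul_eq_mul, Complex.real_smul, map_mul, Complex.conj_ofReal,
    Complex.mul_im, Complex.mul_re, Complex.conj_re, Complex.conj_im, Complex.ofReal_re,
    Complex.ofReal_im, Complex.add_re, Complex.add_im]
  ring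

variable [IsManifold (𝓡 d) ∞ M]

lemma angular_eq_eventually {ζ : M → ℂ} {p : M} (hζ : ContMDiffAt (𝓡 d) 𝓘(ℝ, ℂ) ∞ ζ p) :
    ∀ᶠ q in 𝓝 p, (angular ζ : OneForm d M) q =
      fmul (fun q ↦ (ζ q).re) (diff fun q ↦ (ζ q).im) q +
        fmul (fun q ↦ - (ζ q).im) (diff fun q ↦ (ζ q).re) q := by
  have : IsManifold (𝓡 d) 1 M := IsManifold.of_le (n := ∞) (by simp)
  filter_upwards [(contMDiffAt_iff_contMDiffAt_nhds (by simp)).1 (hζ.of_le (m := 1) (by simp))]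
    with q hq
  have hd := hq.mdifferentiableAt (by simp)
  have e (T : ℂ →L[ℝ] ℝ) (w : Model d) :
      dfun (d := d) (fun q ↦ T (ζ q)) q w = T (dfun (d := d) ζ q w) := by
    have h1 := mfderiv_comp (I := 𝓡 d) (I' := 𝓘(ℝ, ℂ)) (I'' := 𝓘(ℝ, ℝ)) q
      (T.differentiableAt.mdifferentiableAt (x := ζ q)) hd
    rw [mfderiv_eq_fderiv, T.fderiv] at h1
    exact congrArg (fun S : Model d →L[ℝ] ℝ ↦ S w) h1
  have hi := e Complex.imCLM
  have hr := e Complex.reCLM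
  have key : cov (d := d) (angular ζ) q = (ζ q).re • dfun (d := d) (fun q ↦ (ζ q).im) q +
      (-(ζ q).im) • dfun (d := d) (fun q ↦ (ζ q).re) q := by
    ext w
    simp only [Complex.imCLM_apply, Complex.reCLM_apply] at hi hr
    simp only [add_apply, FunLike.coe_smul, Pi.smul_apply, hi w, hr w, cov_angular,
      Complex.mul_im, Complex.conj_re, Complex.conj_im, smul_eq_mul]
  exact key

omit [IsManifold (𝓡 d) ∞ M] in
lemma contMDiffAt_re {ζ : M → ℂ} {p : M} (hζ : ContMDiffAt (𝓡 d) 𝓘(ℝ, ℂ) ∞ ζ p) :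
    ContMDiffAt (𝓡 d) 𝓘(ℝ, ℝ) ∞ (fun q ↦ (ζ q).re) p :=
  Complex.reCLM.contDiff.contDiffAt.contMDiffAt.comp p hζ

omit [IsManifold (𝓡 d) ∞ M] in
lemma contMDiffAt_im {ζ : M → ℂ} {p : M} (hζ : ContMDiffAt (𝓡 d) 𝓘(ℝ, ℂ) ∞ ζ p) :
    ContMDiffAt (𝓡 d) 𝓘(ℝ, ℝ) ∞ (fun q ↦ (ζ q).im) p :=
  Complex.imCLM.contDiff.contDiffAt.contMDiffAt.comp p hζ

lemma smoothFormAt_angular {ζ : M → ℂ} {p : M} (hζ : ContMDiffAt (𝓡 d) 𝓘(ℝ, ℂ) ∞ ζ p) :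
    SmoothFormAt (angular ζ : OneForm d M) p :=
  (((smoothFormAt_diff (contMDiffAt_im hζ)).fmul (contMDiffAt_re hζ)).add
    ((smoothFormAt_diff (contMDiffAt_re hζ)).fmul (contMDiffAt_im hζ).neg)).congr
      (angular_eq_eventually hζ)

lemma dForm_angular {ζ : M → ℂ} {p : M} (hζ : ContMDiffAt (𝓡 d) 𝓘(ℝ, ℂ) ∞ ζ p)
    (u : Fin 2 → Model d) :
    dForm (angular ζ : OneForm d M) p u =
      2 * ((dfun ζ p (u 0)).re * (dfun ζ p (u 1)).im - (dfun ζ p (u 1)).re * (dfun ζ p (u 0)).im) := by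
  have h1 := smoothFormAt_diff (contMDiffAt_im hζ)
  have h2 := smoothFormAt_diff (contMDiffAt_re hζ)
  rw [dForm_congr (angular_eq_eventually hζ), dForm_add (h1.fmul (contMDiffAt_re hζ))
    (h2.fmul (contMDiffAt_im hζ).neg), dForm_fmul h1 (contMDiffAt_re hζ),
    dForm_fmul h2 (contMDiffAt_im hζ).neg, dForm_diff (contMDiffAt_im hζ),
    dForm_diff (contMDiffAt_re hζ)]
  have hr := dfun_clm_comp Complex.reCLM hζ
  have hi := dfun_clm_comp Complex.imCLM hζ
  have hi' := dfun_clm_comp (-Complex.imCLM) hζ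
  simp only [Complex.imCLM_apply, Complex.reCLM_apply, neg_apply] at hi hr hi'
  simp only [cov_diff, hr, hi, hi']
  simp only [ContinuousLinearMap.comp_apply, Complex.imCLM_apply, Complex.reCLM_apply, neg_apply]
  ring

/-- The angular form of a function with values in the circle is closed. -/
lemma dForm_angular_of_norm_eq_one {ζ : M → ℂ} {p : M} (hζ : ContMDiffAt (𝓡 d) 𝓘(ℝ, ℂ) ∞ ζ p)
    (h1 : ∀ᶠ q in 𝓝 p, ‖ζ q‖ = 1) (u : Fin 2 → Model d) :
    dForm (angular ζ : OneForm d M) p u = 0 := by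
  have hsq : ∀ z : ℂ, ‖z‖ = 1 → z.re * z.re + z.im * z.im = 1 := fun z hz ↦ by
    have := Complex.normSq_eq_norm_sq z
    rw [hz, Complex.normSq_apply] at this
    simpa using this
  have hc : dfun (d := d) (fun q ↦ (ζ q).re • (ζ q).re + (ζ q).im • (ζ q).im) p = 0 := by
    rw [dfun_congr (g := fun _ ↦ (1 : ℝ)), dfun_const]
    filter_upwards [h1] with q hq
    exact hsq _ hq
  have hre := contMDiffAt_re hζ
  have him := contMDiffAt_im hζ
  have hre2 : ContMDiffAt (𝓡 d) 𝓘(ℝ, ℝ) ∞ (fun q ↦ (ζ q).re • (ζ q).re) p := hre.smul hre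
  have him2 : ContMDiffAt (𝓡 d) 𝓘(ℝ, ℝ) ∞ (fun q ↦ (ζ q).im • (ζ q).im) p := him.smul him
  rw [dfun_add hre2 him2, dfun_smul hre hre, dfun_smul him him] at hc
  have hr := dfun_clm_comp Complex.reCLM hζ
  have hi := dfun_clm_comp Complex.imCLM hζ
  simp only [Complex.imCLM_apply, Complex.reCLM_apply] at hi hr
  rw [hr, hi] at hc
  have hc' : ∀ w : Model d, (ζ p).re * (dfun ζ p w).re + (ζ p).im * (dfun ζ p w).im = 0 := by
    intro w
    have := congrArg (fun T : Model d →L[ℝ] ℝ ↦ T w) hc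
    simp only [add_apply, FunLike.coe_smul, Pi.smul_apply, ContinuousLinearMap.comp_apply,
      ContinuousLinearMap.smulRight_apply, Complex.reCLM_apply, Complex.imCLM_apply, smul_eq_mul,
      zero_apply] at this
    linarith
  rw [dForm_angular hζ]
  have e0 := hc' (u 0)
  have e1 := hc' (u 1)
  have hn := hsq _ h1.self_of_nhds
  set x := (ζ p).re
  set y := (ζ p).im
  -- Multiply `dx ∧ dy` by `x² + y² = 1` and eliminate using `x dx + y dy = 0`, the differentiated
  -- norm condition.
  linear_combination (-2 * ((dfun ζ p (u 0)).re * (dfun ζ p (u 1)).im -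
    (dfun ζ p (u 1)).re * (dfun ζ p (u 0)).im)) * hn +
    2 * (x * (dfun ζ p (u 1)).im - y * (dfun ζ p (u 1)).re) * e0 +
    2 * (- x * (dfun ζ p (u 0)).im + y * (dfun ζ p (u 0)).re) * e1

end Differentials

/-! ### Local primitives of closed forms and Diophantine approximation. -/

section ClosedForms

open Filter Topology

variable {d : ℕ} {N : Type*} [TopologicalSpace N] [ChartedSpace (Model d) N]
  [IsManifold (𝓡 d) ∞ N]

lemma localRep_comp_dfun (ν : OneForm d N) {x y : N} (hy : y ∈ (extChartAt (𝓡 d) x).source) :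
    (localRep ν x (extChartAt (𝓡 d) x y)).comp (dfun (extChartAt (𝓡 d) x) y) = cov ν y := by
  have : IsManifold (𝓡 d) 1 N := IsManifold.of_le (n := ∞) (by simp)
  have h := mfderivWithin_extChartAt_symm_comp_mfderiv_extChartAt' (I := 𝓡 d) hy
  rw [modelWithCornersSelf_coe, Set.range_id, mfderivWithin_univ] at h
  have h3 : ∀ q q', q' = q → ∀ w w' : Model d, w = w' →
      (ν q' : Model d →L[ℝ] ℝ) w = (ν q : Model d →L[ℝ] ℝ) w' := by
    rintro q _ rfl w _ rfl; rfl
  ext w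
  exact h3 _ _ ((extChartAt (𝓡 d) x).left_inv hy) _ _
    (congrArg (fun T : Model d →L[ℝ] Model d ↦ T w) h)

omit [IsManifold (𝓡 d) ∞ N] in
lemma localRep_apply_extChartAt (ν : OneForm d N) {x y : N}
    (hy : y ∈ (extChartAt (𝓡 d) x).source) (w : Model d) :
    localRep ν x (extChartAt (𝓡 d) x y) w = cov ν y
      ((mfderiv 𝓘(ℝ, Model d) (𝓡 d) (extChartAt (𝓡 d) x).symm (extChartAt (𝓡 d) x y) :
        Model d →L[ℝ] Model d) w) := by
  have h3 : ∀ q q', q' = q → ∀ w : Model d,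
      (ν q' : Model d →L[ℝ] ℝ) w = (ν q : Model d →L[ℝ] ℝ) w := by
    rintro q _ rfl w; rfl
  exact h3 _ _ ((extChartAt (𝓡 d) x).left_inv hy) _

lemma localRep_model (γ : OneForm d (Model d)) (x y : Model d) : localRep γ x y = cov γ y := by
  ext w
  have key : ∀ φ : Model d → Model d, φ = id → (γ (φ y) : Model d →L[ℝ] ℝ)
      ((mfderiv 𝓘(ℝ, Model d) (𝓡 d) φ y : Model d →L[ℝ] Model d) w) = cov γ y w := by
    rintro _ rfl
    exact congrArg (fun T : Model d →L[ℝ] Model d ↦ cov γ y (T w)) mfderiv_id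
  exact key _ (by simp only [extChartAt_model_space_eq_id, PartialEquiv.refl_symm,
    PartialEquiv.refl_coe])

/-- A closed smooth `1`-form is locally the differential of a smooth function. -/
lemma exists_local_primitive {ν : OneForm d N} (hν : IsSmooth ν) (hc : ∀ x, dForm ν x = 0) (x : N) :
    ∃ (h : N → ℝ) (U : Set N), IsOpen U ∧ x ∈ U ∧ ∀ y ∈ U, ContMDiffAt (𝓡 d) 𝓘(ℝ, ℝ) ∞ h y ∧
      dfun h y = cov ν y := by
  have hs := (isSmooth_iff ν).1 hν
  set φ := extChartAt (𝓡 d) x with hφ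
  let γ : OneForm d (Model d) := pullback φ.symm ν
  have hφs : ∀ y ∈ φ.target, ContMDiffAt (𝓡 d) (𝓡 d) ∞ φ.symm y := fun y hy ↦
    (contMDiffOn_extChartAt_symm x).contMDiffAt ((isOpen_extChartAt_target x).mem_nhds hy)
  have hl : localRep ν x = cov γ := rfl
  have hγ : ∀ y ∈ φ.target, SmoothFormAt γ y := fun y hy ↦ (hs _).pullback (hφs y hy)
  have hrep : ∀ y, localRep γ y = cov γ := fun y ↦ funext fun y' ↦ localRep_model γ y y'
  have hcd : ∀ y ∈ φ.target, ContDiffAt ℝ ∞ (cov γ) y := fun y hy ↦ by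
    have := hγ y hy
    rwa [SmoothFormAt, hrep] at this
  -- In the chart, closedness is symmetry of the derivative, the hypothesis of the Poincaré lemma on
  -- a ball.
  have hsym : ∀ y ∈ φ.target, ∀ u w, fderiv ℝ (cov γ) y u w = fderiv ℝ (cov γ) y w u := by
    intro y hy u w
    have h1 := dForm_apply (hγ y hy) ![u, w]
    have h2 := dForm_pullback (hs (φ.symm y)) (hφs y hy) ![u, w]
    rw [hc] at h2
    rw [hrep] at h1
    exact sub_eq_zero.1 (h1.symm.trans h2)
  obtain ⟨r, hr, hball⟩ := Metric.isOpen_iff.1 (isOpen_extChartAt_target (I := 𝓡 d) x) _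
    (mem_extChartAt_target x)
  obtain ⟨f, hf⟩ := (convex_ball (φ x) r).exists_forall_hasFDerivAt_of_fderiv_symmetric
    Metric.isOpen_ball (fun y hy ↦ ((hcd y (hball hy)).differentiableAt (by simp)).differentiableWithinAt)
    (fun y hy ↦ hsym y (hball hy))
  have hfs : ContDiffOn ℝ ∞ f (Metric.ball (φ x) r) := by
    rw [contDiffOn_infty_iff_fderiv_of_isOpen Metric.isOpen_ball]
    refine ⟨fun y hy ↦ (hf y hy).differentiableAt.differentiableWithinAt, ?_⟩
    refine ContDiffOn.congr (f := cov γ) (fun y hy ↦ (hcd y (hball hy)).contDiffWithinAt)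
      fun y hy ↦ (hf y hy).fderiv
  refine ⟨fun y ↦ f (φ y), φ.source ∩ φ ⁻¹' Metric.ball (φ x) r,
    (continuousOn_extChartAt x).isOpen_inter_preimage (isOpen_extChartAt_source x) Metric.isOpen_ball,
    ⟨mem_extChartAt_source x, Metric.mem_ball_self hr⟩, fun y hy ↦ ?_⟩
  have h1 : ContMDiffAt (𝓡 d) 𝓘(ℝ, Model d) ∞ φ y :=
    contMDiffAt_extChartAt' (by simpa [hφ] using hy.1)
  have h2 : ContDiffAt ℝ ∞ f (φ y) := hfs.contDiffAt (Metric.isOpen_ball.mem_nhds hy.2)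
  refine ⟨h2.contMDiffAt.comp y h1, ?_⟩
  rw [dfun_comp h1 h2, (hf _ hy.2).fderiv, ← hl]
  exact localRep_comp_dfun ν hy.1

lemma eventually_eq_of_dfun_eq_zero {f : N → ℝ} {p : N}
    (hf : ∀ᶠ y in 𝓝 p, ContMDiffAt (𝓡 d) 𝓘(ℝ, ℝ) ∞ f y ∧ dfun (d := d) f y = 0) :
    ∀ᶠ y in 𝓝 p, f y = f p := by
  have : IsManifold (𝓡 d) 1 N := IsManifold.of_le (n := ∞) (by simp)
  set φ := extChartAt (𝓡 d) p with hφ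
  have h1 := ((tendsto_extChartAt_symm (d := d) p).eventually hf).and
    (extChartAt_target_mem_nhds (I := 𝓡 d) p)
  obtain ⟨r, hr, hball⟩ := Metric.eventually_nhds_iff_ball.1 h1
  have hd : ∀ y ∈ Metric.ball (φ p) r, HasFDerivAt (f ∘ φ.symm) (0 : Model d →L[ℝ] ℝ) y := by
    intro y hy
    obtain ⟨⟨h2, h3⟩, h4⟩ := hball y hy
    have h5 : MDifferentiableAt 𝓘(ℝ, Model d) (𝓡 d) φ.symm y := by
      have := mdifferentiableWithinAt_extChartAt_symm (I := 𝓡 d) h4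
      rwa [modelWithCornersSelf_coe, Set.range_id, mdifferentiableWithinAt_univ] at this
    have h6 := (h2.mdifferentiableAt (by simp)).hasMFDerivAt.comp y h5.hasMFDerivAt
    have h7 : mfderiv (𝓡 d) 𝓘(ℝ, ℝ) f (φ.symm y) = (0 : Model d →L[ℝ] ℝ) := h3
    have h8 := h6.hasFDerivAt
    refine h8.congr_fderiv ?_
    rw [h7]
    rfl
  have hconst : ∀ y ∈ Metric.ball (φ p) r, (f ∘ φ.symm) y = (f ∘ φ.symm) (φ p) := fun y hy ↦
    (convex_ball (φ p) r).is_const_of_fderivWithin_eq_zero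
      (fun z hz ↦ (hd z hz).differentiableAt.differentiableWithinAt)
      (fun z hz ↦ by
        rw [fderivWithin_of_isOpen Metric.isOpen_ball hz, (hd z hz).fderiv]) hy
        (Metric.mem_ball_self hr)
  have hcont : ∀ᶠ y in 𝓝 p, φ y ∈ Metric.ball (φ p) r :=
    (continuousAt_extChartAt (I := 𝓡 d) p).eventually (Metric.ball_mem_nhds _ hr)
  filter_upwards [hcont, extChartAt_source_mem_nhds (I := 𝓡 d) p] with y hy hys
  have := hconst _ hy
  simpa only [Function.comp, hφ, (extChartAt (𝓡 d) p).left_inv hys, extChartAt_to_inv] using this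

/-- Simultaneous Diophantine approximation. -/
lemma exists_pos_nat_exp_near_one (S : Finset ℝ) {ε : ℝ} (hε : 0 < ε) :
    ∃ D : ℕ, 0 < D ∧ ∀ c ∈ S, ‖Complex.exp (2 * Real.pi * D * c * Complex.I) - 1‖ < ε := by
  let g : S → Circle := fun c ↦ Circle.exp (2 * Real.pi * c)
  have hV : {x : S → Circle | ∀ c, ‖(x c : ℂ) - 1‖ < ε} ∈ 𝓝 (1 : S → Circle) := by
    refine IsOpen.mem_nhds ?_ (by simpa using fun _ _ ↦ hε)
    simp only [Set.ofPred_forall]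
    exact isOpen_iInter_of_finite fun c ↦ isOpen_lt (by fun_prop) continuous_const
  -- In the compact group `S → Circle` the powers of any element return to every neighbourhood of
  -- the identity.
  have h := (mapClusterPt_one_atTop_pow g).frequently hV
  obtain ⟨D, h1, hD⟩ := (h.and_eventually (eventually_gt_atTop 0)).exists
  refine ⟨D, hD, fun c hc ↦ ?_⟩
  have h2 := h1 ⟨c, hc⟩
  simp only [Pi.pow_apply, g, ← Circle.exp_nsmul, Circle.coe_exp] at h2
  convert h2 using 4
  push_cast
  simp
  ring

end ClosedForms

/-! ### Tischler's theorem. -/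

section Fibration

open Filter Topology

variable {d : ℕ} {N : Type*} [TopologicalSpace N] [ChartedSpace (Model d) N]
  [IsManifold (𝓡 d) ∞ N]

/-- Replaces a Riemannian metric: a constant vector in a chart, normalised by `ν(w) = 1` at the
centre, keeps `ν(w) ≥ 1/2` and bounded `dψ(w)` nearby, and compactness makes the bound uniform. -/
lemma exists_vectors_with_bounded_differentials [CompactSpace N] {ι : Type*} [Fintype ι]
    {ν : OneForm d N} (hν : IsSmooth ν) (hν0 : ∀ x, ν x ≠ 0) {ψ : ι → N → ℝ}
    (hψ : ∀ j, ContMDiff (𝓡 d) 𝓘(ℝ, ℝ) ∞ (ψ j)) :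
    ∃ C : ℝ, ∀ y, ∃ w : Model d, 1 / 2 ≤ cov ν y w ∧ ∀ j, |dfun (d := d) (ψ j) y w| ≤ C := by
  suffices h : ∃ C : ℝ, ∀ y ∈ (Set.univ : Set N), ∃ w : Model d, 1 / 2 ≤ cov ν y w ∧
      ∀ j, |dfun (d := d) (ψ j) y w| ≤ C by simpa using h
  refine isCompact_univ.induction_on (p := fun s : Set N ↦ ∃ C : ℝ, ∀ y ∈ s, ∃ w : Model d,
    1 / 2 ≤ cov ν y w ∧ ∀ j, |dfun (d := d) (ψ j) y w| ≤ C) ⟨0, by simp⟩ ?_ ?_ ?_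
  · rintro s t hst ⟨C, hC⟩
    exact ⟨C, fun y hy ↦ hC y (hst hy)⟩
  · rintro s t ⟨C, hC⟩ ⟨C', hC'⟩
    refine ⟨max C C', fun y hy ↦ ?_⟩
    rcases hy with hy | hy
    · obtain ⟨w, h1, h2⟩ := hC y hy
      exact ⟨w, h1, fun j ↦ (h2 j).trans (le_max_left _ _)⟩
    · obtain ⟨w, h1, h2⟩ := hC' y hy
      exact ⟨w, h1, fun j ↦ (h2 j).trans (le_max_right _ _)⟩
  · intro x _
    have h0 : cov ν x ≠ 0 := hν0 x
    obtain ⟨w1, hw1⟩ : ∃ w, cov ν x w ≠ 0 := by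
      by_contra! h
      exact h0 (ContinuousLinearMap.ext h)
    set w0 : Model d := (cov ν x w1)⁻¹ • w1 with hw0
    have hval : cov ν x w0 = 1 := by rw [hw0, map_smul, smul_eq_mul, inv_mul_cancel₀ hw1]
    have hcont : ∀ γ : OneForm d N, SmoothFormAt γ x →
        ContinuousAt (fun y ↦ localRep γ x (extChartAt (𝓡 d) x y) w0) x := fun γ hγ ↦ by
      have h1 : ContinuousAt (localRep γ x) (extChartAt (𝓡 d) x x) := hγ.continuousAt
      exact (ContinuousAt.comp (g := localRep γ x) h1
        (continuousAt_extChartAt (I := 𝓡 d) x)).clm_apply continuousAt_const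
    have e1 : ∀ᶠ y in 𝓝 x, 1 / 2 < localRep ν x (extChartAt (𝓡 d) x y) w0 := by
      refine (hcont ν ((isSmooth_iff ν).1 hν x)).eventually (lt_mem_nhds ?_)
      change 1 / 2 < localRep ν x (extChartAt (𝓡 d) x x) w0
      rw [localRep_self, hval]; norm_num
    have e2 : ∀ j, ∀ᶠ y in 𝓝 x, |localRep (diff (ψ j)) x (extChartAt (𝓡 d) x y) w0| <
        |localRep (diff (ψ j)) x (extChartAt (𝓡 d) x x) w0| + 1 := fun j ↦ by
      refine (hcont _ (smoothFormAt_diff (hψ j x))).abs.eventually (gt_mem_nhds (lt_add_one _))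
    refine ⟨_, mem_nhdsWithin_of_mem_nhds ((e1.and (eventually_all.2 e2)).and
      (extChartAt_source_mem_nhds (I := 𝓡 d) x)),
      ∑ j, (|localRep (diff (ψ j)) x (extChartAt (𝓡 d) x x) w0| + 1), ?_⟩
    rintro y ⟨⟨h1, h2⟩, hy⟩
    refine ⟨(mfderiv 𝓘(ℝ, Model d) (𝓡 d) (extChartAt (𝓡 d) x).symm (extChartAt (𝓡 d) x y) :
        Model d →L[ℝ] Model d) w0, ?_, fun j ↦ ?_⟩
    · rw [← localRep_apply_extChartAt ν hy]; exact h1.le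
    · rw [← cov_diff, ← localRep_apply_extChartAt _ hy]
      exact (h2 j).le.trans (Finset.single_le_sum
        (f := fun j ↦ |localRep (diff (ψ j)) x (extChartAt (𝓡 d) x x) w0| + 1)
        (fun i _ ↦ by positivity) (Finset.mem_univ j))

/-- The difference is locally constant and `K` is compact. Finiteness of the transition constants
between primitives is what allows simultaneous approximation. -/
lemma finite_image_of_dfun_eq [CompactSpace N] {f g : N → ℝ} {K U : Set N} (hK : IsClosed K)
    (hU : IsOpen U) (hKU : K ⊆ U)
    (hf : ∀ y ∈ U, ContMDiffAt (𝓡 d) 𝓘(ℝ, ℝ) ∞ f y) (hg : ∀ y ∈ U, ContMDiffAt (𝓡 d) 𝓘(ℝ, ℝ) ∞ g y)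
    (hfg : ∀ y ∈ U, dfun (d := d) f y = dfun g y) : ((fun y ↦ f y - g y) '' K).Finite := by
  refine hK.isCompact.induction_on (p := fun s ↦ ((fun y ↦ f y - g y) '' s).Finite) (by simp)
    (fun s t hst ht ↦ ht.subset (Set.image_mono hst))
    (fun s t hs ht ↦ by rw [Set.image_union]; exact hs.union ht) fun x hx ↦ ?_
  have h : ∀ᶠ y in 𝓝 x, f y - g y = f x - g x := by
    refine eventually_eq_of_dfun_eq_zero (d := d) (f := fun y ↦ f y - g y) ?_
    filter_upwards [hU.mem_nhds (hKU hx)] with y hy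
    exact ⟨(hf y hy).sub (hg y hy), by rw [dfun_sub (hf y hy) (hg y hy), hfg y hy, sub_self]⟩
  refine ⟨_, mem_nhdsWithin_of_mem_nhds h, (Set.finite_singleton (f x - g x)).subset ?_⟩
  rintro _ ⟨y, hy, rfl⟩
  exact hy

lemma exists_finite_primitive_cover [CompactSpace N] {ν : OneForm d N} (hν : IsSmooth ν)
    (hc : ∀ x, dForm ν x = 0) :
    ∃ (t : Finset N) (h : t → N → ℝ) (U : t → Set N), (∀ i, IsOpen (U i)) ∧ (⋃ i, U i) = Set.univ ∧
      ∀ i, ∀ y ∈ U i, ContMDiffAt (𝓡 d) 𝓘(ℝ, ℝ) ∞ (h i) y ∧ dfun (h i) y = cov ν y := by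
  choose h U hU hx hh using exists_local_primitive hν hc
  obtain ⟨t, ht⟩ := isCompact_univ.elim_finite_subcover U hU fun x _ ↦ Set.mem_iUnion.2 ⟨x, hx x⟩
  refine ⟨t, fun i ↦ h i, fun i ↦ U i, fun i ↦ hU i, ?_, fun i ↦ hh i⟩
  rw [← Set.univ_subset_iff]
  intro y hy
  obtain ⟨i, hi, hy⟩ := Set.mem_iUnion₂.1 (ht hy)
  exact Set.mem_iUnion.2 ⟨⟨i, hi⟩, hy⟩

/-- Tischler's theorem: a closed manifold with a nowhere vanishing closed `1`-form has a
submersion to the circle. -/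
theorem exists_submersion_circle [CompactSpace N] [T2Space N] {ν : OneForm d N} (hν : IsSmooth ν)
    (hν0 : ∀ x, ν x ≠ 0) (hc : ∀ x, dForm ν x = 0) :
    ∃ q : N → Circle, ContMDiff (𝓡 d) 𝓘(ℝ, ℂ) ∞ (fun x ↦ (q x : ℂ)) ∧
      ∀ x, (angleForm q : OneForm d N) x ≠ 0 := by
  classical
  obtain ⟨t, h, U, hU, hcov, hh⟩ := exists_finite_primitive_cover hν hc
  obtain ⟨ψ, hψU⟩ := SmoothPartitionOfUnity.exists_isSubordinate (𝓡 d) isClosed_univ U hU hcov.ge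
  obtain ⟨C, hC⟩ := exists_vectors_with_bounded_differentials hν hν0 (ψ := fun j ↦ ψ j)
    fun j ↦ (ψ j).contMDiff
  have hfin : ∀ i j, ((fun y ↦ h j y - h i y) '' (tsupport (ψ i) ∩ tsupport (ψ j))).Finite := fun i j ↦
    finite_image_of_dfun_eq (d := d) ((isClosed_tsupport _).inter (isClosed_tsupport _))
      ((hU i).inter (hU j)) (Set.inter_subset_inter (hψU i) (hψU j))
      (fun y hy ↦ (hh j y hy.2).1) (fun y hy ↦ (hh i y hy.1).1)
      fun y hy ↦ by rw [(hh j y hy.2).2, (hh i y hy.1).2]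
  have hψ0 : ∀ i y, 0 ≤ ψ i y := fun i y ↦ ψ.nonneg i y
  have hψ1 : ∀ y, ∑ i, ψ i y = 1 := fun y ↦ by
    rw [← finsum_eq_sum_of_fintype]; exact ψ.sum_eq_one (Set.mem_univ y)
  set K : ℝ := (Fintype.card t : ℝ) * |C| with hK
  have hK0 : 0 ≤ K := by positivity
  -- The first bound keeps `‖E‖ ≥ 1/2`; the second makes the error in `dE`, at most `K ε`, smaller
  -- than `1/2`.
  set ε : ℝ := min (1 / 2) (1 / (2 * (K + 1))) with hε
  have hε0 : 0 < ε := by positivity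
  obtain ⟨D, hD0, hD⟩ := exists_pos_nat_exp_near_one
    ((Set.finite_iUnion fun i ↦ Set.finite_iUnion fun j ↦ hfin i j).toFinset) hε0
  -- By the choice of `D` these local maps to the circle agree up to `ε` on overlaps of the
  -- supports, so averaging them gives the global map `E` up to normalisation.
  let e : t → N → ℂ := fun j y ↦ Complex.exp (2 * Real.pi * D * h j y * Complex.I)
  have he1 : ∀ j y, ‖e j y‖ = 1 := fun j y ↦ by
    have : (2 * Real.pi * D * h j y * Complex.I : ℂ) =
      ((2 * Real.pi * D * h j y : ℝ) : ℂ) * Complex.I := by push_cast; ring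
    simp only [e, this, Complex.norm_exp_ofReal_mul_I]
  have hdist : ∀ i j y, y ∈ tsupport (ψ i) → y ∈ tsupport (ψ j) → ‖e j y - e i y‖ ≤ ε := by
    intro i j y hi hj
    have h1 := hD (h j y - h i y) (by
      rw [Set.Finite.mem_toFinset]
      exact Set.mem_iUnion.2 ⟨i, Set.mem_iUnion.2 ⟨j, y, ⟨hi, hj⟩, rfl⟩⟩)
    have h2 : e j y - e i y = e i y *
        (Complex.exp (2 * Real.pi * D * (h j y - h i y : ℝ) * Complex.I) - 1) := by
      simp only [e]
      rw [mul_sub, ← Complex.exp_add, mul_one]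
      congr 2
      push_cast; ring
    rw [h2, norm_mul, he1, one_mul]
    exact h1.le
  have hexp : ContDiff ℝ ∞ fun s : ℝ ↦ Complex.exp (2 * Real.pi * D * s * Complex.I) :=
    Complex.contDiff_exp.comp
      ((contDiff_const.mul Complex.ofRealCLM.contDiff).mul contDiff_const)
  have hes : ∀ j, ∀ y ∈ tsupport (ψ j), ContMDiffAt (𝓡 d) 𝓘(ℝ, ℂ) ∞ (e j) y := fun j y hy ↦
    (hexp.contDiffAt.contMDiffAt).comp y (hh j y (hψU j hy)).1
  have hed : ∀ j, ∀ y ∈ tsupport (ψ j), ∀ w : Model d,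
      dfun (e j) y w = (2 * Real.pi * D * cov ν y w : ℝ) * Complex.I * e j y := fun j y hy w ↦ by
    have h1 := hh j y (hψU j hy)
    have h2 : HasDerivAt (fun s : ℝ ↦ Complex.exp (2 * Real.pi * D * s * Complex.I))
        (Complex.exp (2 * Real.pi * D * h j y * Complex.I) * (2 * Real.pi * D * Complex.I))
        (h j y) := by
      have h3 : HasDerivAt (fun s : ℝ ↦ (2 * Real.pi * D * s * Complex.I : ℂ))
          (2 * Real.pi * D * Complex.I) (h j y) := by
        have := ((Complex.ofRealCLM.hasDerivAt (x := h j y)).const_mul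
          (2 * Real.pi * D : ℂ)).mul_const Complex.I
        simpa using this
      exact h3.cexp
    simp only [e]
    rw [dfun_comp (g := fun s : ℝ ↦ Complex.exp (2 * Real.pi * D * s * Complex.I)) h1.1
      hexp.contDiffAt, h1.2, h2.hasFDerivAt.fderiv]
    simp only [ContinuousLinearMap.comp_apply, ContinuousLinearMap.toSpanSingleton_apply,
      Complex.real_smul]
    push_cast
    ring
  let E : N → ℂ := fun y ↦ ∑ j, ψ j y • e j y
  have hEs : ∀ j, ContMDiff (𝓡 d) 𝓘(ℝ, ℂ) ∞ fun y ↦ ψ j y • e j y := fun j ↦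
    ψ.contMDiff_smul (hes j)
  have hE : ContMDiff (𝓡 d) 𝓘(ℝ, ℂ) ∞ E := fun y ↦ contMDiffAt_finsetSum fun j _ ↦ hEs j y
  have hsupp : ∀ y, ∃ i, y ∈ tsupport (ψ i) := by
    intro y
    by_contra! hcon
    have := hψ1 y
    rw [Finset.sum_eq_zero fun i _ ↦ image_eq_zero_of_notMem_tsupport (hcon i)] at this
    exact zero_ne_one this
  have hEnear : ∀ i y, y ∈ tsupport (ψ i) → ‖E y - e i y‖ ≤ ε := by
    intro i y hi
    have h1 : E y - e i y = ∑ j, ψ j y • (e j y - e i y) := by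
      simp only [smul_sub, Finset.sum_sub_distrib, ← Finset.sum_smul, hψ1, one_smul, E]
    rw [h1]
    calc ‖∑ j, ψ j y • (e j y - e i y)‖ ≤ ∑ j, ψ j y * ε := by
          refine norm_sum_le_of_le _ fun j _ ↦ ?_
          rw [norm_smul, Real.norm_of_nonneg (hψ0 j y)]
          by_cases hj : y ∈ tsupport (ψ j)
          · exact mul_le_mul_of_nonneg_left (hdist i j y hi hj) (hψ0 j y)
          · rw [image_eq_zero_of_notMem_tsupport hj]; simp
      _ = ε := by rw [← Finset.sum_mul, hψ1, one_mul]
  have hElow : ∀ y, 1 / 2 ≤ ‖E y‖ := fun y ↦ by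
    obtain ⟨i, hi⟩ := hsupp y
    have h1 := hEnear i y hi
    have h2 := norm_sub_norm_le (e i y) (E y)
    rw [he1, norm_sub_rev] at h2
    have h3 : ε ≤ 1 / 2 := min_le_left _ _
    linarith
  have hE0 : ∀ y, E y ≠ 0 := fun y h0 ↦ by
    have := hElow y
    rw [h0, norm_zero] at this
    norm_num at this
  have hEhigh : ∀ y, ‖E y‖ ≤ 1 := fun y ↦ by
    calc ‖E y‖ ≤ ∑ j, ψ j y := norm_sum_le_of_le _ fun j _ ↦ by
          rw [norm_smul, he1, mul_one, Real.norm_of_nonneg (hψ0 j y)]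
      _ = 1 := hψ1 y
  -- Since `∑ dψⱼ = 0`, the reference value `e i y` may be subtracted from each `e j y` in the terms
  -- with `dψⱼ`, which makes them small.
  have hdE : ∀ i y, y ∈ tsupport (ψ i) → ∀ w : Model d, dfun E y w =
      (2 * Real.pi * D * cov ν y w : ℝ) * Complex.I * E y +
        ∑ j, dfun (d := d) (ψ j) y w • (if y ∈ tsupport (ψ j) then e j y - e i y else 0) := by
    intro i y hi w
    have hsum0 : ∑ j, dfun (d := d) (ψ j) y w = 0 := by
      have h1 := dfun_sum (d := d) (p := y) Finset.univ (f := fun j y ↦ ψ j y)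
        fun j _ ↦ (ψ j).contMDiff y
      rw [show (fun q ↦ ∑ j, ψ j q) = fun _ ↦ (1 : ℝ) from funext hψ1, dfun_const] at h1
      have h2 := congrArg (fun T : Model d →L[ℝ] ℝ ↦ T w) h1
      simpa using h2.symm
    have hz : ∀ j, y ∉ tsupport (ψ j) → dfun (d := d) (ψ j) y = 0 ∧
        dfun (d := d) (fun y ↦ ψ j y • e j y) y = 0 := by
      intro j hj
      have h1 := notMem_tsupport_iff_eventuallyEq.1 hj
      refine ⟨(dfun_congr h1).trans (dfun_const 0 y), ?_⟩
      refine (dfun_congr (g := fun _ ↦ (0 : ℂ)) ?_).trans (dfun_const 0 y)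
      filter_upwards [h1] with z hz
      rw [hz]; simp
    have hterm : ∀ j, dfun (d := d) (fun y ↦ ψ j y • e j y) y w =
        (2 * Real.pi * D * cov ν y w : ℝ) * Complex.I * (ψ j y • e j y) +
        (dfun (d := d) (ψ j) y w • (if y ∈ tsupport (ψ j) then e j y - e i y else 0) +
          dfun (d := d) (ψ j) y w • e i y) := by
      intro j
      by_cases hj : y ∈ tsupport (ψ j)
      · rw [dfun_smul ((ψ j).contMDiff y) (hes j y hj), if_pos hj]
        simp only [add_apply, FunLike.coe_smul, Pi.smul_apply,
          ContinuousLinearMap.smulRight_apply, hed j y hj w, Complex.real_smul]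
        ring
      · rw [(hz j hj).1, (hz j hj).2, image_eq_zero_of_notMem_tsupport hj]
        simp
    have h1 := dfun_sum (d := d) (p := y) Finset.univ (f := fun j y ↦ ψ j y • e j y)
      fun j _ ↦ hEs j y
    have h2 := congrArg (fun T : Model d →L[ℝ] ℂ ↦ T w) h1
    simp only [sum_apply, hterm, Finset.sum_add_distrib, ← Finset.sum_smul,
      hsum0, zero_smul, add_zero, ← Finset.mul_sum] at h2
    exact h2
  have hpos : ∀ y, ∃ w, 0 < cov (d := d) (angular E) y w := by
    intro y
    obtain ⟨w, hw, hwC⟩ := hC y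
    obtain ⟨i, hi⟩ := hsupp y
    refine ⟨w, ?_⟩
    set s : ℂ := ∑ j, dfun (d := d) (ψ j) y w • (if y ∈ tsupport (ψ j) then e j y - e i y else 0)
      with hs
    have hsn : ‖s‖ ≤ K * ε := by
      have : ‖s‖ ≤ ∑ _j : t, |C| * ε := norm_sum_le_of_le _ fun j _ ↦ by
        rw [norm_smul]
        refine mul_le_mul ((hwC j).trans (le_abs_self C)) ?_ (norm_nonneg _) (abs_nonneg _)
        split_ifs with hj
        · exact hdist i j y hi hj
        · simpa using hε0.le
      refine this.trans (le_of_eq ?_)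
      rw [Finset.sum_const, Finset.card_univ, nsmul_eq_mul, hK, mul_assoc]
    have hKε : K * ε < 1 / 2 := by
      have h1 : ε ≤ 1 / (2 * (K + 1)) := min_le_right _ _
      calc K * ε ≤ K * (1 / (2 * (K + 1))) := mul_le_mul_of_nonneg_left h1 hK0
        _ < 1 / 2 := by
          rw [mul_one_div, div_lt_div_iff₀ (by positivity) (by norm_num)]
          linarith
    rw [cov_angular, hdE i y hi w, mul_add, Complex.add_im]
    have h1 : (starRingEnd ℂ (E y) * ((2 * Real.pi * D * cov ν y w : ℝ) * Complex.I * E y)).im =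
        2 * Real.pi * D * cov ν y w * ‖E y‖ ^ 2 := by
      rw [show starRingEnd ℂ (E y) * ((2 * Real.pi * D * cov ν y w : ℝ) * Complex.I * E y) =
        (2 * Real.pi * D * cov ν y w : ℝ) * Complex.I * (starRingEnd ℂ (E y) * E y) by ring,
        Complex.conj_mul', show (2 * Real.pi * D * cov ν y w : ℝ) * Complex.I * (‖E y‖ : ℂ) ^ 2 =
        (2 * Real.pi * D * cov ν y w * ‖E y‖ ^ 2 : ℝ) * Complex.I by push_cast; ring,
        Complex.im_ofReal_mul, Complex.I_im, mul_one]
    have h2 : -(1 / 2) < (starRingEnd ℂ (E y) * s).im := by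
      have h3 := Complex.abs_im_le_norm (starRingEnd ℂ (E y) * s)
      rw [norm_mul, Complex.norm_conj] at h3
      have h4 : ‖E y‖ * ‖s‖ ≤ 1 * (K * ε) :=
        mul_le_mul (hEhigh y) hsn (norm_nonneg _) zero_le_one
      have h5 := neg_abs_le (starRingEnd ℂ (E y) * s).im
      linarith
    -- From `π > 3`, `D ≥ 1`, `ν(w) ≥ 1/2` and `‖E‖ ≥ 1/2` the main term is at least `3/4`, so it
    -- beats the error.
    have h6 : 1 / 2 ≤ 2 * Real.pi * D * cov ν y w * ‖E y‖ ^ 2 := by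
      have hD1 : (1 : ℝ) ≤ D := by exact_mod_cast hD0
      have h7 : (1 / 2 : ℝ) ^ 2 ≤ ‖E y‖ ^ 2 := pow_le_pow_left₀ (by norm_num) (hElow y) 2
      have h8 : 3 ≤ 2 * Real.pi * D * cov ν y w := by
        have h9 := Real.pi_gt_three
        calc (3 : ℝ) ≤ 2 * Real.pi * 1 * (1 / 2) := by linarith
          _ ≤ 2 * Real.pi * D * cov ν y w := by gcongr
      nlinarith
    rw [h1]
    linarith
  have hr : ∀ y, ContMDiffAt (𝓡 d) 𝓘(ℝ, ℝ) ∞ (fun y ↦ ‖E y‖⁻¹) y := fun y ↦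
    ((contDiffAt_norm ℝ (hE0 y)).inv (norm_ne_zero_iff.2 (hE0 y))).contMDiffAt.comp y (hE y)
  refine ⟨fun y ↦ ⟨‖E y‖⁻¹ • E y, by
    refine mem_sphere_zero_iff_norm.2 ?_
    rw [norm_smul, norm_inv, norm_norm,
      inv_mul_cancel₀ (norm_ne_zero_iff.2 (hE0 y))]⟩, fun y ↦ (hr y).smul (hE y), fun y h0 ↦ ?_⟩
  obtain ⟨w, hw⟩ := hpos y
  have h1 : cov (d := d) (angular fun y ↦ ‖E y‖⁻¹ • E y) y = 0 := h0
  rw [cov_angular_smul (hr y) (hE y)] at h1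
  have h2 := congrArg (fun T : Model d →L[ℝ] ℝ ↦ T w) h1
  simp only [FunLike.coe_smul, Pi.smul_apply, smul_eq_mul, zero_apply] at h2
  have h3 := norm_pos_iff.2 (hE0 y)
  have : 0 < ‖E y‖⁻¹ ^ 2 * cov (d := d) (angular E) y w := by positivity
  exact this.ne' h2

end Fibration

/-! ### Top powers of forms on a product with a plane. -/

section TopForms

open ExteriorAlgebra

variable {d m k n : ℕ}

lemma wedgePow_conformal {β γ : Model d →L[ℝ] ℝ} {η : Model d [⋀^Fin 2]→L[ℝ] ℝ} {r : ℝ}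
    {β' : Model d → ℝ} {η' : (Fin 2 → Model d) → ℝ} (hβ : ∀ u, β' u = r * β u)
    (hη : ∀ u, η' u = r * η u + (γ (u 0) * β (u 1) - γ (u 1) * β (u 0)))
    (v : Fin (2 * n + 1) → Model d) :
    wedgePow β' η' n v = r ^ (n + 1) * wedgePow β (fun u ↦ η u) n v := by
  obtain ⟨X, hX⟩ := exists_represents η
  have h := (Represents.wedge γ β).add (hX.smul r)
  have e1 : β' = ⇑(r • β) := funext fun u ↦ by rw [hβ]; rfl
  have e2 : η' = fun u ↦ (γ (u 0) * β (u 1) - γ (u 1) * β (u 0)) + r * η u :=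
    funext fun u ↦ by rw [hη, add_comm]
  rw [e1, e2, h.wedgePow_eq, hX.wedgePow_eq, map_smul, smul_mul_assoc,
    ι_mul_pow_conformal hX.commute, map_smul, map_smul, smul_eq_mul, smul_eq_mul]
  ring

lemma wedgePow_zero (β : Model d → ℝ) {η : (Fin 2 → Model d) → ℝ} (hη : ∀ u, η u = 0) (hn : n ≠ 0)
    (v : Fin (2 * n + 1) → Model d) : wedgePow β η n v = 0 := by
  simp [wedgePow, hη, hn]

/-- The only candidates in `β ∧ η` are `ν ∧ dr ∧ dθ` and `dθ ∧ dr ∧ ν`, with coefficients `a b'` and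
`b a'`. -/
lemma wedgePow_integrable {β : Model d → ℝ} {η : (Fin 2 → Model d) → ℝ}
    (ν Θ R : Model d →L[ℝ] ℝ) (a b c a' b' : ℝ) (hab : a * b' = 0) (hba : b * a' = 0)
    (hβ : ∀ u, β u = a * ν u + b * Θ u + c * R u)
    (hη : ∀ u, η u = R (u 0) * (a' * ν (u 1) + b' * Θ (u 1)) -
      R (u 1) * (a' * ν (u 0) + b' * Θ (u 0)))
    (v : Fin (2 * 1 + 1) → Model d) : wedgePow β η 1 v = 0 := by
  have h := Represents.wedge R (a' • ν + b' • Θ)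
  have e1 : β = ⇑(a • ν + b • Θ + c • R) := funext fun u ↦ by rw [hβ]; rfl
  have e2 : η = fun u ↦ R (u 0) * (a' • ν + b' • Θ) (u 1) - R (u 1) * (a' • ν + b' • Θ) (u 0) :=
    funext fun u ↦ by rw [hη]; rfl
  rw [e1, e2, h.wedgePow_eq, pow_one]
  have h1 : ∀ x : Model d →L[ℝ] ℝ, ι ℝ x * (ι ℝ R * ι ℝ x) = 0 := fun x ↦ by
    rw [ι_mul_ι_comm R, mul_neg, ← mul_assoc, ι_sq_zero, zero_mul, neg_zero]
  have h2 : ∀ x : Model d →L[ℝ] ℝ, ι ℝ R * (ι ℝ R * ι ℝ x) = 0 := fun x ↦ by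
    rw [← mul_assoc, ι_sq_zero, zero_mul]
  have h3 : ι ℝ (a • ν + b • Θ + c • R) * (ι ℝ R * ι ℝ (a' • ν + b' • Θ)) =
      (a * b') • (ι ℝ ν * (ι ℝ R * ι ℝ Θ)) + (b * a') • (ι ℝ Θ * (ι ℝ R * ι ℝ ν)) := by
    simp only [map_add, map_smul, add_mul, mul_add, smul_mul_assoc, mul_smul_comm, h1, h2,
      smul_zero, add_zero, zero_add]
    module
  rw [h3, hab, hba, zero_smul, zero_smul, add_zero, map_zero]

/-- `T` evaluates `(dμ)^k ∧ μ ∧ dr ∧ dθ`. It is chosen before the coefficients, so a single `T`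
serves to compare `β`, `dθ` and the whole segment. -/
lemma exists_wedgePow_product (hm : m = 2 * k + 1) (hn : n = k + 1) (P : Model d →L[ℝ] Model m)
    (ηN : Model m [⋀^Fin 2]→L[ℝ] ℝ) (μ ν : Model m →L[ℝ] ℝ)
    (hν : ∀ v, wedgePow ν (fun u ↦ ηN u) k v = 0) (R Θ : Model d →L[ℝ] ℝ) :
    ∃ T : (Fin (2 * n + 1) → Model d) → ℝ, ∀ (F B H G c F' H' G' : ℝ) (β : Model d → ℝ)
      (η : (Fin 2 → Model d) → ℝ),
      (∀ u, β u = B * μ (P u) + H * ν (P u) + G * Θ u + c * R u) →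
      (∀ u, η u = F * ηN (fun i ↦ P (u i)) +
        (R (u 0) * (F' * μ (P (u 1)) + H' * ν (P (u 1)) + G' * Θ (u 1)) -
          R (u 1) * (F' * μ (P (u 0)) + H' * ν (P (u 0)) + G' * Θ (u 0)))) →
      ∀ v, wedgePow β η n v = (k + 1) * F ^ k * (B * G' - G * F') * T v := by
  subst hm hn
  obtain ⟨Y, hY⟩ := exists_represents ηN
  have hX := hY.comp P
  set X := ExteriorAlgebra.map (covectorPullback P) Y
  have hX0 : X ^ (k + 1) = 0 := by rw [← map_pow, hY.pow_succ_eq_zero, map_zero]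
  have hνX : ι ℝ (ν.comp P) * X ^ k = 0 := by
    have := congrArg (ExteriorAlgebra.map (covectorPullback P)) (hY.ι_mul_pow_eq_zero ν hν)
    rwa [map_mul, map_pow, map_zero, ExteriorAlgebra.map_apply_ι] at this
  refine ⟨fun v ↦ pairing v (X ^ k * (ι ℝ (μ.comp P) * (ι ℝ R * ι ℝ Θ))),
    fun F B H G c F' H' G' β η hβ hη v ↦ ?_⟩
  have h := (hX.smul F).add (Represents.wedge R (F' • μ.comp P + H' • ν.comp P + G' • Θ))
  have e1 : β = ⇑(B • μ.comp P + H • ν.comp P + G • Θ + c • R) := funext fun u ↦ by rw [hβ]; rfl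
  rw [e1, show η = _ from funext hη]
  refine (h.wedgePow_eq _ _ _).trans ?_
  rw [ι_mul_pow_product hX.commute hX0 _ _ _ _ hνX, map_smul, smul_eq_mul]

/-- The same computation on the core, with Cartesian covectors in place of the singular `dr` and
`dθ`. The leading form is purely `ν`, so `B = G = 0` and `B G' - G F'` vanishes. -/
lemma wedgePow_binding (hm : m = 2 * k + 1) (hn : n = k + 1) (P : Model d →L[ℝ] Model m)
    (ηN : Model m [⋀^Fin 2]→L[ℝ] ℝ) (ν : Model m →L[ℝ] ℝ)
    (hν : ∀ v, wedgePow ν (fun u ↦ ηN u) k v = 0) (x y : Model d →L[ℝ] ℝ) (F : ℝ)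
    {β : Model d → ℝ} (hβ : ∀ u, β u = ν (P u)) {η : (Fin 2 → Model d) → ℝ}
    (hη : ∀ u, η u = F * ηN (fun i ↦ P (u i)) + (x (u 0) * y (u 1) - x (u 1) * y (u 0)))
    (v : Fin (2 * n + 1) → Model d) : wedgePow β η n v = 0 := by
  obtain ⟨T, hT⟩ := exists_wedgePow_product hm hn P ηN ν ν hν x y
  rw [hT F 0 1 0 0 0 0 1 β η (fun u ↦ by rw [hβ]; ring) (fun u ↦ by rw [hη]; ring) v]
  ring

end TopForms

/-! ### Radial profiles of the spinnable form. -/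

section Profiles

/-- Coefficients `a(r)`, `b(r)` and the primitive `C(r)` of the coefficient `c(r)` for a spinnable
foliation `a(r) ν + b(r) dθ + c(r) dr`. -/
structure IsSpinProfile (a b C : ℝ → ℝ) : Prop where
  contDiff_a : ContDiff ℝ ∞ a
  contDiff_b : ContDiff ℝ ∞ b
  contDiff_C : ContDiff ℝ ∞ C
  a_nonneg : ∀ r, 0 ≤ a r
  a_pos : ∀ r < 1 / 2, 0 < a r
  a_zero : ∀ r, 1 / 2 ≤ r → a r = 0
  a_one : ∀ r ≤ 1 / 4, a r = 1
  b_nonneg : ∀ r, 0 ≤ b r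
  b_zero : ∀ r ≤ 1 / 2, b r = 0
  b_pos : ∀ r, 1 / 2 < r → 0 < b r
  b_one : ∀ r, 3 / 4 ≤ r → b r = 1
  deriv_b_nonneg : ∀ r, 0 ≤ deriv b r
  C_zero : ∀ r ≤ 1 / 4, C r = 0
  C_zero' : ∀ r, 3 / 4 ≤ r → C r = 0
  deriv_C : deriv C (1 / 2) = 1

lemma exists_isSpinProfile : ∃ a b C : ℝ → ℝ, IsSpinProfile a b C := by
  have hs : ContDiff ℝ ∞ Real.smoothTransition := Real.smoothTransition.contDiff
  refine ⟨fun r ↦ Real.smoothTransition (2 - 4 * r), fun r ↦ Real.smoothTransition (4 * r - 2),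
    -- `C` is `r - 1/2` times a cutoff equal to `1` on `[3/8, 5/8]`, so that `C' = 1` at `1/2`.
    fun r ↦ Real.smoothTransition (8 * r - 2) * Real.smoothTransition (6 - 8 * r) * (r - 1 / 2),
    hs.comp (by fun_prop), hs.comp (by fun_prop),
    ((hs.comp (by fun_prop)).mul (hs.comp (by fun_prop))).mul (by fun_prop),
    fun r ↦ Real.smoothTransition.nonneg _, fun r hr ↦ Real.smoothTransition.pos_of_pos (by linarith),
    fun r hr ↦ Real.smoothTransition.zero_of_nonpos (by linarith),
    fun r hr ↦ Real.smoothTransition.one_of_one_le (by linarith),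
    fun r ↦ Real.smoothTransition.nonneg _,
    fun r hr ↦ Real.smoothTransition.zero_of_nonpos (by linarith),
    fun r hr ↦ Real.smoothTransition.pos_of_pos (by linarith),
    fun r hr ↦ Real.smoothTransition.one_of_one_le (by linarith),
    fun r ↦ ?_, fun r hr ↦ ?_, fun r hr ↦ ?_, ?_⟩
  · refine Monotone.deriv_nonneg (fun x y hxy ↦ Real.smoothTransition.monotone (by linarith))
  · rw [Real.smoothTransition.zero_of_nonpos (x := 8 * r - 2) (by linarith)]; simp
  · rw [Real.smoothTransition.zero_of_nonpos (x := 6 - 8 * r) (by linarith)]; simp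
  · have : (fun r ↦ Real.smoothTransition (8 * r - 2) * Real.smoothTransition (6 - 8 * r) *
        (r - 1 / 2)) =ᶠ[nhds (1 / 2)] fun r ↦ r - 1 / 2 := by
      filter_upwards [Ioo_mem_nhds (show (3 / 8 : ℝ) < 1 / 2 by norm_num)
        (show (1 / 2 : ℝ) < 5 / 8 by norm_num)] with r hr
      rw [Real.smoothTransition.one_of_one_le (by linarith [hr.1]),
        Real.smoothTransition.one_of_one_le (by linarith [hr.2]), one_mul, one_mul]
    rw [this.deriv_eq]
    simp

namespace IsSpinProfile

variable {a b C : ℝ → ℝ}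

/-- Where `a` does not vanish, the nonnegative function `b` is zero, hence at a minimum, so its
derivative vanishes too. -/
lemma a_mul_deriv_b (h : IsSpinProfile a b C) (r : ℝ) : a r * deriv b r = 0 := by
  rcases le_or_gt (1 / 2) r with hr | hr
  · rw [h.a_zero r hr, zero_mul]
  · rw [IsLocalMin.deriv_eq_zero (Filter.Eventually.of_forall fun s ↦ by
      rw [h.b_zero r hr.le]; exact h.b_nonneg s), mul_zero]

lemma b_mul_deriv_a (h : IsSpinProfile a b C) (r : ℝ) : b r * deriv a r = 0 := by
  rcases le_or_gt r (1 / 2) with hr | hr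
  · rw [h.b_zero r hr, zero_mul]
  · rw [IsLocalMin.deriv_eq_zero (Filter.Eventually.of_forall fun s ↦ by
      rw [h.a_zero r hr.le]; exact h.a_nonneg s), mul_zero]

lemma deriv_C_zero (h : IsSpinProfile a b C) {r : ℝ} (hr : r < 1 / 4 ∨ 3 / 4 < r) :
    deriv C r = 0 := by
  have : C =ᶠ[nhds r] fun _ ↦ 0 := by
    rcases hr with hr | hr
    · filter_upwards [Iio_mem_nhds hr] with s hs using h.C_zero s hs.le
    · filter_upwards [Ioi_mem_nhds hr] with s hs using h.C_zero' s hs.le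
  rw [this.deriv_eq, deriv_const]

end IsSpinProfile

end Profiles

/-! ### Segments, quotients and rescalings of forms. -/

section FormLemmas

open Filter Topology

variable {d : ℕ} {M : Type*} [TopologicalSpace M] [ChartedSpace (Model d) M]
  [IsManifold (𝓡 d) ∞ M]

lemma dForm_segment {α β : OneForm d M} {p : M} (hα : SmoothFormAt α p) (hβ : SmoothFormAt β p)
    (s t : ℝ) (u : Fin 2 → Model d) :
    dForm (fun q ↦ s • α q + t • β q) p u = s * dForm α p u + t * dForm β p u := by
  have hc : ∀ s : ℝ, ContMDiffAt (𝓡 d) 𝓘(ℝ, ℝ) ∞ (fun _ : M ↦ s) p := fun s ↦ contMDiffAt_const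
  have h := dForm_add (hα.fmul (hc s)) (hβ.fmul (hc t)) u
  rw [dForm_fmul hα (hc s), dForm_fmul hβ (hc t)] at h
  simp only [cov_diff, dfun_const, zero_apply, zero_mul, sub_self, add_zero] at h
  exact h

/-- A function is smooth where its product with a nonzero smooth form is smooth. -/
lemma contMDiffAt_of_fmul {α γ : OneForm d M} {F : M → ℝ} {p : M} (hα : SmoothFormAt α p)
    (hγ : SmoothFormAt γ p) (hγ0 : cov γ p ≠ 0) (h : ∀ᶠ q in 𝓝 p, α q = fmul F γ q) :
    ContMDiffAt (𝓡 d) 𝓘(ℝ, ℝ) ∞ F p := by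
  obtain ⟨w, hw⟩ : ∃ w, cov γ p w ≠ 0 := by
    by_contra! h
    exact hγ0 (ContinuousLinearMap.ext h)
  have hw' : localRep γ p (extChartAt (𝓡 d) p p) w ≠ 0 := by rwa [localRep_self]
  have hnum : ContDiffAt ℝ ∞ (fun y ↦ localRep α p y w) (extChartAt (𝓡 d) p p) :=
    ContDiffAt.clm_apply hα contDiffAt_const
  have hden : ContDiffAt ℝ ∞ (fun y ↦ localRep γ p y w) (extChartAt (𝓡 d) p p) :=
    ContDiffAt.clm_apply hγ contDiffAt_const
  have hdiv := (hnum.div hden hw').contMDiffAt.comp p (contMDiffAt_extChartAt (I := 𝓡 d) (n := ∞))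
  refine hdiv.congr_of_eventuallyEq ?_
  have hne : ∀ᶠ q in 𝓝 p, localRep γ p (extChartAt (𝓡 d) p q) w ≠ 0 :=
    (ContinuousAt.comp (g := fun y ↦ localRep γ p y w) hden.continuousAt
      (continuousAt_extChartAt (I := 𝓡 d) p)).eventually (isOpen_ne.mem_nhds hw')
  filter_upwards [h, hne, extChartAt_source_mem_nhds (I := 𝓡 d) p] with q hq hq' hqs
  have e : localRep α p (extChartAt (𝓡 d) p q) w = F q * localRep γ p (extChartAt (𝓡 d) p q) w := by
    rw [localRep_apply_extChartAt α hqs, localRep_apply_extChartAt γ hqs, show cov α q = _ from hq]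
    rfl
  change F q = localRep α p (extChartAt (𝓡 d) p q) w / localRep γ p (extChartAt (𝓡 d) p q) w
  rw [e, mul_div_assoc, div_self hq', mul_one]

omit [IsManifold (𝓡 d) ∞ M] in
lemma dfun_eq_zero_of_isLocalMax {F : M → ℝ} {p : M} (hF : ContMDiffAt (𝓡 d) 𝓘(ℝ, ℝ) ∞ F p)
    (h : ∀ᶠ q in 𝓝 p, F q ≤ F p) : dfun (d := d) F p = 0 := by
  rw [dfun_eq_fderiv hF]
  refine IsLocalMax.fderiv_eq_zero ?_
  filter_upwards [(tendsto_extChartAt_symm p).eventually h] with y hy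
  simpa using hy

/-- The orientations defined by a form and by its positive multiples agree. -/
lemma wedgeD_fmul {α : OneForm d M} {ρ : M → ℝ} {p : M} (hα : SmoothFormAt α p)
    (hρ : ContMDiffAt (𝓡 d) 𝓘(ℝ, ℝ) ∞ ρ p) (n : ℕ)
    (v : Fin (2 * n + 1) → TangentSpace (𝓡 d) p) :
    wedgeD (fmul ρ α) (fmul ρ α) n p v = ρ p ^ (n + 1) * wedgeD α α n p v :=
  wedgePow_conformal (β := cov α p) (γ := cov (diff ρ) p) (η := dForm α p) (r := ρ p)
    (fun _ ↦ rfl) (fun u ↦ dForm_fmul hα hρ u) v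

end FormLemmas

/-! ### Coordinates and polar forms in a tubular neighbourhood. -/

section Tubes

/-- The projection of a tubular neighbourhood to the binding (with irrelevant values outside). -/
def tubeBase {M N : Type*} [Nonempty N] (Φ : N × ℂ → M) (p : M) : N := (Function.invFun Φ p).1

/-- The plane coordinate of a tubular neighbourhood (with irrelevant values outside). -/
def tubeCoord {M N : Type*} [Nonempty N] (Φ : N × ℂ → M) (p : M) : ℂ := (Function.invFun Φ p).2

lemma mk_tubeBase_tubeCoord {M N : Type*} [Nonempty N] {Φ : N × ℂ → M} {p : M}
    (hp : p ∈ Set.range Φ) : Φ (tubeBase Φ p, tubeCoord Φ p) = p :=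
  Function.invFun_eq hp

open Filter Topology

variable {n : ℕ}
  {M : Type*} [TopologicalSpace M] [ChartedSpace (Model (2 * n + 1)) M]
  {N : Type*} [TopologicalSpace N] [ChartedSpace (Model (2 * n - 1)) N]
  {incl : N → M} {angle : M → Circle} {Φ : N × ℂ → M}

namespace IsTube

lemma isOpen_range (hΦ : IsTube (n := n) incl angle Φ) : IsOpen (Set.range Φ) :=
  hΦ.isLocalDiffeomorph.isOpen_range

lemma continuous (hΦ : IsTube (n := n) incl angle Φ) : Continuous Φ :=
  hΦ.isLocalDiffeomorph.contMDiff.continuous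

lemma contMDiff_incl (hΦ : IsTube (n := n) incl angle Φ) :
    ContMDiff (𝓡 (2 * n - 1)) (𝓡 (2 * n + 1)) ∞ incl := by
  have : incl = fun x ↦ Φ (x, 0) := funext fun x ↦ (hΦ.zero_section x).symm
  rw [this]
  exact hΦ.isLocalDiffeomorph.contMDiff.comp (contMDiff_id.prodMk contMDiff_const)

lemma mfderiv_surjective (hΦ : IsTube (n := n) incl angle Φ) (x : N) (z : ℂ)
    (u : Model (2 * n + 1)) : ∃ (v : Model (2 * n - 1)) (w : ℂ),
    (mfderiv ((𝓡 (2 * n - 1)).prod 𝓘(ℝ, ℂ)) (𝓡 (2 * n + 1)) Φ (x, z) (v, w) :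
      Model (2 * n + 1)) = u := by
  obtain ⟨⟨v, w⟩, h⟩ :=
    ((hΦ.isLocalDiffeomorph (x, z)).mfderivToContinuousLinearEquiv (by simp)).surjective u
  exact ⟨v, w, h⟩

variable [Nonempty N]

lemma base_apply (hΦ : IsTube (n := n) incl angle Φ) (x : N) (z : ℂ) :
    tubeBase Φ (Φ (x, z)) = x := by
  rw [tubeBase, Function.leftInverse_invFun hΦ.injective]

lemma coord_apply (hΦ : IsTube (n := n) incl angle Φ) (x : N) (z : ℂ) :
    tubeCoord Φ (Φ (x, z)) = z := by
  rw [tubeCoord, Function.leftInverse_invFun hΦ.injective]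

lemma mem_range_incl_iff (hΦ : IsTube (n := n) incl angle Φ) {p : M} (hp : p ∈ Set.range Φ) :
    p ∈ Set.range incl ↔ tubeCoord Φ p = 0 := by
  obtain ⟨⟨x, z⟩, rfl⟩ := hp
  rw [hΦ.coord_apply]
  constructor
  · rintro ⟨y, hy⟩
    rw [← hΦ.zero_section] at hy
    exact (congrArg Prod.snd (hΦ.injective hy)).symm
  · rintro rfl
    exact ⟨x, (hΦ.zero_section x).symm⟩

/-- By injectivity the global inverse agrees with the local inverses of the local diffeomorphism. -/
lemma contMDiffAt_invFun (hΦ : IsTube (n := n) incl angle Φ) {p : M} (hp : p ∈ Set.range Φ) :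
    ContMDiffAt (𝓡 (2 * n + 1)) ((𝓡 (2 * n - 1)).prod 𝓘(ℝ, ℂ)) ∞ (Function.invFun Φ) p := by
  obtain ⟨y, rfl⟩ := hp
  have h := hΦ.isLocalDiffeomorph y
  refine h.localInverse_contMDiffAt.congr_of_eventuallyEq ?_
  filter_upwards [h.localInverse_eventuallyEq_right] with q hq
  exact hΦ.injective ((Function.invFun_eq (f := Φ) (b := q) ⟨_, hq⟩).trans hq.symm)

lemma contMDiffAt_base (hΦ : IsTube (n := n) incl angle Φ) {p : M} (hp : p ∈ Set.range Φ) :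
    ContMDiffAt (𝓡 (2 * n + 1)) (𝓡 (2 * n - 1)) ∞ (tubeBase Φ) p :=
  contMDiffAt_fst.comp p (hΦ.contMDiffAt_invFun hp)

lemma contMDiffAt_coord (hΦ : IsTube (n := n) incl angle Φ) {p : M} (hp : p ∈ Set.range Φ) :
    ContMDiffAt (𝓡 (2 * n + 1)) 𝓘(ℝ, ℂ) ∞ (tubeCoord Φ) p :=
  contMDiffAt_snd.comp p (hΦ.contMDiffAt_invFun hp)

lemma mfderiv_base (hΦ : IsTube (n := n) incl angle Φ) (x : N) (z : ℂ) (v : Model (2 * n - 1))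
    (w : ℂ) :
    mfderiv (𝓡 (2 * n + 1)) (𝓡 (2 * n - 1)) (tubeBase Φ) (Φ (x, z))
      (mfderiv ((𝓡 (2 * n - 1)).prod 𝓘(ℝ, ℂ)) (𝓡 (2 * n + 1)) Φ (x, z) (v, w)) = v := by
  have h := mfderiv_comp (x, z) ((hΦ.contMDiffAt_base ⟨(x, z), rfl⟩).mdifferentiableAt (by simp))
    ((hΦ.isLocalDiffeomorph (x, z)).mdifferentiableAt (by simp))
  have e : tubeBase Φ ∘ Φ = Prod.fst := funext fun ⟨x, z⟩ ↦ hΦ.base_apply x z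
  rw [e, mfderiv_fst] at h
  exact (congrArg (fun T : Model (2 * n - 1) × ℂ →L[ℝ] Model (2 * n - 1) ↦ T (v, w)) h).symm

lemma dfun_coord (hΦ : IsTube (n := n) incl angle Φ) (x : N) (z : ℂ) (v : Model (2 * n - 1))
    (w : ℂ) :
    dfun (tubeCoord Φ) (Φ (x, z))
      (mfderiv ((𝓡 (2 * n - 1)).prod 𝓘(ℝ, ℂ)) (𝓡 (2 * n + 1)) Φ (x, z) (v, w)) = w := by
  have h := mfderiv_comp (x, z) ((hΦ.contMDiffAt_coord ⟨(x, z), rfl⟩).mdifferentiableAt (by simp))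
    ((hΦ.isLocalDiffeomorph (x, z)).mdifferentiableAt (by simp))
  have e : tubeCoord Φ ∘ Φ = Prod.snd := funext fun ⟨x, z⟩ ↦ hΦ.coord_apply x z
  rw [e, mfderiv_snd] at h
  exact (congrArg (fun T : Model (2 * n - 1) × ℂ →L[ℝ] ℂ ↦ T (v, w)) h).symm

end IsTube

section Radial

variable [Nonempty N]

lemma fderiv_norm_complex {z : ℂ} (hz : z ≠ 0) (w : ℂ) :
    fderiv ℝ (fun z : ℂ ↦ ‖z‖) z w = polarR z w := by
  have h : HasFDerivAt (fun z : ℂ ↦ √(‖z‖ ^ 2)) _ z :=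
    (hasStrictFDerivAt_norm_sq z).hasFDerivAt.sqrt (by positivity)
  simp only [Real.sqrt_sq (norm_nonneg _)] at h
  rw [h.fderiv]
  have h2 : (innerSL ℝ z) w = (starRingEnd ℂ z * w).re := by
    rw [innerSL_apply_apply, Complex.inner, mul_comm]
  have := norm_ne_zero_iff.2 hz
  rw [FunLike.coe_smul, Pi.smul_apply, FunLike.coe_smul, Pi.smul_apply, h2, polarR, smul_eq_mul,
    nsmul_eq_mul]
  push_cast
  field_simp

/-- A function of the distance to the core of a tubular neighbourhood. -/
def radial (Φ : N × ℂ → M) (f : ℝ → ℝ) (p : M) : ℝ := f ‖tubeCoord Φ p‖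

variable {f : ℝ → ℝ} {p : M}

lemma IsTube.contMDiffAt_norm (hΦ : IsTube (n := n) incl angle Φ) (hp : p ∈ Set.range Φ)
    (h0 : tubeCoord Φ p ≠ 0) :
    ContMDiffAt (𝓡 (2 * n + 1)) 𝓘(ℝ, ℝ) ∞ (fun q ↦ ‖tubeCoord Φ q‖) p :=
  (contDiffAt_norm ℝ h0).contMDiffAt.comp p (hΦ.contMDiffAt_coord hp)

lemma IsTube.contMDiffAt_radial (hΦ : IsTube (n := n) incl angle Φ) (hp : p ∈ Set.range Φ)
    (h0 : tubeCoord Φ p ≠ 0) (hf : ContDiffAt ℝ ∞ f ‖tubeCoord Φ p‖) :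
    ContMDiffAt (𝓡 (2 * n + 1)) 𝓘(ℝ, ℝ) ∞ (radial Φ f) p :=
  hf.contMDiffAt.comp p (hΦ.contMDiffAt_norm hp h0)

lemma IsTube.dfun_radial (hΦ : IsTube (n := n) incl angle Φ) (hp : p ∈ Set.range Φ)
    (h0 : tubeCoord Φ p ≠ 0) (hf : ContDiffAt ℝ ∞ f ‖tubeCoord Φ p‖) :
    dfun (d := 2 * n + 1) (radial Φ f) p =
      deriv f ‖tubeCoord Φ p‖ • dfun (fun q ↦ ‖tubeCoord Φ q‖) p := by
  ext u
  have h := dfun_comp (g := f) (hΦ.contMDiffAt_norm hp h0) hf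
  rw [show radial Φ f = fun q ↦ f ‖tubeCoord Φ q‖ from rfl, h, ContinuousLinearMap.comp_apply,
    fderiv_eq_smul_deriv, smul_eq_mul, mul_comm]
  rfl

lemma IsTube.dfun_norm (hΦ : IsTube (n := n) incl angle Φ) (hp : p ∈ Set.range Φ)
    (h0 : tubeCoord Φ p ≠ 0) (u : Model (2 * n + 1)) :
    dfun (fun q ↦ ‖tubeCoord Φ q‖) p u = polarR (tubeCoord Φ p) (dfun (tubeCoord Φ) p u) := by
  rw [dfun_comp (g := fun z : ℂ ↦ ‖z‖) (hΦ.contMDiffAt_coord hp) (contDiffAt_norm ℝ h0),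
    ContinuousLinearMap.comp_apply, fderiv_norm_complex h0]

lemma IsTube.angle_eventuallyEq (hΦ : IsTube (n := n) incl angle Φ) (hp : p ∈ Set.range Φ)
    (h0 : tubeCoord Φ p ≠ 0) :
    (fun q ↦ (angle q : ℂ)) =ᶠ[𝓝 p] fun q ↦ ‖tubeCoord Φ q‖⁻¹ • tubeCoord Φ q := by
  filter_upwards [hΦ.isOpen_range.mem_nhds hp,
    (hΦ.contMDiffAt_coord hp).continuousAt.eventually_ne h0] with q hq hq0
  nth_rewrite 1 [← mk_tubeBase_tubeCoord hq]
  rw [hΦ.angle_eq _ _ hq0, Complex.real_smul, Complex.ofReal_inv, div_eq_inv_mul]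

/-- Near `p` the page coordinate is `z / |z|`, and rescaling `z` by `1/|z|` divides `Im (conj z dz)`
by `|z|²`. -/
lemma IsTube.cov_angleForm (hΦ : IsTube (n := n) incl angle Φ) (hp : p ∈ Set.range Φ)
    (h0 : tubeCoord Φ p ≠ 0) (u : Model (2 * n + 1)) :
    cov (angleForm angle) p u = polarTheta (tubeCoord Φ p) (dfun (tubeCoord Φ) p u) := by
  have e := hΦ.angle_eventuallyEq hp h0
  have h1 := hΦ.contMDiffAt_radial (f := fun r ↦ r⁻¹) hp h0
    (contDiffAt_inv ℝ (norm_ne_zero_iff.2 h0))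
  have h := cov_angular_smul h1 (hΦ.contMDiffAt_coord hp)
  have h2 : cov (angleForm angle) p u = cov (angular fun q ↦ radial Φ (fun r ↦ r⁻¹) q •
      tubeCoord Φ q) p u := by
    have e0 : (angle p : ℂ) = ‖tubeCoord Φ p‖⁻¹ • tubeCoord Φ p := e.self_of_nhds
    rw [angleForm_eq_angular, cov_angular, cov_angular, dfun_congr e]
    exact congrArg (fun z : ℂ ↦ (starRingEnd ℂ z * dfun (fun q ↦ ‖tubeCoord Φ q‖⁻¹ •
      tubeCoord Φ q) p u).im) e0
  rw [h2, h, FunLike.coe_smul, Pi.smul_apply, cov_angular, polarTheta, radial, smul_eq_mul]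
  field_simp

end Radial

end Tubes

/-! ### The segment towards a closed form. -/

section Closed

open Filter Topology

variable {d : ℕ} {M : Type*} [TopologicalSpace M] [ChartedSpace (Model d) M]
  [IsManifold (𝓡 d) ∞ M]

/-- With `dη = 0` the derivative of the segment is `s dβ`, so only the leading factor still sees
`η`. Closedness is needed at `p` alone. -/
lemma wedgeD_segment_of_closed {β η : OneForm d M} {p : M} (hβ : SmoothFormAt β p)
    (hη : SmoothFormAt η p) (h0 : ∀ u, dForm η p u = 0) (s t : ℝ) (n : ℕ)
    (v : Fin (2 * n + 1) → TangentSpace (𝓡 d) p) :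
    wedgeD (fun q ↦ s • β q + t • η q) (fun q ↦ s • β q + t • η q) n p v =
      s ^ n * (s * wedgeD β β n p v + t * wedgeD η β n p v) := by
  rw [wedgeD, show (fun u ↦ dForm (fun q ↦ s • β q + t • η q) p u) = fun u ↦ s * dForm β p u from
    funext fun u ↦ (dForm_segment hβ hη s t u).trans (by rw [h0, mul_zero, add_zero])]
  exact wedgePow_linear (cov β p) (cov η p) (fun u ↦ dForm β p u) n s t v

omit [IsManifold (𝓡 d) ∞ M] in
lemma smoothFormAt_segment {β η : OneForm d M} {p : M} (hβ : SmoothFormAt β p)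
    (hη : SmoothFormAt η p) (s t : ℝ) : SmoothFormAt (fun q ↦ s • β q + t • η q) p :=
  (hβ.fmul (f := fun _ ↦ s) contMDiffAt_const).add (hη.fmul (f := fun _ ↦ t) contMDiffAt_const)

end Closed

/-! ### The angular form of an open book. -/

section OpenBooks

open Filter Topology

variable {n : ℕ}
  {M : Type*} [TopologicalSpace M] [ChartedSpace (Model (2 * n + 1)) M]
  {N : Type*} [TopologicalSpace N] [ChartedSpace (Model (2 * n - 1)) N]

lemma OpenBook.isClosed_binding [T2Space M] [CompactSpace N] (O : OpenBook n M N) :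
    IsClosed (Set.range O.incl) := by
  obtain ⟨Φ, hΦ⟩ := O.exists_tube
  exact (isCompact_range hΦ.contMDiff_incl.continuous).isClosed

lemma OpenBook.contMDiffAt_angle [T2Space M] [CompactSpace N] (O : OpenBook n M N) {p : M}
    (hp : p ∉ Set.range O.incl) :
    ContMDiffAt (𝓡 (2 * n + 1)) 𝓘(ℝ, ℂ) ∞ (fun p ↦ (O.angle p : ℂ)) p :=
  O.smooth_angle.contMDiffAt (O.isClosed_binding.isOpen_compl.mem_nhds hp)

variable [IsManifold (𝓡 (2 * n + 1)) ∞ M]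

lemma OpenBook.smoothFormAt_angleForm [T2Space M] [CompactSpace N] (O : OpenBook n M N) {p : M}
    (hp : p ∉ Set.range O.incl) : SmoothFormAt (angleForm O.angle : OneForm (2 * n + 1) M) p :=
  smoothFormAt_angular (O.contMDiffAt_angle hp)

lemma OpenBook.dForm_angleForm [T2Space M] [CompactSpace N] (O : OpenBook n M N) {p : M}
    (hp : p ∉ Set.range O.incl) (u : Fin 2 → Model (2 * n + 1)) :
    dForm (angleForm O.angle : OneForm (2 * n + 1) M) p u = 0 :=
  dForm_angular_of_norm_eq_one (O.contMDiffAt_angle hp)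
    (Eventually.of_forall fun _ ↦ Circle.norm_coe _) u

end OpenBooks

/-! ### The spinnable form in the tube. -/

section Spin

open Filter Topology

variable {n : ℕ}
  {M : Type*} [TopologicalSpace M] [ChartedSpace (Model (2 * n + 1)) M]
  {N : Type*} [TopologicalSpace N] [ChartedSpace (Model (2 * n - 1)) N]
  {incl : N → M} {angle : M → Circle} {Φ : N × ℂ → M} [Nonempty N] {p : M}

/-- The differential of the projection of a tubular neighbourhood to the binding, on the model
spaces. -/
def dbase (Φ : N × ℂ → M) (p : M) : Model (2 * n + 1) →L[ℝ] Model (2 * n - 1) :=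
  mfderiv (𝓡 (2 * n + 1)) (𝓡 (2 * n - 1)) (tubeBase Φ) p

lemma cov_pullback_base (γ : OneForm (2 * n - 1) N) (Φ : N × ℂ → M) (p : M)
    (u : Model (2 * n + 1)) :
    cov (pullback (tubeBase Φ) γ : OneForm (2 * n + 1) M) p u =
      cov γ (tubeBase Φ p) (dbase Φ p u) := rfl

/-- A form which is known on the product vectors of a tubular neighbourhood. -/
lemma IsTube.cov_eq (hΦ : IsTube (n := n) incl angle Φ) {β : OneForm (2 * n + 1) M}
    {μ : OneForm (2 * n - 1) N} {h : ℂ → ℂ → ℝ} {F : ℂ → ℝ} {s : Set ℂ}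
    (hβ : ∀ (x : N), ∀ z ∈ s, ∀ (v : TangentSpace (𝓡 (2 * n - 1)) x) (w : ℂ),
      β (Φ (x, z)) (mfderiv ((𝓡 (2 * n - 1)).prod 𝓘(ℝ, ℂ)) (𝓡 (2 * n + 1)) Φ (x, z) (v, w)) =
        F z * μ x v + h z w) (hp : p ∈ Set.range Φ) (hs : tubeCoord Φ p ∈ s)
    (u : Model (2 * n + 1)) :
    cov β p u = F (tubeCoord Φ p) * cov μ (tubeBase Φ p) (dbase Φ p u) +
      h (tubeCoord Φ p) (dfun (tubeCoord Φ) p u) := by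
  obtain ⟨⟨x, z⟩, rfl⟩ := hp
  obtain ⟨v, w, rfl⟩ := hΦ.mfderiv_surjective x z u
  have h1 := hΦ.mfderiv_base x z v w
  have h2 := hΦ.dfun_coord x z v w
  rw [hΦ.coord_apply] at hs ⊢
  rw [h2]
  have h3 : dbase Φ (Φ (x, z)) (mfderiv ((𝓡 (2 * n - 1)).prod 𝓘(ℝ, ℂ)) (𝓡 (2 * n + 1)) Φ (x, z)
      (v, w)) = v := h1
  rw [h3, hΦ.base_apply]
  exact hβ x z hs v w

/-- The form `a(r) ν + b(r) dθ + d(C(r))` on a tubular neighbourhood, extended by `dθ`. -/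
def spinForm (Φ : N × ℂ → M) (angle : M → Circle) (ν : OneForm (2 * n - 1) N) (a b C : ℝ → ℝ) :
    OneForm (2 * n + 1) M := fun p ↦
  open Classical in
  if p ∈ Set.range Φ then radial Φ a p • (pullback (tubeBase Φ) ν : OneForm (2 * n + 1) M) p +
    radial Φ b p • angleForm angle p + diff (radial Φ C) p
  else angleForm angle p

variable {ν : OneForm (2 * n - 1) N} {a b C : ℝ → ℝ}

lemma spinForm_of_mem (hp : p ∈ Set.range Φ) :
    spinForm Φ angle ν a b C p =
      radial Φ a p • (pullback (tubeBase Φ) ν : OneForm (2 * n + 1) M) p +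
        radial Φ b p • angleForm angle p + diff (radial Φ C) p := if_pos hp

lemma spinForm_of_notMem (hp : p ∉ Set.range Φ) :
    spinForm Φ angle ν a b C p = angleForm angle p := if_neg hp

/-- For `r < 1/4` one has `a = 1`, `b = 0`, `C = 0`, so no polar term remains and the form extends
smoothly across `r = 0`. -/
lemma spinForm_eventuallyEq_core (hΦ : IsTube (n := n) incl angle Φ) (h : IsSpinProfile a b C)
    (hp : p ∈ Set.range Φ) (hr : ‖tubeCoord Φ p‖ < 1 / 4) :
    ∀ᶠ q in 𝓝 p, spinForm Φ angle ν a b C q =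
      (pullback (tubeBase Φ) ν : OneForm (2 * n + 1) M) q := by
  have h1 : ∀ᶠ q in 𝓝 p, q ∈ Set.range Φ ∧ ‖tubeCoord Φ q‖ < 1 / 4 :=
    (hΦ.isOpen_range.eventually_mem hp).and
      ((hΦ.contMDiffAt_coord hp).continuousAt.norm.eventually_lt_const hr)
  filter_upwards [h1.eventually_nhds] with q hq
  obtain ⟨hq1, hq2⟩ := hq.self_of_nhds
  have hC : cov (diff (radial Φ C)) q = (0 : Model (2 * n + 1) →L[ℝ] ℝ) := by
    rw [cov_diff, dfun_congr (g := fun _ ↦ (0 : ℝ)), dfun_const]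
    filter_upwards [hq] with q hq using h.C_zero _ hq.2.le
  have hC' : (diff (radial Φ C) : OneForm (2 * n + 1) M) q = 0 := hC
  rw [spinForm_of_mem hq1, hC', radial, radial, h.a_one _ hq2.le, h.b_zero _ (by linarith)]
  simp

/-- For `r > 3/4` the profiles are `a = 0`, `b = 1`, `C = 0`. The closed tube of radius `3/4` is
compact, hence closed in `M`, so the two branches of the definition glue on an open set. -/
lemma spinForm_eventuallyEq_outer [CompactSpace N] [T2Space M]
    (hΦ : IsTube (n := n) incl angle Φ) (h : IsSpinProfile a b C)
    (hp : ∀ x z, ‖z‖ ≤ 3 / 4 → Φ (x, z) ≠ p) :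
    ∀ᶠ q in 𝓝 p, spinForm Φ angle ν a b C q = angleForm angle q := by
  have hK : IsClosed (Φ '' (Set.univ ×ˢ Metric.closedBall 0 (3 / 4))) :=
    ((isCompact_univ.prod (isCompact_closedBall _ _)).image hΦ.continuous).isClosed
  have h1 : ∀ᶠ q in 𝓝 p, ∀ x z, Φ (x, z) = q → 3 / 4 < ‖z‖ := by
    filter_upwards [hK.isOpen_compl.mem_nhds (x := p) (by
      rintro ⟨⟨x, z⟩, hz, e⟩
      exact hp x z (by simpa using hz) e)] with q hq x z e
    by_contra! hz
    exact hq ⟨(x, z), by simpa using hz, e⟩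
  filter_upwards [h1.eventually_nhds] with q hq
  by_cases hq1 : q ∈ Set.range Φ
  · have hq2 := hq.self_of_nhds _ _ (mk_tubeBase_tubeCoord hq1)
    have hC : cov (diff (radial Φ C)) q = (0 : Model (2 * n + 1) →L[ℝ] ℝ) := by
      rw [cov_diff, dfun_congr (g := fun _ ↦ (0 : ℝ)), dfun_const]
      filter_upwards [hq, hΦ.isOpen_range.eventually_mem hq1] with q hq hq1
      exact h.C_zero' _ (hq _ _ (mk_tubeBase_tubeCoord hq1)).le
    have hC' : (diff (radial Φ C) : OneForm (2 * n + 1) M) q = 0 := hC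
    rw [spinForm_of_mem hq1, hC', radial, radial, h.a_zero _ (by linarith), h.b_one _ hq2.le]
    simp
  · exact spinForm_of_notMem hq1

/-- The spinnable form in terms of polar coordinates, where the radius does not vanish. -/
lemma cov_spinForm (hΦ : IsTube (n := n) incl angle Φ) (h : IsSpinProfile a b C)
    (hp : p ∈ Set.range Φ) (h0 : tubeCoord Φ p ≠ 0) (u : Model (2 * n + 1)) :
    cov (spinForm Φ angle ν a b C) p u =
      a ‖tubeCoord Φ p‖ * cov ν (tubeBase Φ p) (dbase Φ p u) +
        b ‖tubeCoord Φ p‖ * cov (angleForm angle) p u +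
          deriv C ‖tubeCoord Φ p‖ * dfun (fun q ↦ ‖tubeCoord Φ q‖) p u := by
  have e : cov (spinForm Φ angle ν a b C) p =
      radial Φ a p • cov (pullback (tubeBase Φ) ν : OneForm (2 * n + 1) M) p +
        radial Φ b p • cov (angleForm angle) p + cov (diff (radial Φ C)) p := spinForm_of_mem hp
  rw [e, cov_diff, hΦ.dfun_radial hp h0 h.contDiff_C.contDiffAt]
  rfl

lemma cov_spinForm_core (hΦ : IsTube (n := n) incl angle Φ) (h : IsSpinProfile a b C)
    (hp : p ∈ Set.range Φ) (hr : ‖tubeCoord Φ p‖ < 1 / 4) (u : Model (2 * n + 1)) :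
    cov (spinForm Φ angle ν a b C) p u = cov ν (tubeBase Φ p) (dbase Φ p u) := by
  rw [show cov (spinForm Φ angle ν a b C) p = _ from
    (spinForm_eventuallyEq_core hΦ h hp hr).self_of_nhds]
  rfl

lemma spinForm_mfderiv (hΦ : IsTube (n := n) incl angle Φ) (h : IsSpinProfile a b C)
    (x : N) (z : ℂ) (v : TangentSpace (𝓡 (2 * n - 1)) x) (w : ℂ) :
    spinForm Φ angle ν a b C (Φ (x, z))
      (mfderiv ((𝓡 (2 * n - 1)).prod 𝓘(ℝ, ℂ)) (𝓡 (2 * n + 1)) Φ (x, z) (v, w)) =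
        a ‖z‖ * ν x v + b ‖z‖ * polarTheta z w + deriv C ‖z‖ * polarR z w := by
  obtain ⟨u, hu⟩ : ∃ u : Model (2 * n + 1), u = mfderiv ((𝓡 (2 * n - 1)).prod 𝓘(ℝ, ℂ))
    (𝓡 (2 * n + 1)) Φ (x, z) (v, w) := ⟨_, rfl⟩
  have h1 : dbase Φ (Φ (x, z)) u = v := hu ▸ hΦ.mfderiv_base x z v w
  have h2 : dfun (tubeCoord Φ) (Φ (x, z)) u = w := hu ▸ hΦ.dfun_coord x z v w
  have hc := hΦ.coord_apply x z
  have hp : Φ (x, z) ∈ Set.range Φ := ⟨_, rfl⟩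
  have key : cov (spinForm Φ angle ν a b C) (Φ (x, z)) u =
      a ‖z‖ * cov ν x v + b ‖z‖ * polarTheta z w + deriv C ‖z‖ * polarR z w := by
    -- On the core the two polar terms contribute zero, and the formula reduces to `ν`.
    by_cases h0 : z = 0
    · rw [cov_spinForm_core hΦ h hp (by rw [hc, h0]; norm_num), h1, hΦ.base_apply, h0, norm_zero,
        h.a_one 0 (by norm_num), h.b_zero 0 (by norm_num), polarR]
      simp
    · have hc0 : tubeCoord Φ (Φ (x, z)) ≠ 0 := by rwa [hc]
      rw [cov_spinForm hΦ h hp hc0, h1, hΦ.base_apply, hΦ.cov_angleForm hp hc0,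
        hΦ.dfun_norm hp hc0, h2, hc]
  rw [hu] at key
  exact key

end Spin

/-! ### Smoothness, integrability and nonvanishing of the spinnable form. -/

section Spin

open Filter Topology

variable {n : ℕ}
  {M : Type*} [TopologicalSpace M] [ChartedSpace (Model (2 * n + 1)) M]
  [IsManifold (𝓡 (2 * n + 1)) ∞ M] [T2Space M]
  {N : Type*} [TopologicalSpace N] [ChartedSpace (Model (2 * n - 1)) N]
  [IsManifold (𝓡 (2 * n - 1)) ∞ N] [CompactSpace N] [Nonempty N]
  {O : OpenBook n M N} {Φ : N × ℂ → M} {p : M}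

omit [IsManifold (𝓡 2 * n + 1) ∞ M] [T2Space M] [IsManifold (𝓡 2 * n - 1) ∞ N] [CompactSpace N] in
lemma IsTube.notMem_binding (hΦ : IsTube (n := n) O.incl O.angle Φ)
    (hp : p ∈ Set.range Φ → tubeCoord Φ p ≠ 0) : p ∉ Set.range O.incl := by
  intro h
  have hr : p ∈ Set.range Φ := by
    obtain ⟨x, rfl⟩ := h
    exact ⟨(x, 0), hΦ.zero_section x⟩
  exact hp hr ((hΦ.mem_range_incl_iff hr).1 h)

variable {μ ν : OneForm (2 * n - 1) N} {f g : ℝ → ℝ}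

lemma smoothFormAt_radial_sum (hΦ : IsTube (n := n) O.incl O.angle Φ) (hp : p ∈ Set.range Φ)
    (h0 : tubeCoord Φ p ≠ 0) (hμ : SmoothFormAt μ (tubeBase Φ p))
    (hf : ContDiffAt ℝ ∞ f ‖tubeCoord Φ p‖) (hg : ContDiffAt ℝ ∞ g ‖tubeCoord Φ p‖) :
    SmoothFormAt (fun q ↦ fmul (radial Φ f) (pullback (tubeBase Φ) μ : OneForm (2 * n + 1) M) q +
      fmul (radial Φ g) (angleForm O.angle) q) p :=
  ((hμ.pullback (hΦ.contMDiffAt_base hp)).fmul (hΦ.contMDiffAt_radial hp h0 hf)).add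
    ((O.smoothFormAt_angleForm (hΦ.notMem_binding fun _ ↦ h0)).fmul
      (hΦ.contMDiffAt_radial hp h0 hg))

lemma dForm_radial_sum (hΦ : IsTube (n := n) O.incl O.angle Φ) (hp : p ∈ Set.range Φ)
    (h0 : tubeCoord Φ p ≠ 0) (hμ : SmoothFormAt μ (tubeBase Φ p))
    (hf : ContDiffAt ℝ ∞ f ‖tubeCoord Φ p‖) (hg : ContDiffAt ℝ ∞ g ‖tubeCoord Φ p‖)
    (u : Fin 2 → Model (2 * n + 1)) :
    dForm (fun q ↦ fmul (radial Φ f) (pullback (tubeBase Φ) μ : OneForm (2 * n + 1) M) q +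
      fmul (radial Φ g) (angleForm O.angle) q) p u =
      f ‖tubeCoord Φ p‖ * dForm μ (tubeBase Φ p) (fun i ↦ dbase Φ p (u i)) +
        (dfun (fun q ↦ ‖tubeCoord Φ q‖) p (u 0) *
            (deriv f ‖tubeCoord Φ p‖ * cov μ (tubeBase Φ p) (dbase Φ p (u 1)) +
              deriv g ‖tubeCoord Φ p‖ * cov (angleForm O.angle) p (u 1)) -
          dfun (fun q ↦ ‖tubeCoord Φ q‖) p (u 1) *
            (deriv f ‖tubeCoord Φ p‖ * cov μ (tubeBase Φ p) (dbase Φ p (u 0)) +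
              deriv g ‖tubeCoord Φ p‖ * cov (angleForm O.angle) p (u 0))) := by
  have hb := hΦ.notMem_binding fun _ ↦ h0
  have s1 := hμ.pullback (hΦ.contMDiffAt_base hp)
  have s2 := O.smoothFormAt_angleForm hb
  have r1 := hΦ.contMDiffAt_radial hp h0 hf
  have r2 := hΦ.contMDiffAt_radial hp h0 hg
  have e : dForm (pullback (tubeBase Φ) μ : OneForm (2 * n + 1) M) p u =
    dForm μ (tubeBase Φ p) (fun i ↦ dbase Φ p (u i)) := dForm_pullback hμ (hΦ.contMDiffAt_base hp) u
  rw [dForm_add (s1.fmul r1) (s2.fmul r2), dForm_fmul s1 r1, dForm_fmul s2 r2, e, O.dForm_angleForm hb, cov_diff, cov_diff,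
    hΦ.dfun_radial hp h0 hf, hΦ.dfun_radial hp h0 hg]
  simp only [cov_pullback_base, FunLike.coe_smul, Pi.smul_apply, smul_eq_mul]
  simp only [radial]
  ring

variable {a b C : ℝ → ℝ}

omit [IsManifold (𝓡 2 * n + 1) ∞ M] [T2Space M] [IsManifold (𝓡 2 * n - 1) ∞ N] [CompactSpace N] in
lemma spinForm_eventuallyEq_radial (hΦ : IsTube (n := n) O.incl O.angle Φ)
    (hp : p ∈ Set.range Φ) : ∀ᶠ q in 𝓝 p, spinForm Φ O.angle ν a b C q =
      (fmul (radial Φ a) (pullback (tubeBase Φ) ν : OneForm (2 * n + 1) M) q +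
      fmul (radial Φ b) (angleForm O.angle) q) + diff (radial Φ C) q := by
  filter_upwards [hΦ.isOpen_range.mem_nhds hp] with q hq using spinForm_of_mem hq

lemma smoothFormAt_spinForm_of_ne (hΦ : IsTube (n := n) O.incl O.angle Φ)
    (h : IsSpinProfile a b C) (hp : p ∈ Set.range Φ) (h0 : tubeCoord Φ p ≠ 0)
    (hν : SmoothFormAt ν (tubeBase Φ p)) : SmoothFormAt (spinForm Φ O.angle ν a b C) p :=
  ((smoothFormAt_radial_sum hΦ hp h0 hν h.contDiff_a.contDiffAt h.contDiff_b.contDiffAt).add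
    (smoothFormAt_diff (hΦ.contMDiffAt_radial hp h0 h.contDiff_C.contDiffAt))).congr
      (spinForm_eventuallyEq_radial hΦ hp)

lemma dForm_spinForm_of_ne (hΦ : IsTube (n := n) O.incl O.angle Φ)
    (h : IsSpinProfile a b C) (hp : p ∈ Set.range Φ) (h0 : tubeCoord Φ p ≠ 0)
    (hν : SmoothFormAt ν (tubeBase Φ p)) (hνc : dForm ν (tubeBase Φ p) = 0)
    (u : Fin 2 → Model (2 * n + 1)) :
    dForm (spinForm Φ O.angle ν a b C) p u =
      dfun (fun q ↦ ‖tubeCoord Φ q‖) p (u 0) *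
          (deriv a ‖tubeCoord Φ p‖ * cov ν (tubeBase Φ p) (dbase Φ p (u 1)) +
            deriv b ‖tubeCoord Φ p‖ * cov (angleForm O.angle) p (u 1)) -
        dfun (fun q ↦ ‖tubeCoord Φ q‖) p (u 1) *
          (deriv a ‖tubeCoord Φ p‖ * cov ν (tubeBase Φ p) (dbase Φ p (u 0)) +
            deriv b ‖tubeCoord Φ p‖ * cov (angleForm O.angle) p (u 0)) := by
  have hC := hΦ.contMDiffAt_radial hp h0 h.contDiff_C.contDiffAt
  have hνc' : dForm ν (tubeBase Φ p) (fun i ↦ dbase Φ p (u i)) = 0 := by rw [hνc]; rfl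
  rw [dForm_congr (spinForm_eventuallyEq_radial hΦ hp),
    dForm_add (smoothFormAt_radial_sum hΦ hp h0 hν h.contDiff_a.contDiffAt
      h.contDiff_b.contDiffAt) (smoothFormAt_diff hC), dForm_diff hC,
    dForm_radial_sum hΦ hp h0 hν h.contDiff_a.contDiffAt h.contDiff_b.contDiffAt, hνc',
    mul_zero, zero_add, add_zero]

lemma smoothFormAt_spinForm (hΦ : IsTube (n := n) O.incl O.angle Φ) (h : IsSpinProfile a b C)
    (hν : ∀ x, SmoothFormAt ν x) (p : M) : SmoothFormAt (spinForm Φ O.angle ν a b C) p := by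
  by_cases hp : p ∈ Set.range Φ
  · rcases lt_or_ge ‖tubeCoord Φ p‖ (1 / 4) with hr | hr
    · exact ((hν _).pullback (hΦ.contMDiffAt_base hp)).congr
        (spinForm_eventuallyEq_core hΦ h hp hr)
    · exact smoothFormAt_spinForm_of_ne hΦ h hp (norm_pos_iff.1 (by linarith)) (hν _)
  · exact (O.smoothFormAt_angleForm (hΦ.notMem_binding fun h ↦ absurd h hp)).congr
      (spinForm_eventuallyEq_outer hΦ h fun x z _ e ↦ hp ⟨_, e⟩)

omit [T2Space M] [CompactSpace N] in
lemma dForm_spinForm_core (hΦ : IsTube (n := n) O.incl O.angle Φ) (h : IsSpinProfile a b C)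
    (hν : ∀ x, SmoothFormAt ν x) (hνc : ∀ x, dForm ν x = 0)
    (hp : p ∈ Set.range Φ) (hr : ‖tubeCoord Φ p‖ < 1 / 4) (u : Fin 2 → Model (2 * n + 1)) :
    dForm (spinForm Φ O.angle ν a b C) p u = 0 := by
  rw [dForm_congr (spinForm_eventuallyEq_core hΦ h hp hr),
    dForm_pullback (hν _) (hΦ.contMDiffAt_base hp), hνc]
  rfl

omit [IsManifold (𝓡 2 * n - 1) ∞ N] in
lemma dForm_spinForm_outer (hΦ : IsTube (n := n) O.incl O.angle Φ) (h : IsSpinProfile a b C)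
    (hp : ∀ x z, ‖z‖ ≤ 3 / 4 → Φ (x, z) ≠ p) (u : Fin 2 → Model (2 * n + 1)) :
    dForm (spinForm Φ O.angle ν a b C) p u = 0 := by
  rw [dForm_congr (spinForm_eventuallyEq_outer hΦ h hp), O.dForm_angleForm]
  rintro ⟨x, rfl⟩
  exact hp x 0 (by norm_num) (hΦ.zero_section x)

lemma wedgeD_spinForm (hΦ : IsTube (n := n) O.incl O.angle Φ) (h : IsSpinProfile a b C)
    (hν : ∀ x, SmoothFormAt ν x) (hνc : ∀ x, dForm ν x = 0) (p : M)
    (v : Fin (2 * 1 + 1) → TangentSpace (𝓡 (2 * n + 1)) p) :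
    wedgeD (spinForm Φ O.angle ν a b C) (spinForm Φ O.angle ν a b C) 1 p v = 0 := by
  by_cases hp : p ∈ Set.range Φ
  · rcases lt_or_ge ‖tubeCoord Φ p‖ (1 / 4) with hr | hr
    · exact wedgePow_zero _ (dForm_spinForm_core hΦ h hν hνc hp hr) one_ne_zero v
    · have h0 : tubeCoord Φ p ≠ 0 := norm_pos_iff.1 (by linarith)
      exact wedgePow_integrable ((cov ν (tubeBase Φ p)).comp (dbase Φ p))
        (cov (angleForm O.angle) p) (dfun (fun q ↦ ‖tubeCoord Φ q‖) p) _ _ _ _ _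
        (h.a_mul_deriv_b ‖tubeCoord Φ p‖) (h.b_mul_deriv_a ‖tubeCoord Φ p‖)
        (cov_spinForm hΦ h hp h0) (dForm_spinForm_of_ne hΦ h hp h0 (hν _) (hνc _)) v
  · exact wedgePow_zero _ (dForm_spinForm_outer hΦ h fun x z _ e ↦ hp ⟨_, e⟩) one_ne_zero v

omit [IsManifold (𝓡 2 * n + 1) ∞ M] [T2Space M] [IsManifold (𝓡 2 * n - 1) ∞ N] [CompactSpace N] in
lemma spinForm_ne_zero (hΦ : IsTube (n := n) O.incl O.angle Φ) (h : IsSpinProfile a b C)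
    (hν : ∀ x, ν x ≠ 0) (p : M) : spinForm Φ O.angle ν a b C p ≠ 0 := by
  by_cases hp : p ∈ Set.range Φ
  · obtain ⟨⟨x, z⟩, rfl⟩ := hp
    intro h0
    have key : ∀ (v : Model (2 * n - 1)) (w : ℂ),
        a ‖z‖ * cov ν x v + b ‖z‖ * polarTheta z w + deriv C ‖z‖ * polarR z w = 0 := fun v w ↦ by
      refine (spinForm_mfderiv (ν := ν) hΦ h x z v w).symm.trans ?_
      rw [h0]
      rfl
    -- Test vectors: tangent to the binding for `r < 1/2`, where `a > 0`; radial `z` at `r = 1/2`,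
    -- where `C' = 1`; rotational `i z` for `r > 1/2`, where `b > 0`.
    have hz : 1 / 2 ≤ ‖z‖ → (z.re ^ 2 + z.im ^ 2) / ‖z‖ ^ 2 = 1 := fun hr ↦ by
      rw [Complex.sq_norm, Complex.normSq_apply, ← sq, ← sq, div_self]
      have := Complex.sq_norm z
      rw [Complex.normSq_apply] at this
      nlinarith
    rcases lt_trichotomy ‖z‖ (1 / 2) with hr | hr | hr
    · refine hν x (ContinuousLinearMap.ext fun v ↦ ?_)
      have := key v 0
      simp only [polarTheta, polarR, mul_zero, Complex.zero_im, Complex.zero_re, zero_div,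
        add_zero] at this
      exact (mul_eq_zero.1 this).resolve_left (h.a_pos _ hr).ne'
    · have := key 0 z
      have h1 := hz hr.ge
      rw [h.a_zero _ hr.ge, h.b_zero _ hr.le, hr, h.deriv_C, polarR, Complex.mul_re,
        Complex.conj_re, Complex.conj_im] at this
      rw [hr] at h1 this
      norm_num at h1 this
      nlinarith
    · have := key 0 (Complex.I * z)
      have h1 := hz hr.le
      rw [map_zero, polarTheta, polarR] at this
      simp only [Complex.mul_re, Complex.mul_im, Complex.I_re, Complex.I_im, Complex.conj_re,
        Complex.conj_im] at this
      have e1 : z.re * (0 * z.im + 1 * z.re) + -z.im * (0 * z.re - 1 * z.im) =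
        z.re ^ 2 + z.im ^ 2 := by ring
      have e2 : z.re * (0 * z.re - 1 * z.im) - -z.im * (0 * z.im + 1 * z.re) = 0 := by ring
      rw [e1, e2, h1] at this
      have := h.b_pos _ hr
      simp at *
      linarith
  · rw [spinForm_of_notMem hp]
    exact O.submersion p (hΦ.notMem_binding fun h ↦ absurd h hp)

end Spin

/-! ### Positivity along the segment. -/

section Positivity

open Filter Topology

variable {n : ℕ}
  {M : Type*} [TopologicalSpace M] [ChartedSpace (Model (2 * n + 1)) M]
  [IsManifold (𝓡 (2 * n + 1)) ∞ M] [T2Space M]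
  {N : Type*} [TopologicalSpace N] [ChartedSpace (Model (2 * n - 1)) N]
  [IsManifold (𝓡 (2 * n - 1)) ∞ N] [CompactSpace N] [Nonempty N]
  {O : OpenBook n M N} {Φ : N × ℂ → M} {p : M}
  {μ ν : OneForm (2 * n - 1) N} {f g a b C : ℝ → ℝ} {β : OneForm (2 * n + 1) M}

/-- Positivity of the segment from an axisymmetric form to a spinnable form, off the binding. -/
lemma wedgeD_segment_pos_of_ne (hn : 1 < n) (hΦ : IsTube (n := n) O.incl O.angle Φ)
    (h : IsSpinProfile a b C) (hp : p ∈ Set.range Φ) (h0 : tubeCoord Φ p ≠ 0)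
    (hμ : SmoothFormAt μ (tubeBase Φ p)) (hν : SmoothFormAt ν (tubeBase Φ p))
    (hνc : dForm ν (tubeBase Φ p) = 0) (hνμ : ∀ v, wedgeD ν μ (n - 1) (tubeBase Φ p) v = 0)
    (hf : ContDiffAt ℝ ∞ f ‖tubeCoord Φ p‖) (hg : ContDiffAt ℝ ∞ g ‖tubeCoord Φ p‖)
    (hf0 : 0 < f ‖tubeCoord Φ p‖) (hf' : deriv f ‖tubeCoord Φ p‖ < 0)
    (hβ : ∀ᶠ q in 𝓝 p, β q =
      fmul (radial Φ f) (pullback (tubeBase Φ) μ : OneForm (2 * n + 1) M) q +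
        fmul (radial Φ g) (angleForm O.angle) q)
    {t : ℝ} (ht : t ∈ Set.Ico (0 : ℝ) 1) {v : Fin (2 * n + 1) → TangentSpace (𝓡 (2 * n + 1)) p}
    (W0 : 0 < wedgeD β β n p v) (Wθ : 0 < wedgeD (angleForm O.angle) β n p v) :
    0 < wedgeD (fun q ↦ (1 - t) • β q + t • spinForm Φ O.angle ν a b C q)
      (fun q ↦ (1 - t) • β q + t • spinForm Φ O.angle ν a b C q) n p v := by
  obtain ⟨D, hD⟩ : ∃ D : Model (2 * n - 1) [⋀^Fin 2]→L[ℝ] ℝ, D = dForm μ (tubeBase Φ p) :=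
    ⟨_, rfl⟩
  obtain ⟨T, hT⟩ := exists_wedgePow_product (k := n - 1) (m := 2 * n - 1) (n := n) (by omega)
    (by omega) (dbase Φ p) D (cov μ (tubeBase Φ p)) (cov ν (tubeBase Φ p))
    (hD ▸ hνμ) (dfun (fun q ↦ ‖tubeCoord Φ q‖) p) (cov (angleForm O.angle) p)
  set r := ‖tubeCoord Φ p‖ with hr
  have hβs : SmoothFormAt β p := (smoothFormAt_radial_sum hΦ hp h0 hμ hf hg).congr hβ
  have hβc : ∀ u, cov β p u = f r * cov μ (tubeBase Φ p) (dbase Φ p u) +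
      g r * cov (angleForm O.angle) p u := fun u ↦ by
    rw [show cov β p = _ from hβ.self_of_nhds]
    rfl
  have hβd : ∀ u : Fin 2 → Model (2 * n + 1), dForm β p u = f r * D (fun i ↦ dbase Φ p (u i)) +
      (dfun (fun q ↦ ‖tubeCoord Φ q‖) p (u 0) *
          (deriv f r * cov μ (tubeBase Φ p) (dbase Φ p (u 1)) +
            deriv g r * cov (angleForm O.angle) p (u 1)) -
        dfun (fun q ↦ ‖tubeCoord Φ q‖) p (u 1) *
          (deriv f r * cov μ (tubeBase Φ p) (dbase Φ p (u 0)) +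
            deriv g r * cov (angleForm O.angle) p (u 0))) := fun u ↦ by
    rw [dForm_congr hβ, hD]
    exact dForm_radial_sum hΦ hp h0 hμ hf hg u
  have e0 : wedgeD β β n p v = _ := hT (f r) (f r) 0 (g r) 0 (deriv f r) 0 (deriv g r)
    (cov β p) (fun u ↦ dForm β p u) (fun u ↦ by rw [hβc]; ring)
    (fun u ↦ by rw [hβd]; ring) v
  have eθ : wedgeD (angleForm O.angle) β n p v = _ := hT (f r) 0 0 1 0 (deriv f r) 0 (deriv g r)
    (cov (angleForm O.angle) p) (fun u ↦ dForm β p u) (fun u ↦ by ring)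
    (fun u ↦ by rw [hβd]; ring) v
  have et : wedgeD (fun q ↦ (1 - t) • β q + t • spinForm Φ O.angle ν a b C q)
      (fun q ↦ (1 - t) • β q + t • spinForm Φ O.angle ν a b C q) n p v = _ :=
    hT ((1 - t) * f r) ((1 - t) * f r) (t * a r) ((1 - t) * g r + t * b r) (t * deriv C r)
      ((1 - t) * deriv f r) (t * deriv a r) ((1 - t) * deriv g r + t * deriv b r)
      (fun u ↦ (1 - t) * cov β p u + t * cov (spinForm Φ O.angle ν a b C) p u)
      (fun u ↦ dForm (fun q ↦ (1 - t) • β q + t • spinForm Φ O.angle ν a b C q) p u)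
      (fun u ↦ by rw [hβc, cov_spinForm hΦ h hp h0, ← hr]; ring)
      (fun u ↦ by
        refine (dForm_segment hβs (smoothFormAt_spinForm_of_ne hΦ h hp h0 hν) _ _ u).trans ?_
        rw [hβd, dForm_spinForm_of_ne hΦ h hp h0 hν hνc, ← hr]
        ring) v
  rw [eθ] at Wθ
  rw [e0] at W0
  rw [et]
  have hk : (0 : ℝ) < ((n - 1 : ℕ) : ℝ) + 1 := by positivity
  have hs : 0 < 1 - t := by linarith [ht.2]
  have hc : 0 < (((n - 1 : ℕ) : ℝ) + 1) * f r ^ (n - 1) := by positivity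
  -- The supporting condition reads `n f^(n-1) (-f') T > 0`, which fixes the sign of the volume
  -- element.
  have hT0 : 0 < T v := by
    refine pos_of_mul_pos_right (b := T v) (a := (((n - 1 : ℕ) : ℝ) + 1) * f r ^ (n - 1) *
      (0 * deriv g r - 1 * deriv f r)) Wθ ?_
    exact mul_nonneg hc.le (by linarith)
  -- Contactness of `β` gives the sign of the Wronskian, now that the sign of `T` is known.
  have hD : 0 < f r * deriv g r - g r * deriv f r := by
    rw [mul_assoc] at W0
    exact pos_of_mul_pos_left (pos_of_mul_pos_right W0 hc.le) hT0.le
  have hE : 0 ≤ f r * deriv b r - b r * deriv f r := by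
    have := mul_nonneg hf0.le (h.deriv_b_nonneg r)
    have := mul_nonneg (h.b_nonneg r) (neg_nonneg.2 hf'.le)
    linarith
  refine mul_pos (mul_pos (by positivity) ?_) hT0
  have : (1 - t) * f r * ((1 - t) * deriv g r + t * deriv b r) -
      ((1 - t) * g r + t * b r) * ((1 - t) * deriv f r) =
      (1 - t) * ((1 - t) * (f r * deriv g r - g r * deriv f r) +
        t * (f r * deriv b r - b r * deriv f r)) := by ring
  rw [this]
  exact mul_pos hs (add_pos_of_pos_of_nonneg (mul_pos hs hD) (mul_nonneg ht.1 hE))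

omit [IsManifold (𝓡 2 * n + 1) ∞ M] [T2Space M] [TopologicalSpace N]
  [ChartedSpace (Model (2 * n - 1)) N] [IsManifold (𝓡 2 * n - 1) ∞ N] [CompactSpace N] in
/-- Near the binding, `r² dθ` is `Im (conj z dz)`. -/
lemma cov_angular_coord (Φ : N × ℂ → M) (p : M) (u : Model (2 * n + 1)) :
    cov (angular (tubeCoord Φ)) p u =
      ‖tubeCoord Φ p‖ ^ 2 * polarTheta (tubeCoord Φ p) (dfun (tubeCoord Φ) p u) := by
  rw [cov_angular, polarTheta]
  by_cases h0 : tubeCoord Φ p = 0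
  · simp [h0]
  · have := norm_ne_zero_iff.2 h0
    field_simp

omit [T2Space M] [CompactSpace N] in
/-- At the binding, the leaves of the spinnable form contain the normal plane of the binding. -/
lemma wedgeD_spinForm_binding (hn : 1 < n) (hΦ : IsTube (n := n) O.incl O.angle Φ)
    (h : IsSpinProfile a b C) (hp : p ∈ Set.range Φ) (h0 : tubeCoord Φ p = 0)
    (hβs : SmoothFormAt β p) (hμ : SmoothFormAt μ (tubeBase Φ p)) (hμ0 : μ (tubeBase Φ p) ≠ 0)
    (hνμ : ∀ v, wedgeD ν μ (n - 1) (tubeBase Φ p) v = 0)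
    (hβ : ∀ᶠ q in 𝓝 p, β q =
      fmul (radial Φ f) (pullback (tubeBase Φ) μ : OneForm (2 * n + 1) M) q +
        angular (tubeCoord Φ) q)
    (hmax : ∀ᶠ q in 𝓝 p, radial Φ f q ≤ radial Φ f p)
    (v : Fin (2 * n + 1) → TangentSpace (𝓡 (2 * n + 1)) p) :
    wedgeD (spinForm Φ O.angle ν a b C) β n p v = 0 := by
  have hπ := hΦ.contMDiffAt_base hp
  have hZ := hΦ.contMDiffAt_coord hp
  have hs := hμ.pullback hπ
  have hne : cov (pullback (tubeBase Φ) μ : OneForm (2 * n + 1) M) p ≠ 0 := by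
    obtain ⟨⟨x, z⟩, rfl⟩ := hp
    intro hz
    refine hμ0 (ContinuousLinearMap.ext fun w ↦ ?_)
    obtain ⟨u, hu⟩ : ∃ u : Model (2 * n + 1), dbase Φ (Φ (x, z)) u = w :=
      ⟨_, hΦ.mfderiv_base x z w 0⟩
    have := congrArg (fun S : Model (2 * n + 1) →L[ℝ] ℝ ↦ S u) hz
    simp only [cov_pullback_base, hu] at this
    exact this
  -- One-sided smoothness of `f` on `[0, 1]` does not make `f(|z|)` smooth at `z = 0`. It is smooth
  -- because `f μ = β - r² dθ` is a smooth form and `μ` is nonzero.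
  have hF : ContMDiffAt (𝓡 (2 * n + 1)) 𝓘(ℝ, ℝ) ∞ (radial Φ f) p := by
    refine contMDiffAt_of_fmul (hβs.add ((smoothFormAt_angular hZ).fmul
      (f := fun _ ↦ (-1 : ℝ)) contMDiffAt_const)) hs hne ?_
    filter_upwards [hβ] with q hq
    refine (congrArg (· + _) hq).trans ?_
    rw [fmul, fmul, add_assoc, show ∀ x : TangentSpace (𝓡 (2 * n + 1)) q →L[ℝ] Bundle.Trivial M ℝ q,
      x + (-1 : ℝ) • x = 0 from fun x ↦ by module, add_zero]
  have hdF := dfun_eq_zero_of_isLocalMax hF hmax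
  have hνc : ∀ u, cov (spinForm Φ O.angle ν a b C) p u =
      cov ν (tubeBase Φ p) (dbase Φ p u) :=
    cov_spinForm_core hΦ h hp (by rw [h0, norm_zero]; norm_num)
  obtain ⟨D, hD⟩ : ∃ D : Model (2 * n - 1) [⋀^Fin 2]→L[ℝ] ℝ, D = dForm μ (tubeBase Φ p) :=
    ⟨_, rfl⟩
  -- Since `df = 0` on the core, `dβ = f dμ + 2 dx ∧ dy` there; the factor 2 is put into the first
  -- Cartesian covector.
  refine wedgePow_binding (k := n - 1) (m := 2 * n - 1) (by omega) (by omega) (dbase Φ p)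
    D (cov ν (tubeBase Φ p)) (hD ▸ hνμ)
    ((2 : ℝ) • Complex.reCLM.comp (dfun (tubeCoord Φ) p))
    (Complex.imCLM.comp (dfun (tubeCoord Φ) p)) (radial Φ f p) hνc (fun u ↦ ?_) v
  have e : dForm (pullback (tubeBase Φ) μ : OneForm (2 * n + 1) M) p u =
    D (fun i ↦ dbase Φ p (u i)) := by rw [hD]; exact dForm_pullback hμ hπ u
  rw [dForm_congr hβ, dForm_add (hs.fmul hF) (smoothFormAt_angular hZ), dForm_fmul hs hF, e,
    dForm_angular hZ, cov_diff, hdF]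
  simp only [zero_apply, FunLike.coe_smul, Pi.smul_apply, ContinuousLinearMap.comp_apply,
    Complex.reCLM_apply, Complex.imCLM_apply, smul_eq_mul]
  ring

end Positivity

/-! ### Local expressions of the axisymmetric form and assembly of the deformation. -/

section Deformation

open Filter Topology

variable {n : ℕ}
  {M : Type*} [TopologicalSpace M] [ChartedSpace (Model (2 * n + 1)) M]
  [IsManifold (𝓡 (2 * n + 1)) ∞ M] [T2Space M]
  {N : Type*} [TopologicalSpace N] [ChartedSpace (Model (2 * n - 1)) N]
  [IsManifold (𝓡 (2 * n - 1)) ∞ N] [CompactSpace N]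
  {O : OpenBook n M N} {Φ : N × ℂ → M} {p : M}
  {μ ν : OneForm (2 * n - 1) N} {f g a b C : ℝ → ℝ} {β : OneForm (2 * n + 1) M}

omit [IsManifold (𝓡 2 * n + 1) ∞ M] [T2Space M] [IsManifold (𝓡 2 * n - 1) ∞ N] [CompactSpace N] in
lemma eventually_eq_radial_sum [Nonempty N] (hΦ : IsTube (n := n) O.incl O.angle Φ)
    (hβ : ∀ (x : N) (z : ℂ), ‖z‖ ≤ 1 → ∀ (v : TangentSpace (𝓡 (2 * n - 1)) x) (w : ℂ),
      β (Φ (x, z)) (mfderiv ((𝓡 (2 * n - 1)).prod 𝓘(ℝ, ℂ)) (𝓡 (2 * n + 1)) Φ (x, z) (v, w)) =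
        f ‖z‖ * μ x v + g ‖z‖ * polarTheta z w)
    (hp : p ∈ Set.range Φ) (h0 : tubeCoord Φ p ≠ 0) (h1 : ‖tubeCoord Φ p‖ < 1) :
    ∀ᶠ q in 𝓝 p, β q = fmul (radial Φ f) (pullback (tubeBase Φ) μ : OneForm (2 * n + 1) M) q +
      fmul (radial Φ g) (angleForm O.angle) q := by
  have hc := (hΦ.contMDiffAt_coord hp).continuousAt
  filter_upwards [hΦ.isOpen_range.mem_nhds hp, hc.eventually_ne h0,
    hc.norm.eventually_lt_const h1] with q hq hq0 hq1
  refine ContinuousLinearMap.ext fun (u : Model (2 * n + 1)) ↦ ?_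
  have h := hΦ.cov_eq (F := fun z ↦ f ‖z‖) (h := fun z w ↦ g ‖z‖ * polarTheta z w)
    (s := {z | ‖z‖ ≤ 1}) hβ hq hq1.le u
  rw [← hΦ.cov_angleForm hq hq0] at h
  exact h

-- Because `g = r²` near `0`, the term `g dθ` equals `Im (conj z dz)`, a form that is also defined
-- and smooth on the core.
omit [IsManifold (𝓡 2 * n + 1) ∞ M] [T2Space M] [IsManifold (𝓡 2 * n - 1) ∞ N] [CompactSpace N] in
lemma eventually_eq_binding [Nonempty N] (hΦ : IsTube (n := n) O.incl O.angle Φ)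
    (hβ : ∀ (x : N) (z : ℂ), ‖z‖ ≤ 1 → ∀ (v : TangentSpace (𝓡 (2 * n - 1)) x) (w : ℂ),
      β (Φ (x, z)) (mfderiv ((𝓡 (2 * n - 1)).prod 𝓘(ℝ, ℂ)) (𝓡 (2 * n + 1)) Φ (x, z) (v, w)) =
        f ‖z‖ * μ x v + g ‖z‖ * polarTheta z w)
    (hp : p ∈ Set.range Φ) (h0 : tubeCoord Φ p = 0) {ε : ℝ} (hε : ε ∈ Set.Ioo (0 : ℝ) 1)
    (hg : ∀ r ∈ Set.Icc 0 ε, g r = r ^ 2) :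
    ∀ᶠ q in 𝓝 p, β q = fmul (radial Φ f) (pullback (tubeBase Φ) μ : OneForm (2 * n + 1) M) q +
      angular (tubeCoord Φ) q := by
  have hc := (hΦ.contMDiffAt_coord hp).continuousAt
  filter_upwards [hΦ.isOpen_range.mem_nhds hp,
    hc.norm.eventually_lt_const (show ‖tubeCoord Φ p‖ < ε by rw [h0, norm_zero]; exact hε.1)] with q hq hq1
  refine ContinuousLinearMap.ext fun (u : Model (2 * n + 1)) ↦ ?_
  have h := hΦ.cov_eq (F := fun z ↦ f ‖z‖) (h := fun z w ↦ g ‖z‖ * polarTheta z w)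
    (s := {z | ‖z‖ ≤ 1}) hβ hq (hq1.le.trans hε.2.le) u
  beta_reduce at h
  rw [hg _ ⟨norm_nonneg _, hq1.le⟩, ← cov_angular_coord] at h
  exact h

omit [T2Space M] [CompactSpace N] in
/-- A segment from a contact form to a nowhere vanishing integrable form. -/
lemma exists_deformation_of_segment (hn : 0 < n) {α η : OneForm (2 * n + 1) M}
    (hα : IsContactForm n α) (hβ : IsSmooth β) (hη : IsSmooth η) (h0 : ∀ p, η p ≠ 0)
    (hi : ∀ p v, wedgeD η η 1 p v = 0)
    (hW : ∀ t ∈ Set.Ico (0 : ℝ) 1, ∀ p v, 0 < wedgeD α α n p v →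
      0 < wedgeD (fun q ↦ (1 - t) • β q + t • η q) (fun q ↦ (1 - t) • β q + t • η q) n p v)
    (hs : O.IsSpinnable η) :
    ∃ A : ℝ → OneForm (2 * n + 1) M, IsSmoothFamilyOn A (Set.Icc 0 1) ∧ A 0 = β ∧
      (∀ t ∈ Set.Ico (0 : ℝ) 1, IsContactForm n (A t) ∧
        ∀ p v, 0 < wedgeD α α n p v → 0 < wedgeD (A t) (A t) n p v) ∧
      (∀ p, A 1 p ≠ 0) ∧ (∀ p v, wedgeD (A 1) (A 1) 1 p v = 0) ∧ O.IsSpinnable (A 1) := by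
  obtain ⟨A, hA⟩ : ∃ A : ℝ → OneForm (2 * n + 1) M, A = fun t p ↦ (1 - t) • β p + t • η p :=
    ⟨_, rfl⟩
  have hA1 : A 1 = η := by
    rw [hA]
    funext p
    simp
  refine ⟨A, hA ▸ isSmoothFamilyOn_segment hβ hη _, ?_, fun t ht ↦ ⟨⟨?_, fun p ↦ ?_⟩,
    hA ▸ hW t ht⟩, hA1 ▸ h0, hA1 ▸ hi, hA1 ▸ hs⟩
  · rw [hA]
    funext p
    simp
  · rw [isSmooth_iff] at hβ hη ⊢
    exact hA ▸ fun p ↦ smoothFormAt_segment (hβ p) (hη p) _ _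
  · obtain ⟨v, hv⟩ := hα.2 p
    obtain ⟨w, hw⟩ := exists_wedgePow_pos (β := cov α p) hn hv
    exact ⟨w, hA ▸ (hW t ht p w hw).ne'⟩

omit [IsManifold (𝓡 2 * n + 1) ∞ M] [T2Space M] in
lemma OpenBook.isSpinnable_of_leaves {η : OneForm (2 * n + 1) M} [T2Space N]
    (hΦ : IsTube (n := n) O.incl O.angle Φ) (h : IsSpinProfile a b C)
    (hν : IsSmooth ν) (hν0 : ∀ x, ν x ≠ 0) (hνc : ∀ x, dForm ν x = 0)
    (h1 : ∀ (x : N) (z : ℂ) (v : TangentSpace (𝓡 (2 * n - 1)) x) (w : ℂ),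
      η (Φ (x, z)) (mfderiv ((𝓡 (2 * n - 1)).prod 𝓘(ℝ, ℂ)) (𝓡 (2 * n + 1)) Φ (x, z) (v, w)) =
        a ‖z‖ * ν x v + b ‖z‖ * polarTheta z w + deriv C ‖z‖ * polarR z w)
    (h2 : ∀ p, (∀ (x : N) (z : ℂ), ‖z‖ ≤ 1 → Φ (x, z) ≠ p) → η p = angleForm O.angle p) :
    O.IsSpinnable η where
  fibred := exists_submersion_circle hν hν0 hνc
  leaves := by
    refine ⟨Φ, ν, a, b, deriv C, hΦ, hν, hν0, hνc, h.contDiff_a, h.contDiff_b,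
      (contDiff_infty_iff_deriv.1 h.contDiff_C).2, fun r hr ↦ h.a_pos r hr.2,
      fun r hr ↦ h.a_zero r hr.1, fun r hr ↦ h.b_zero r hr.2, fun r hr ↦ h.b_pos r hr.1,
      by rw [h.deriv_C]; exact one_ne_zero, ⟨1 / 8, by norm_num, fun r hr ↦ ?_⟩,
      fun x z _ ↦ h1 x z, fun p hp ↦ ⟨1, one_pos, by rw [one_smul]; exact h2 p hp⟩⟩
    refine h.deriv_C_zero (hr.imp (fun hr ↦ ?_) fun hr ↦ ?_)
    · linarith [hr.2]
    · linarith [hr.1]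

end Deformation

end ContactFoliation

end


/-! ### The main theorem. -/

open ContactFoliation Filter Topology in
theorem mainTheorem1 {n : ℕ} (hn : 1 < n)
    {M : Type*} [TopologicalSpace M] [ChartedSpace (ContactFoliation.Model (2 * n + 1)) M]
    [IsManifold (𝓡 (2 * n + 1)) ∞ M] [CompactSpace M] [T2Space M]
    {N : Type*} [TopologicalSpace N] [ChartedSpace (ContactFoliation.Model (2 * n - 1)) N]
    [IsManifold (𝓡 (2 * n - 1)) ∞ N] [CompactSpace N] [T2Space N]
    (O : ContactFoliation.OpenBook n M N)
    (α : ContactFoliation.OneForm (2 * n + 1) M) (hα : ContactFoliation.IsContactForm n α)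
    (ρ : M → ℝ) (hρ : O.Supports α ρ) (hax : O.IsAxisymmetric (ContactFoliation.fmul ρ α))
    (ν : ContactFoliation.OneForm (2 * n - 1) N) (hν : ContactFoliation.IsSmooth ν)
    (hν_ne : ∀ x, ν x ≠ 0) (hν_closed : ∀ x, ContactFoliation.dForm ν x = 0)
    (hν_wedge : ∀ x v, ContactFoliation.wedgeD ν
      (ContactFoliation.pullback O.incl (ContactFoliation.fmul ρ α)) (n - 1) x v = 0) :
    ∃ A : ℝ → ContactFoliation.OneForm (2 * n + 1) M,
      ContactFoliation.IsSmoothFamilyOn A (Set.Icc 0 1) ∧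
      A 0 = ContactFoliation.fmul ρ α ∧
      (∀ t ∈ Set.Ico (0 : ℝ) 1, ContactFoliation.IsContactForm n (A t) ∧
        ∀ p v, 0 < ContactFoliation.wedgeD α α n p v →
          0 < ContactFoliation.wedgeD (A t) (A t) n p v) ∧
      (∀ p, A 1 p ≠ 0) ∧
      (∀ p v, ContactFoliation.wedgeD (A 1) (A 1) 1 p v = 0) ∧
      O.IsSpinnable (A 1) := by
  obtain ⟨a, b, C, h⟩ := exists_isSpinProfile
  have hαs := (isSmooth_iff α).1 hα.1
  have hβs : ∀ p, SmoothFormAt (fmul ρ α) p := fun p ↦ (hαs p).fmul (hρ.smooth p)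
  have hνs := (isSmooth_iff ν).1 hν
  have hW0 : ∀ p v, 0 < wedgeD α α n p v → 0 < wedgeD (fmul ρ α) (fmul ρ α) n p v := fun p v hv ↦ by
    rw [wedgeD_fmul (hαs p) (hρ.smooth p)]
    exact mul_pos (pow_pos (hρ.pos p) _) hv
  -- Wherever the target form is closed, `η ∧ (dβ)^n ≥ 0` suffices; at the binding it is an
  -- equality.
  have hclosed : ∀ {η : OneForm (2 * n + 1) M} {p : M}, SmoothFormAt η p →
      (∀ u, dForm η p u = 0) → ∀ {t : ℝ}, t ∈ Set.Ico (0 : ℝ) 1 → ∀ {v}, 0 < wedgeD α α n p v →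
      0 ≤ wedgeD η (fmul ρ α) n p v →
      0 < wedgeD (fun q ↦ (1 - t) • fmul ρ α q + t • η q)
        (fun q ↦ (1 - t) • fmul ρ α q + t • η q) n p v := by
    intro η p hη h0 t ht v hv hv'
    rw [wedgeD_segment_of_closed (hβs p) hη h0]
    have hs : 0 < 1 - t := by linarith [ht.2]
    exact mul_pos (pow_pos hs n) (add_pos_of_pos_of_nonneg (mul_pos hs (hW0 p v hv))
      (mul_nonneg ht.1 hv'))
  -- With empty binding there are no tube coordinates; `dθ` is a global closed nowhere vanishing
  -- form and serves as the target.
  rcases isEmpty_or_nonempty N with hN | hN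
  · have hb : ∀ p, p ∉ Set.range O.incl := fun p ⟨x, _⟩ ↦ hN.elim x
    obtain ⟨Φ, hΦ⟩ := O.exists_tube
    refine exists_deformation_of_segment (η := angleForm O.angle) (by omega) hα
      ((isSmooth_iff _).2 hβs) ((isSmooth_iff _).2 fun p ↦ O.smoothFormAt_angleForm (hb p))
      (fun p ↦ O.submersion p (hb p))
      (fun p v ↦ wedgePow_zero _ (O.dForm_angleForm (hb p)) one_ne_zero v)
      (fun t ht p v hv ↦ hclosed (O.smoothFormAt_angleForm (hb p)) (O.dForm_angleForm (hb p)) ht hv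
        (hρ.pages p (hb p) v hv).le)
      (O.isSpinnable_of_leaves hΦ h hν hν_ne hν_closed (fun x ↦ hN.elim x) fun _ _ ↦ rfl)
  · obtain ⟨Φ, f, g, hΦ, hf, hg, hf0, hf', -, ⟨ε, hε, hgε, -⟩, hβ⟩ := hax
    have hηs := smoothFormAt_spinForm hΦ h hνs
    have hμs : ∀ x, SmoothFormAt (pullback O.incl (fmul ρ α) : OneForm (2 * n - 1) N) x :=
      fun x ↦ (hβs _).pullback (hΦ.contMDiff_incl x)
    have hμ0 : ∀ x, (pullback O.incl (fmul ρ α) : OneForm (2 * n - 1) N) x ≠ 0 := fun x hx ↦ by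
      obtain ⟨v, hv⟩ := hρ.contact_binding.2 x
      have e : ∀ u, cov (pullback O.incl α : OneForm (2 * n - 1) N) x u = 0 := fun u ↦ by
        have : ρ (O.incl x) * cov (pullback O.incl α : OneForm (2 * n - 1) N) x u = 0 :=
          congrArg (fun S : Model (2 * n - 1) →L[ℝ] ℝ ↦ S u) hx
        exact (mul_eq_zero.1 this).resolve_left (hρ.pos _).ne'
      apply hv
      simp only [wedgeD, wedgePow]
      rw [Finset.sum_eq_zero, mul_zero]
      intro σ _
      rw [show (pullback O.incl α : OneForm (2 * n - 1) N) x (v (σ 0)) = 0 from e _]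
      simp
    -- Makes the binding a local maximum of `f(|z|)`, whence its differential vanishes there.
    have hanti : AntitoneOn f (Set.Icc 0 1) := by
      refine antitoneOn_of_deriv_nonpos (convex_Icc 0 1) hf.continuousOn
        ((hf.differentiableOn (by simp)).mono interior_subset) fun r hr ↦ ?_
      rw [interior_Icc] at hr
      rw [← derivWithin_of_mem_nhds (Icc_mem_nhds hr.1 hr.2)]
      exact (hf' r ⟨hr.1, hr.2.le⟩).le
    refine exists_deformation_of_segment (by omega) hα ((isSmooth_iff _).2 hβs)
      ((isSmooth_iff _).2 hηs) (spinForm_ne_zero hΦ h hν_ne)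
      (wedgeD_spinForm hΦ h hνs hν_closed) (fun t ht p v hv ↦ ?_)
      (O.isSpinnable_of_leaves hΦ h hν hν_ne hν_closed (spinForm_mfderiv hΦ h) fun p hp ↦
        (spinForm_eventuallyEq_outer hΦ h fun x z hz ↦ hp x z (by linarith)).self_of_nhds)
    -- Beyond radius `3/4` the target is `dθ` and closed. Splitting there keeps the polar
    -- computation strictly inside `0 < r < 1`, where the one-sided derivatives of `f` and `g` are
    -- genuine.
    by_cases hp : ∃ x z, ‖z‖ ≤ 3 / 4 ∧ Φ (x, z) = p
    · obtain ⟨x, z, hz, rfl⟩ := hp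
      have hc := hΦ.coord_apply x z
      have hp : Φ (x, z) ∈ Set.range Φ := ⟨_, rfl⟩
      by_cases h0 : z = 0
      · refine hclosed (hηs _) (dForm_spinForm_core hΦ h hνs hν_closed hp
          (by rw [hc, h0, norm_zero]; norm_num)) ht hv (wedgeD_spinForm_binding hn hΦ h hp
          (hc.trans h0) (hβs _) (hμs _) (hμ0 _) (hν_wedge _)
          (eventually_eq_binding hΦ hβ hp (hc.trans h0) hε hgε) ?_ v).ge
        filter_upwards [(hΦ.contMDiffAt_coord hp).continuousAt.norm.eventually_lt_const
          (show ‖tubeCoord Φ (Φ (x, z))‖ < 1 by rw [hc, h0, norm_zero]; exact one_pos)] with q hq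
        have hn0 : ‖tubeCoord Φ (Φ (x, z))‖ = 0 := by rw [hc, h0, norm_zero]
        exact hanti ⟨hn0.ge, hn0.trans_le zero_le_one⟩ ⟨norm_nonneg _, hq.le⟩
          (hn0.trans_le (norm_nonneg _))
      · have hr : ‖tubeCoord Φ (Φ (x, z))‖ ∈ Set.Ioo (0 : ℝ) 1 := by
          rw [hc]
          exact ⟨norm_pos_iff.2 h0, by linarith⟩
        have hc0 : tubeCoord Φ (Φ (x, z)) ≠ 0 := by rwa [hc]
        have hI := Icc_mem_nhds hr.1 hr.2
        exact wedgeD_segment_pos_of_ne hn hΦ h hp hc0 (hμs _) (hνs _) (hν_closed _) (hν_wedge _)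
          (hf.contDiffAt hI) (hg.contDiffAt hI) (hf0 _ ⟨hr.1.le, hr.2.le⟩)
          (by rw [← derivWithin_of_mem_nhds hI]; exact hf' _ ⟨hr.1, hr.2.le⟩)
          (eventually_eq_radial_sum hΦ hβ hp hc0 hr.2) ht (hW0 _ v hv)
          (hρ.pages _ (hΦ.notMem_binding fun _ ↦ hc0) v hv)
    · have hp' : ∀ x z, ‖z‖ ≤ 3 / 4 → Φ (x, z) ≠ p := fun x z hz e ↦ hp ⟨x, z, hz, e⟩
      have hb : p ∉ Set.range O.incl := by
        rintro ⟨x, rfl⟩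
        exact hp' x 0 (by norm_num) (hΦ.zero_section x)
      refine hclosed (hηs p) (dForm_spinForm_outer hΦ h hp') ht hv ?_
      have e := (spinForm_eventuallyEq_outer (ν := ν) hΦ h hp').self_of_nhds
      rw [wedgeD, e]
      exact (hρ.pages p hb v hv).le
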